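/- Let $\alpha\in\mathbb R$. For $x>0$ put $f_\alpha(x)=\frac{4}{1-\alpha^2}\bigl(1-x^{(1+\alpha)/2}\bigr)+\frac{2}{1-\alpha}(x-1)$ if $\alpha\neq\pm1$, $f_1(x)=x\log x+1-x$, $f_{-1}(x)=-\log x+x-1$, and let $f_\alpha(0)=\lim_{x\downarrow0}f_\alpha(x)\in[0,\infty]$. For probability vectors $m$ (positive) and $\hat m$, indexed by $0,\dots,p$, let $\overset{\alpha}{D}[m:\hat m]=\sum_{i=0}^p m_if_\alpha(\hat m_i/m_i)$ and $\overset{|\alpha|}{D}=\frac12\bigl(\overset{\alpha}{D}+\overset{-\alpha}{D}\bigr)$. Let $\mu$ be a probability distribution on $\mathbb R$ that is absolutely continuous with respect to Lebesgue measure, and let $X_1,\dots,X_n$ be an i.i.d. sample from $\mu$ with order statistics $X_{(1)}\le\dots\le X_{(n)}$. Fixed intervals. Let $-\infty=a_0<a_1<\dots<a_p<a_{p+1}=\infty$ be such that $m_i=\mu((a_i,a_{i+1}))>0$ for $i=0,\dots,p$, and let $\hat m_i=\#\{j: X_j\in(a_i,a_{i+1})\}/n$. Let $\overset{|\alpha|}{ED}_I(n)=E\bigl[\overset{|\alpha|}{D}[m:\hat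 m]\bigr]\in[0,\infty]$, and let $\overset{|\alpha|}{ED}{}^{+}_I(n)=E\bigl[\overset{|\alpha|}{D}[m:\hat m];\ \hat m_i>0\text{ for all }i\bigr]$ be its part from the samples that leave no interval empty. Moving intervals. Let $\lambda_i=i/(p+1)$, $1\le i\le p$, so that $m_i=\lambda_{i+1}-\lambda_i=1/(p+1)$ for $i=0,\dots,p$ (with $\lambda_0=0$, $\lambda_{p+1}=1$). Choose $n_1,\dots,n_p$ at random, independently of each other and of the sample, with $P(n_i=\lfloor n\lambda_i\rfloor)=1+\bar r_i$ and $P(n_i=\lfloor n\lambda_i\rfloor+1)=-\bar r_i$, where $\bar r_i=\lfloor n\lambda_i\rfloor-n\lambda_i$. Let $\hat m_i=\mu((\hat\xi_i,\hat\xi_{i+1}))$ with $\hat\xi_i=X_{(n_i)}$, $1\le i\le p$, $\hat\xi_0=-\infty$, $\hat\xi_{p+1}=\infty$, and let $\overset{|\alpha|}{ED^*_P}(n)=E\bigl[\overset{|\alpha|}{D}[m:\hat m]\bigr]$, the expectation being over the sample and the $n_i$. Then, up to the $n^{-2}$ term, $\overset{|\alpha|}{ED}_I\ge\overset{|\alpha|}{ED^*_P}$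 for every choice of the fixed intervals. Precisely: there is a sequence $(d_n)$ depending only on $p$ and $\alpha$ such that, for every $\mu$, $$\overset{|\alpha|}{ED^*_P}(n)=\frac{p}{2n}+\frac{d_n}{n^2}+o(n^{-2}),$$ and for every $\mu$ and all such $a_1,\dots,a_p$ there is a constant $c$ with $c\ge d_n$ for all $n$ and $$\overset{|\alpha|}{ED}{}^{+}_I(n)=\frac{p}{2n}+\frac{c}{n^2}+o(n^{-2}),$$ where, if $|\alpha|<1$, the same expansion holds for $\overset{|\alpha|}{ED}_I(n)$ itself. Moreover, for every $\alpha\in\mathbb R$ and every $\varepsilon>0$, $\overset{|\alpha|}{ED^*_P}(n)\le\overset{|\alpha|}{ED}_I(n)+\varepsilon n^{-2}$ for all sufficiently large $n$. -/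

import Mathlib

open scoped ENNReal
open Filter Asymptotics MeasureTheory

noncomputable section

namespace Discretization

/-- The function `f_α` of the `α`-divergence. For `α ≤ -1` the formula is meant for `0 < x` only. -/
def fAlpha (α x : ℝ) : ℝ :=
  if α = 1 then x * Real.log x + 1 - x
  else if α = -1 then -Real.log x + x - 1
  else 4 / (1 - α ^ 2) * (1 - x ^ ((1 + α) / 2)) + 2 / (1 - α) * (x - 1)

/-- `f_α` on `[0, ∞)` with values in `[0, ∞]`: at `0` it takes its limit from the right,
which is `∞` exactly when `α ≤ -1`. -/
def fAlphaExt (α x : ℝ) : ℝ≥0∞ :=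
  if x = 0 ∧ α ≤ -1 then ⊤ else ENNReal.ofReal (fAlpha α x)

/-- `f_α` is nonnegative, so that `ENNReal.ofReal` truncates nothing above. -/
theorem fAlpha_nonneg (α x : ℝ) (hx : 0 ≤ x) (h : 0 < x ∨ -1 < α) : 0 ≤ fAlpha α x := by
  unfold fAlpha
  split_ifs with h1 h2
  · rcases hx.eq_or_lt with rfl | hx'
    · norm_num
    · have h3 := Real.log_le_sub_one_of_pos (inv_pos.2 hx')
      rw [Real.log_inv] at h3
      have h4 : x * (-Real.log x) ≤ x * (x⁻¹ - 1) := mul_le_mul_of_nonneg_left h3 hx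
      rw [mul_sub, mul_inv_cancel₀ hx'.ne'] at h4
      linarith
  · have hx' : 0 < x := h.resolve_right (by rw [h2]; exact lt_irrefl _)
    have h3 := Real.log_le_sub_one_of_pos hx'
    linarith
  · have hm : 1 - α ≠ 0 := fun e => h1 (by linarith)
    have hp : 1 + α ≠ 0 := fun e => h2 (by linarith)
    have key : 4 / (1 - α ^ 2) * (1 - x ^ ((1 + α) / 2)) + 2 / (1 - α) * (x - 1)
        = 4 * (1 + (1 + α) / 2 * (x - 1) - x ^ ((1 + α) / 2)) / ((1 - α) * (1 + α)) := by
      rw [show 1 - α ^ 2 = (1 - α) * (1 + α) by ring]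
      field_simp
      ring
    rw [key]
    rcases lt_or_gt_of_ne hp with hp' | hp'
    · have hx' : 0 < x := h.resolve_right (by linarith)
      have h3 := one_add_mul_self_le_rpow_one_add (s := x⁻¹ - 1) (p := (1 - α) / 2)
        (by have := inv_pos.2 hx'; linarith) (by linarith)
      rw [show 1 + (x⁻¹ - 1) = x⁻¹ by ring, Real.inv_rpow hx, ← Real.rpow_neg hx] at h3
      have h4 := mul_le_mul_of_nonneg_left h3 hx
      have h5 : x * x ^ (-((1 - α) / 2)) = x ^ ((1 + α) / 2) := by
        rw [← Real.rpow_one_add' hx (by intro e; apply hp; linarith)]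
        congr 1
        ring
      have h6 : x * (1 + (1 - α) / 2 * (x⁻¹ - 1)) = 1 + (1 + α) / 2 * (x - 1) := by
        field_simp
        ring
      rw [h5, h6] at h4
      apply div_nonneg_of_nonpos
      · linarith
      · exact (mul_neg_of_pos_of_neg (by linarith) hp').le
    · rcases lt_or_gt_of_ne hm with hm' | hm'
      · have h3 := one_add_mul_self_le_rpow_one_add (s := x - 1) (p := (1 + α) / 2)
          (by linarith) (by linarith)
        rw [show 1 + (x - 1) = x by ring] at h3
        apply div_nonneg_of_nonpos
        · linarith
        · exact (mul_neg_of_neg_of_pos hm' hp').le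
      · have h3 := rpow_one_add_le_one_add_mul_self (s := x - 1) (p := (1 + α) / 2)
          (by linarith) (by linarith) (by linarith)
        rw [show 1 + (x - 1) = x by ring] at h3
        apply div_nonneg
        · linarith
        · exact (mul_pos hm' hp').le

variable {p n : ℕ}

/-- The `α`-divergence `∑ m_i f_α(m'_i / m_i)` of two probability vectors, `m` being positive. -/
def alphaDiv (α : ℝ) (m m' : Fin (p + 1) → ℝ) : ℝ≥0∞ :=
  ∑ i, ENNReal.ofReal (m i) * fAlphaExt α (m' i / m i)

/-- The symmetrized divergence: the mean of the `α`- and the `-α`-divergence. -/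
def symDiv (α : ℝ) (m m' : Fin (p + 1) → ℝ) : ℝ≥0∞ :=
  (alphaDiv α m m' + alphaDiv (-α) m m') / 2

/-- The sequence `lo, a_1, …, a_p, hi`, indexed by `0, …, p + 1`. -/
def withEnds {β : Type*} (lo hi : β) (a : Fin p → β) : Fin (p + 2) → β :=
  Fin.cons lo (Fin.snoc a hi : Fin (p + 1) → β)

/-- The `i`-th open interval cut out by `-∞, a_1, …, a_p, ∞`. -/
def cell (a : Fin p → EReal) (i : Fin (p + 1)) : Set ℝ :=
  {x | withEnds ⊥ ⊤ a i.castSucc < (x : EReal) ∧ (x : EReal) < withEnds ⊥ ⊤ a i.succ}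

/-- The vector of the probabilities of the intervals. -/
def cellProb (μ : Measure ℝ) (a : Fin p → EReal) (i : Fin (p + 1)) : ℝ :=
  μ.real (cell a i)

/-- The law of an i.i.d. sample of size `n` from `μ`. -/
def sampleLaw (μ : Measure ℝ) (n : ℕ) : Measure (Fin n → ℝ) :=
  Measure.pi fun _ => μ

open Classical in
/-- The relative frequencies of the intervals in the sample `x`. -/
def empirical (a : Fin p → EReal) (x : Fin n → ℝ) (i : Fin (p + 1)) : ℝ :=
  (Finset.univ.filter fun j => x j ∈ cell a i).card / n

/-- Risk of the fixed interval method with endpoints `a` and sample size `n`. -/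
def riskFixed (μ : Measure ℝ) (a : Fin p → ℝ) (α : ℝ) (n : ℕ) : ℝ≥0∞ :=
  ∫⁻ x, symDiv α (cellProb μ fun i => (a i : EReal)) (empirical (fun i => (a i : EReal)) x)
    ∂sampleLaw μ n

/-- The part of the risk of the fixed interval method that comes from the samples which leave
no interval empty (the divergence may be infinite on the other samples). -/
def riskFixedNonempty (μ : Measure ℝ) (a : Fin p → ℝ) (α : ℝ) (n : ℕ) : ℝ≥0∞ :=
  ∫⁻ x in {x : Fin n → ℝ | ∀ i, 0 < empirical (fun i => (a i : EReal)) x i},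
    symDiv α (cellProb μ fun i => (a i : EReal)) (empirical (fun i => (a i : EReal)) x)
    ∂sampleLaw μ n

/-- The order statistic `x_(k)`, `1 ≤ k ≤ n`, of the sample `x`;
`-∞` for `k = 0` and `∞` for `k > n`. -/
def orderStat (x : Fin n → ℝ) (k : ℕ) : EReal :=
  if k = 0 then ⊥
  else if h : k - 1 < n then ((x (Tuple.sort x ⟨k - 1, h⟩) : ℝ) : EReal)
  else ⊤

/-- The nominal probabilities `lam_(i+1) - lam_i`, where `lam_0 = 0` and `lam_(p+1) = 1`. -/
def gaps (lam : Fin p → ℝ) (i : Fin (p + 1)) : ℝ :=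
  withEnds 0 1 lam i.succ - withEnds 0 1 lam i.castSucc

/-- Risk of the moving interval method when the endpoints are the order statistics
with the ranks `k_1, …, k_p`. -/
def riskMovingAt (μ : Measure ℝ) (lam : Fin p → ℝ) (α : ℝ) (n : ℕ) (k : Fin p → ℕ) : ℝ≥0∞ :=
  ∫⁻ x, symDiv α (gaps lam) (cellProb μ fun i => orderStat x (k i)) ∂sampleLaw μ n

/-- `⌊n t⌋ - n t`, which lies in `(-1, 0]`. -/
def rBar (n : ℕ) (t : ℝ) : ℝ := (⌊(n : ℝ) * t⌋₊ : ℝ) - n * t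

/-- The rank `⌊n t⌋` or `⌊n t⌋ + 1`. -/
def rank (n : ℕ) (t : ℝ) (b : Bool) : ℕ := ⌊(n : ℝ) * t⌋₊ + b.toNat

/-- The probability with which the rank `rank n t b` is chosen. -/
def rankProb (n : ℕ) (t : ℝ) (b : Bool) : ℝ := if b then -rBar n t else 1 + rBar n t

/-- Risk of the moving interval method for the randomized choice of the ranks: each `n_i` is,
independently of the others and of the sample, `⌊n lam_i⌋` with probability `1 + rBar` and
`⌊n lam_i⌋ + 1` with probability `-rBar`. -/
def riskMoving (μ : Measure ℝ) (lam : Fin p → ℝ) (α : ℝ) (n : ℕ) : ℝ≥0∞ :=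
  ∑ b : Fin p → Bool, ENNReal.ofReal (∏ i, rankProb n (lam i) (b i)) *
    riskMovingAt μ lam α n fun i => rank n (lam i) (b i)

/-- `R n = p / (2 n) + c n / n ^ 2 + o(n ^ (-2))` as `n → ∞`, with `R n` finite for large `n`. -/
def SecondOrderExpansion (p : ℕ) (R : ℕ → ℝ≥0∞) (c : ℕ → ℝ) : Prop :=
  (∀ᶠ n in atTop, R n ≠ ⊤) ∧
    (fun n : ℕ => (R n).toReal - ((p : ℝ) / (2 * n) + c n / (n : ℝ) ^ 2))
      =o[atTop] fun n : ℕ => ((n : ℝ) ^ 2)⁻¹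

end Discretization

end

noncomputable section

namespace Discretization

open Topology

/-! Both risks are sums over intervals of `m * E[symF α Y]`, where `Y` is the ratio of estimated to
nominal probability. Since the second derivative of `f_α` is `x ^ ((α - 3) / 2)`, the symmetrized
function is `(x-1)^2/2 - (x-1)^3/4 + (α^2+15)/96 * (x-1)^4` near `1`, up to a remainder bounded on
`(0, M]` by `ε * (x-1)^4 + C * (x-1)^6 * x⁻¹^q` (`symF_remainder`). The fourth moment of `Y - 1` is
`O(n⁻²)` and the weighted sixth moment is `O(n⁻³)`, so the coefficient of `n⁻²` is read off from the
moments of orders two to four.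

Fixed intervals: the counts are binomial, so the moments are explicit. Where no interval is empty,
`Y⁻¹ ≤ n`, and higher moments pay for this; empty intervals have probability `O(n⁻³)`. The resulting
coefficient has the form `(α^2+7)/32 * ∑ 1/m_i + const`, hence is smallest for equal `m_i`, with
value `p((α^2+7)p+8)/32` (`fixedConst_ge`).

Moving intervals: a spacing with rank difference `s` has a beta law with parameters `s` and `n + 1 -
s`, whatever the atomless `μ`. This comes from a size-biasing identity (`lintegral_spacing_mul`): a
new point falls into a spacing with probability equal to its size, and by exchangeability it may be
any of the points found there. The identity yields all moments, and bounds on inverse moments that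
control the singularity at `0`. If the rank difference is `n * m + d`, the coefficient is quadratic
in `d`, with leading term `d^2 / (2m)`.

The shifts `d` of the cells add up to `1`, so the linear terms do not depend on the random choice of
ranks. The shifts of the ranks are independent, centred and of variance at most `1/4`, so the
expected sum of the squares `d^2` is at most `p/2 + 1`. Inserting this bound gives exactly
`p((α^2+7)p+8)/32` again (`movingConst_le`), which is the comparison claimed. -/

/-! ### Taylor expansion of the divergence function at `1` -/

theorem isLittleO_pow_succ_of_hasDerivAt {g g' : ℝ → ℝ} {a : ℝ} {k : ℕ}
    (hd : ∀ᶠ x in 𝓝 a, HasDerivAt g (g' x) x) (h0 : g a = 0)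
    (ho : g' =o[𝓝 a] fun x => (x - a) ^ k) : g =o[𝓝 a] fun x => (x - a) ^ (k + 1) := by
  rw [isLittleO_iff] at ho ⊢
  intro c hc
  obtain ⟨δ, hδ, h⟩ := Metric.eventually_nhds_iff_ball.1 (hd.and (ho hc))
  filter_upwards [Metric.ball_mem_nhds a hδ] with x hx
  have hsub : Metric.closedBall a |x - a| ⊆ Metric.ball a δ := by
    apply Metric.closedBall_subset_ball
    simpa [Real.dist_eq] using hx
  have key := (convex_closedBall a |x - a|).norm_image_sub_le_of_norm_hasDerivWithin_le
    (f := g) (f' := g') (C := c * |x - a| ^ k) (x := a) (y := x)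
    (fun y hy => ((h y (hsub hy)).1).hasDerivWithinAt)
    (fun y hy => by
      refine ((h y (hsub hy)).2).trans ?_
      rw [norm_pow, Real.norm_eq_abs]
      have : |y - a| ≤ |x - a| := by simpa [Real.dist_eq] using hy
      gcongr)
    (by simp) (by simp [Real.dist_eq])
  rw [h0, sub_zero] at key
  rw [norm_pow, pow_succ, Real.norm_eq_abs (x - a)]
  simpa [mul_assoc] using key

/-- The derivative of `f_α`. -/
def fAlphaDeriv (α x : ℝ) : ℝ :=
  if α = 1 then Real.log x else 2 / (1 - α) * (1 - x ^ ((α - 1) / 2))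

theorem hasDerivAt_fAlpha (α : ℝ) {x : ℝ} (hx : 0 < x) :
    HasDerivAt (fAlpha α) (fAlphaDeriv α x) x := by
  unfold fAlpha fAlphaDeriv
  by_cases h1 : α = 1
  · simp only [h1, if_true]
    have := (((hasDerivAt_id x).mul (Real.hasDerivAt_log hx.ne')).add_const 1).sub
      (hasDerivAt_id x)
    refine this.congr_deriv ?_
    simp [hx.ne']
  · by_cases h2 : α = -1
    · subst h2
      have := (((Real.hasDerivAt_log hx.ne').neg).add (hasDerivAt_id x)).sub_const 1
      simp only [h1, if_false, if_true]
      refine this.congr_deriv ?_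
      norm_num [Real.rpow_neg_one]
      ring
    · simp only [h1, h2, if_false]
      have hm : 1 - α ≠ 0 := fun e => h1 (by linarith)
      have hp : 1 + α ≠ 0 := fun e => h2 (by linarith)
      have := ((((Real.hasDerivAt_rpow_const (p := (1 + α) / 2) (Or.inl hx.ne')).const_sub 1).const_mul
        (4 / (1 - α ^ 2)))).add (((hasDerivAt_id x).sub_const 1).const_mul (2 / (1 - α)))
      refine this.congr_deriv ?_
      rw [show 1 - α ^ 2 = (1 - α) * (1 + α) by ring,
        show (1 + α) / 2 - 1 = (α - 1) / 2 by ring]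
      field_simp
      ring

theorem hasDerivAt_fAlphaDeriv (α : ℝ) {x : ℝ} (hx : 0 < x) :
    HasDerivAt (fAlphaDeriv α) (x ^ ((α - 3) / 2)) x := by
  unfold fAlphaDeriv
  by_cases h1 : α = 1
  · simp only [h1, if_true]
    refine (Real.hasDerivAt_log hx.ne').congr_deriv ?_
    rw [show ((1 : ℝ) - 3) / 2 = -1 by norm_num, Real.rpow_neg_one]
  · simp only [h1, if_false]
    have hm : 1 - α ≠ 0 := fun e => h1 (by linarith)
    have := ((Real.hasDerivAt_rpow_const (p := (α - 1) / 2) (Or.inl hx.ne')).const_sub 1).const_mul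
        (2 / (1 - α))
    refine this.congr_deriv ?_
    rw [show (α - 1) / 2 - 1 = (α - 3) / 2 by ring]
    field_simp
    ring

/-- Two integrations of the continuity of `x ^ (r - 2)` at `1`. -/
theorem rpow_taylor (r : ℝ) :
    (fun x : ℝ => x ^ r - (1 + r * (x - 1) + r * (r - 1) / 2 * (x - 1) ^ 2))
      =o[𝓝 1] fun x => (x - 1) ^ 2 := by
  have hpos : ∀ᶠ x : ℝ in 𝓝 1, 0 < x := lt_mem_nhds one_pos
  have hmon : ∀ x : ℝ, HasDerivAt (fun y : ℝ => y - 1) 1 x := fun x => (hasDerivAt_id x).sub_const 1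
  have h0 : (fun x : ℝ => (r - 1) * (x ^ (r - 2) - 1)) =o[𝓝 1] fun x => (x - 1) ^ 0 := by
    simp only [pow_zero]
    rw [isLittleO_one_iff]
    have : ContinuousAt (fun x : ℝ => (r - 1) * (x ^ (r - 2) - 1)) 1 :=
      (((Real.continuousAt_rpow_const 1 (r - 2) (Or.inl one_ne_zero)).sub
        continuousAt_const).const_mul _)
    simpa [ContinuousAt] using this
  have h1 : (fun x : ℝ => x ^ (r - 1) - (1 + (r - 1) * (x - 1))) =o[𝓝 1] fun x => (x - 1) ^ 1 := by
    refine isLittleO_pow_succ_of_hasDerivAt ?_ (by simp) h0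
    filter_upwards [hpos] with x hx
    have := (Real.hasDerivAt_rpow_const (p := r - 1) (Or.inl hx.ne')).sub
      (((hmon x).const_mul (r - 1)).const_add 1)
    refine this.congr_deriv ?_
    rw [show r - 1 - 1 = r - 2 by ring]
    ring
  refine isLittleO_pow_succ_of_hasDerivAt (g' := fun x : ℝ => r * (x ^ (r - 1) - (1 + (r - 1) * (x - 1))))
    ?_ (by simp) (h1.const_mul_left r)
  filter_upwards [hpos] with x hx
  have := (Real.hasDerivAt_rpow_const (p := r) (Or.inl hx.ne')).sub
    ((((hmon x).const_mul r).const_add 1).add (((hmon x).pow 2).const_mul (r * (r - 1) / 2)))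
  refine this.congr_deriv ?_
  simp
  ring

theorem fAlpha_one (α : ℝ) : fAlpha α 1 = 0 := by
  unfold fAlpha; split_ifs <;> simp

/-- The second derivative is a power of `x` for every `α`, including `±1`, so `rpow_taylor`
integrated twice covers all cases at once. -/
theorem fAlpha_taylor (α : ℝ) :
    (fun x : ℝ => fAlpha α x - ((x - 1) ^ 2 / 2 + (α - 3) / 12 * (x - 1) ^ 3
      + (α - 3) * (α - 5) / 96 * (x - 1) ^ 4)) =o[𝓝 1] fun x => (x - 1) ^ 4 := by
  have hpos : ∀ᶠ x : ℝ in 𝓝 1, 0 < x := lt_mem_nhds one_pos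
  have hmon : ∀ x : ℝ, HasDerivAt (fun y : ℝ => y - 1) 1 x := fun x => (hasDerivAt_id x).sub_const 1
  have h1 : (fun x : ℝ => fAlphaDeriv α x - ((x - 1) + (α - 3) / 4 * (x - 1) ^ 2
      + (α - 3) * (α - 5) / 24 * (x - 1) ^ 3)) =o[𝓝 1] fun x => (x - 1) ^ 3 := by
    refine isLittleO_pow_succ_of_hasDerivAt ?_ (by simp [fAlphaDeriv]) (rpow_taylor ((α - 3) / 2))
    filter_upwards [hpos] with x hx
    have := (hasDerivAt_fAlphaDeriv α hx).sub (((hmon x).add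
      (((hmon x).pow 2).const_mul ((α - 3) / 4))).add
      (((hmon x).pow 3).const_mul ((α - 3) * (α - 5) / 24)))
    refine this.congr_deriv ?_
    simp
    ring
  refine isLittleO_pow_succ_of_hasDerivAt ?_ (by simp [fAlpha_one]) h1
  filter_upwards [hpos] with x hx
  have := (hasDerivAt_fAlpha α hx).sub (((((hmon x).pow 2).div_const 2).add
    (((hmon x).pow 3).const_mul ((α - 3) / 12))).add
    (((hmon x).pow 4).const_mul ((α - 3) * (α - 5) / 96)))
  refine this.congr_deriv ?_
  simp
  ring

/-- The mean of `f_α` and `f_{-α}`. -/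
def symF (α x : ℝ) : ℝ := (fAlpha α x + fAlpha (-α) x) / 2

/-- The Taylor polynomial of degree four of `symF α` at `1`. -/
def symTaylor (α x : ℝ) : ℝ :=
  (x - 1) ^ 2 / 2 - (x - 1) ^ 3 / 4 + (α ^ 2 + 15) / 96 * (x - 1) ^ 4

theorem symF_taylor (α : ℝ) :
    (fun x : ℝ => symF α x - symTaylor α x) =o[𝓝 1] fun x => (x - 1) ^ 4 := by
  have := ((fAlpha_taylor α).add (fAlpha_taylor (-α))).const_mul_left (1 / 2)
  refine this.congr_left fun x => ?_
  unfold symF symTaylor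
  ring

/-! ### Growth near `0` and the remainder on `(0, M]` -/

theorem measurable_fAlpha (α : ℝ) : Measurable (fAlpha α) := by
  unfold fAlpha
  split_ifs <;> fun_prop

theorem measurable_symF (α : ℝ) : Measurable (symF α) :=
  ((measurable_fAlpha α).add (measurable_fAlpha (-α))).div_const 2

theorem rpow_mul_pow_le {x M β : ℝ} {q : ℕ} (hx : 0 < x) (hM : x ≤ M) (hβ : 0 ≤ β + q) :
    x ^ β * x ^ q ≤ M ^ (β + q) := by
  rw [← Real.rpow_natCast, ← Real.rpow_add hx]
  exact Real.rpow_le_rpow hx.le hM hβ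

/-- The singularity at `0` is at worst logarithmic or of the order `x ^ ((1 + α) / 2)`; the
assumption on `q` makes `(1 + α) / 2 + q` nonnegative, and `q ≥ 1` takes care of the logarithm. -/
theorem abs_fAlpha_mul_pow_le (α M : ℝ) {q : ℕ} (hq : 1 + |α| ≤ q) :
    ∃ C, ∀ x, 0 < x → x ≤ M → |fAlpha α x| * x ^ q ≤ C := by
  have hα := abs_le.1 (le_refl |α|)
  have hq1 : (1 : ℝ) ≤ q := le_trans (by linarith [abs_nonneg α]) hq
  have hq1' : 1 ≤ q := by exact_mod_cast hq1
  have hlog : ∀ x : ℝ, 0 < x → x ≤ M → |Real.log x| * x ^ q ≤ M ^ (q + 1) + M ^ (q - 1) := by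
    intro x hx hM
    have h1 : |Real.log x| ≤ x + x⁻¹ := by
      rw [abs_le]
      have h2 := Real.log_le_sub_one_of_pos (inv_pos.2 hx)
      have h3 := Real.log_le_sub_one_of_pos hx
      have := inv_pos.2 hx
      rw [Real.log_inv] at h2
      constructor <;> linarith
    calc |Real.log x| * x ^ q ≤ (x + x⁻¹) * x ^ q := by gcongr
      _ = x ^ (q + 1) + x ^ (q - 1) := by
        obtain ⟨q', rfl⟩ := Nat.exists_eq_add_of_le' hq1'
        simp only [Nat.add_sub_cancel]
        field_simp
        ring
      _ ≤ _ := by gcongr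
  have hpow : ∀ x : ℝ, 0 < x → x ≤ M → x ^ q ≤ M ^ q := fun x hx hM => by gcongr
  have hlin : ∀ x : ℝ, 0 < x → x ≤ M → x * x ^ q ≤ M * M ^ q := fun x hx hM => by
    have : 0 < M := hx.trans_le hM
    gcongr
  by_cases h1 : α = 1
  · refine ⟨M * (M ^ (q + 1) + M ^ (q - 1)) + M ^ q + M * M ^ q, fun x hx hM => ?_⟩
    have hM0 : 0 < M := hx.trans_le hM
    simp only [fAlpha, h1, if_true]
    calc |x * Real.log x + 1 - x| * x ^ q ≤ (x * |Real.log x| + 1 + x) * x ^ q := by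
          gcongr
          refine (abs_sub _ _).trans ?_
          refine add_le_add ((abs_add_le _ _).trans ?_) (abs_of_pos hx).le
          rw [abs_mul, abs_of_pos hx, abs_one]
      _ = x * (|Real.log x| * x ^ q) + x ^ q + x * x ^ q := by ring
      _ ≤ _ := by
        have := hlog x hx hM
        have := hpow x hx hM
        have := hlin x hx hM
        gcongr
  · by_cases h2 : α = -1
    · refine ⟨(M ^ (q + 1) + M ^ (q - 1)) + M * M ^ q + M ^ q, fun x hx hM => ?_⟩
      simp only [fAlpha, h2, if_true]
      rw [if_neg (by norm_num)]
      calc |-Real.log x + x - 1| * x ^ q ≤ (|Real.log x| + x + 1) * x ^ q := by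
            gcongr
            refine (abs_sub _ _).trans ?_
            rw [abs_one]
            refine add_le_add ((abs_add_le _ _).trans ?_) le_rfl
            rw [abs_neg, abs_of_pos hx]
        _ = |Real.log x| * x ^ q + x * x ^ q + x ^ q := by ring
        _ ≤ _ := by
          have := hlog x hx hM
          have := hpow x hx hM
          have := hlin x hx hM
          gcongr
    · refine ⟨|4 / (1 - α ^ 2)| * (M ^ q + M ^ ((1 + α) / 2 + q))
        + |2 / (1 - α)| * (M * M ^ q + M ^ q), fun x hx hM => ?_⟩
      simp only [fAlpha, h1, h2, if_false]
      have hr : 0 ≤ x ^ ((1 + α) / 2) := Real.rpow_nonneg hx.le _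
      calc |4 / (1 - α ^ 2) * (1 - x ^ ((1 + α) / 2)) + 2 / (1 - α) * (x - 1)| * x ^ q
          ≤ (|4 / (1 - α ^ 2)| * (1 + x ^ ((1 + α) / 2)) + |2 / (1 - α)| * (x + 1)) * x ^ q := by
            gcongr
            refine (abs_add_le _ _).trans ?_
            rw [abs_mul, abs_mul]
            gcongr
            · refine (abs_sub _ _).trans ?_
              rw [abs_one, abs_of_nonneg hr]
            · refine (abs_sub _ _).trans ?_
              rw [abs_one, abs_of_pos hx]
        _ = |4 / (1 - α ^ 2)| * (x ^ q + x ^ ((1 + α) / 2) * x ^ q)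
            + |2 / (1 - α)| * (x * x ^ q + x ^ q) := by ring
        _ ≤ _ := by
          have := hpow x hx hM
          have := hlin x hx hM
          have := rpow_mul_pow_le (β := (1 + α) / 2) (q := q) hx hM (by linarith [hα.1])
          gcongr

theorem abs_symF_mul_pow_le (α M : ℝ) {q : ℕ} (hq : 1 + |α| ≤ q) :
    ∃ C, ∀ x, 0 < x → x ≤ M → |symF α x| * x ^ q ≤ C := by
  obtain ⟨C1, h1⟩ := abs_fAlpha_mul_pow_le α M hq
  obtain ⟨C2, h2⟩ := abs_fAlpha_mul_pow_le (-α) M (q := q) (by rwa [abs_neg])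
  refine ⟨(C1 + C2) / 2, fun x hx hM => ?_⟩
  have h3 := h1 x hx hM
  have h4 := h2 x hx hM
  have h5 : |symF α x| ≤ (|fAlpha α x| + |fAlpha (-α) x|) / 2 := by
    rw [symF, abs_div, abs_two]
    gcongr
    exact abs_add_le _ _
  calc |symF α x| * x ^ q ≤ (|fAlpha α x| + |fAlpha (-α) x|) / 2 * x ^ q := by gcongr
    _ = (|fAlpha α x| * x ^ q + |fAlpha (-α) x| * x ^ q) / 2 := by ring
    _ ≤ _ := by gcongr

theorem continuous_symTaylor (α : ℝ) : Continuous (symTaylor α) := by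
  unfold symTaylor; fun_prop

theorem exists_abs_symTaylor_le (α M : ℝ) : ∃ C, 0 ≤ C ∧ ∀ x, 0 ≤ x → x ≤ M → |symTaylor α x| ≤ C := by
  obtain ⟨C, hC⟩ := (isCompact_Icc (a := (0 : ℝ)) (b := M)).exists_bound_of_continuousOn
    (continuous_symTaylor α).continuousOn
  exact ⟨max C 0, le_max_right _ _, fun x h0 h1 => (hC x ⟨h0, h1⟩).trans (le_max_left _ _)⟩

/-- Global control of the remainder of the Taylor expansion of `symF α` at `1`. -/
theorem symF_remainder (α M : ℝ) {q : ℕ} (hq : 1 + |α| ≤ q) {ε : ℝ} (hε : 0 < ε) :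
    ∃ C, 0 ≤ C ∧ ∀ x, 0 < x → x ≤ M →
      |symF α x - symTaylor α x| ≤ ε * (x - 1) ^ 4 + C * ((x - 1) ^ 6 * (x⁻¹) ^ q) := by
  obtain ⟨δ, hδ, h⟩ := Metric.eventually_nhds_iff_ball.1 ((isLittleO_iff.1 (symF_taylor α)) hε)
  obtain ⟨C1, h1⟩ := abs_symF_mul_pow_le α M hq
  obtain ⟨C2, hC2, h2⟩ := exists_abs_symTaylor_le α M
  refine ⟨max ((C1 + C2 * M ^ q) / δ ^ 6) 0, le_max_right _ _, fun x hx hM => ?_⟩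
  have h4 : 0 ≤ (x - 1) ^ 4 := by positivity
  have h6 : 0 ≤ (x - 1) ^ 6 := by positivity
  by_cases hx1 : x ∈ Metric.ball 1 δ
  · have := h x hx1
    rw [Real.norm_eq_abs, Real.norm_eq_abs, abs_of_nonneg h4] at this
    refine this.trans (le_add_of_nonneg_right ?_)
    have : 0 ≤ max ((C1 + C2 * M ^ q) / δ ^ 6) 0 := le_max_right _ _
    positivity
  -- Away from `1` the difference is at most a constant times `x⁻¹ ^ q`, and the factor `(x - 1) ^ 6
  -- ≥ δ ^ 6` is inserted for free. The exponent six is what later yields `O(n⁻³)`.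
  · have hd : δ ≤ |x - 1| := by simpa [Real.dist_eq] using hx1
    have hd6 : δ ^ 6 ≤ (x - 1) ^ 6 := by
      rw [← Even.pow_abs (by decide : Even 6) (x - 1)]
      gcongr
    have hb : |symF α x - symTaylor α x| * x ^ q ≤ C1 + C2 * M ^ q := by
      calc |symF α x - symTaylor α x| * x ^ q ≤ (|symF α x| + |symTaylor α x|) * x ^ q := by
            gcongr; exact abs_sub _ _
        _ = |symF α x| * x ^ q + |symTaylor α x| * x ^ q := by ring
        _ ≤ _ := by
          have := h1 x hx hM
          have := h2 x hx.le hM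
          gcongr
    have hb0 : 0 ≤ C1 + C2 * M ^ q := le_trans (by positivity) hb
    calc |symF α x - symTaylor α x| = (|symF α x - symTaylor α x| * x ^ q) * (x⁻¹) ^ q := by
          rw [inv_pow]; field_simp
      _ ≤ (C1 + C2 * M ^ q) * (x⁻¹) ^ q := by gcongr
      _ = (C1 + C2 * M ^ q) / δ ^ 6 * (δ ^ 6 * (x⁻¹) ^ q) := by field_simp
      _ ≤ max ((C1 + C2 * M ^ q) / δ ^ 6) 0 * ((x - 1) ^ 6 * (x⁻¹) ^ q) := by
        gcongr
        exact le_max_left _ _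
      _ ≤ _ := le_add_of_nonneg_left (by positivity)

theorem symF_nonneg (α : ℝ) {x : ℝ} (hx : 0 < x) : 0 ≤ symF α x :=
  div_nonneg (add_nonneg (fAlpha_nonneg α x hx.le (Or.inl hx))
    (fAlpha_nonneg (-α) x hx.le (Or.inl hx))) zero_le_two

theorem continuous_fAlpha {α : ℝ} (hα : |α| < 1) : Continuous (fAlpha α) := by
  have h := abs_lt.1 hα
  have h1 : α ≠ 1 := h.2.ne
  have h2 : α ≠ -1 := h.1.ne'
  unfold fAlpha
  simp only [h1, h2, if_false]
  have : Continuous fun x : ℝ => x ^ ((1 + α) / 2) :=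
    Real.continuous_rpow_const (by linarith)
  fun_prop

theorem exists_symF_le {α : ℝ} (hα : |α| < 1) (M : ℝ) :
    ∃ C, 0 ≤ C ∧ ∀ x, 0 ≤ x → x ≤ M → |symF α x| ≤ C := by
  have hc : Continuous (symF α) :=
    ((continuous_fAlpha hα).add (continuous_fAlpha (α := -α) (by rwa [abs_neg]))).div_const 2
  obtain ⟨C, hC⟩ := (isCompact_Icc (a := (0 : ℝ)) (b := M)).exists_bound_of_continuousOn
    hc.continuousOn
  exact ⟨max C 0, le_max_right _ _, fun x h0 h1 => (hC x ⟨h0, h1⟩).trans (le_max_left _ _)⟩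

/-! ### Spacings of an atomless sample: size biasing and moments -/

section Spacing

variable {n : ℕ}

/-- The number of sample points to the left of `y`. -/
def countLT (x : Fin n → ℝ) (y : ℝ) : ℕ := ∑ i, if x i < y then 1 else 0

/-- The number of sample points which are at most `y`. -/
def countLE (x : Fin n → ℝ) (y : ℝ) : ℕ := ∑ i, if x i ≤ y then 1 else 0

/-- The points strictly between the order statistics of the ranks `j` and `k`. -/
def between (x : Fin n → ℝ) (j k : ℕ) : Set ℝ := {y | j ≤ countLT x y ∧ countLE x y < k}

/-- The probability of the open interval between the order statistics of the ranks `j` and `k`. -/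
def spacing (μ : Measure ℝ) (x : Fin n → ℝ) (j k : ℕ) : ℝ≥0∞ := μ (between x j k)

theorem countLT_eq_card (x : Fin n → ℝ) (y : ℝ) : countLT x y = Fintype.card {i // x i < y} := by
  rw [countLT, Fintype.card_subtype, Finset.card_filter]

theorem countLE_eq_card (x : Fin n → ℝ) (y : ℝ) : countLE x y = Fintype.card {i // x i ≤ y} := by
  rw [countLE, Fintype.card_subtype, Finset.card_filter]

theorem countLT_comp_perm (x : Fin n → ℝ) (y : ℝ) (σ : Equiv.Perm (Fin n)) :
    countLT (x ∘ σ) y = countLT x y :=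
  Equiv.sum_comp σ fun i => if x i < y then 1 else 0

theorem countLE_comp_perm (x : Fin n → ℝ) (y : ℝ) (σ : Equiv.Perm (Fin n)) :
    countLE (x ∘ σ) y = countLE x y :=
  Equiv.sum_comp σ fun i => if x i ≤ y then 1 else 0

theorem countLT_le (x : Fin n → ℝ) (y : ℝ) : countLT x y ≤ n := by
  rw [countLT_eq_card]
  exact (Fintype.card_subtype_le _).trans (by simp)

theorem countLE_le (x : Fin n → ℝ) (y : ℝ) : countLE x y ≤ n := by
  rw [countLE_eq_card]
  exact (Fintype.card_subtype_le _).trans (by simp)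

/-- Counts do not change under permutation, so the sample may be taken sorted. The values `-∞` at
rank `0` and `∞` beyond `n` fit the same rule. Working with counts avoids sorting from here on. -/
theorem orderStat_lt_iff (x : Fin n → ℝ) (k : ℕ) (y : ℝ) :
    orderStat x k < y ↔ k ≤ countLT x y := by
  unfold orderStat
  rcases Nat.eq_zero_or_pos k with rfl | hk
  · simp [EReal.bot_lt_coe]
  rw [if_neg hk.ne']
  split_ifs with h
  · rw [EReal.coe_lt_coe_iff, ← countLT_comp_perm x y (Tuple.sort x), countLT_eq_card]
    have := Tuple.lt_card_lt_iff_apply_lt_of_monotone (a := y) (j := ⟨k - 1, h⟩)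
      (Tuple.monotone_sort x)
    simp only [Function.comp_apply, Fintype.card_subtype] at this ⊢
    rw [← this]
    omega
  · have := countLT_le x y
    simp only [not_top_lt, false_iff]
    omega

theorem lt_orderStat_iff (x : Fin n → ℝ) (k : ℕ) (y : ℝ) :
    (y : EReal) < orderStat x k ↔ countLE x y < k := by
  unfold orderStat
  rcases Nat.eq_zero_or_pos k with rfl | hk
  · simp
  rw [if_neg hk.ne']
  split_ifs with h
  · rw [EReal.coe_lt_coe_iff, ← countLE_comp_perm x y (Tuple.sort x), countLE_eq_card]
    have := Tuple.lt_card_le_iff_apply_le_of_monotone (a := y) (j := ⟨k - 1, h⟩)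
      (Tuple.monotone_sort x)
    simp only [Function.comp_apply, Fintype.card_subtype] at this ⊢
    rw [← not_le, ← this]
    omega
  · have := countLE_le x y
    simp only [EReal.coe_lt_top, true_iff]
    omega

theorem between_eq (x : Fin n → ℝ) (j k : ℕ) :
    between x j k = {y : ℝ | orderStat x j < y ∧ (y : EReal) < orderStat x k} := by
  ext y
  simp only [between, Set.mem_ofPred_eq, orderStat_lt_iff, lt_orderStat_iff]

theorem countLT_insertNth (i : Fin (n + 1)) (y : ℝ) (x : Fin n → ℝ) (w : ℝ) :
    countLT (i.insertNth y x : Fin (n + 1) → ℝ) w = countLT x w + if y < w then 1 else 0 := by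
  rw [countLT, Fin.sum_univ_succAbove _ i, add_comm]
  simp [countLT]

theorem countLE_insertNth (i : Fin (n + 1)) (y : ℝ) (x : Fin n → ℝ) (w : ℝ) :
    countLE (i.insertNth y x : Fin (n + 1) → ℝ) w = countLE x w + if y ≤ w then 1 else 0 := by
  rw [countLE, Fin.sum_univ_succAbove _ i, add_comm]
  simp [countLE]

theorem countLE_le_countLT (x : Fin n → ℝ) {v w : ℝ} (h : v < w) : countLE x v ≤ countLT x w := by
  refine Finset.sum_le_sum fun i _ => ?_
  split_ifs with h1 h2
  · rfl
  · exact absurd (h1.trans_lt h) h2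
  · exact zero_le_one
  · rfl

theorem countLT_le_countLE (x : Fin n → ℝ) (w : ℝ) : countLT x w ≤ countLE x w := by
  refine Finset.sum_le_sum fun i _ => ?_
  split_ifs with h1 h2
  · rfl
  · exact absurd h1.le h2
  · exact zero_le_one
  · rfl

/-- A new sample point inside the interval does not change the interval, up to its rank. -/
theorem mem_between_insertNth {i : Fin (n + 1)} {x : Fin n → ℝ} {y w : ℝ} {j k : ℕ}
    (hy : y ∈ between x j k) (hw : w ≠ y) :
    w ∈ between (i.insertNth y x : Fin (n + 1) → ℝ) j (k + 1) ↔ w ∈ between x j k := by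
  obtain ⟨h1, h2⟩ := hy
  simp only [between, Set.mem_ofPred_eq, countLT_insertNth, countLE_insertNth]
  have h3 := countLT_le_countLE x y
  rcases hw.lt_or_gt with h | h
  · have := countLE_le_countLT x h
    rw [if_neg h.not_gt, if_neg h.not_ge]
    omega
  · have := countLE_le_countLT x h
    rw [if_pos h, if_pos h.le]
    omega

theorem insertNth_mem_between {i : Fin (n + 1)} {x : Fin n → ℝ} {y : ℝ} {j k : ℕ} :
    y ∈ between (i.insertNth y x : Fin (n + 1) → ℝ) j (k + 1) ↔ y ∈ between x j k := by
  simp [between, countLT_insertNth, countLE_insertNth]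

theorem measurable_countLT : Measurable fun z : (Fin n → ℝ) × ℝ => countLT z.1 z.2 := by
  unfold countLT
  refine Finset.measurable_fun_sum _ fun i _ => Measurable.ite ?_ measurable_const measurable_const
  exact measurableSet_lt (by fun_prop) (by fun_prop)

theorem measurable_countLE : Measurable fun z : (Fin n → ℝ) × ℝ => countLE z.1 z.2 := by
  unfold countLE
  refine Finset.measurable_fun_sum _ fun i _ => Measurable.ite ?_ measurable_const measurable_const
  exact measurableSet_le (by fun_prop) (by fun_prop)

theorem measurableSet_between_prod (j k : ℕ) :
    MeasurableSet {z : (Fin n → ℝ) × ℝ | z.2 ∈ between z.1 j k} :=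
  (measurableSet_le measurable_const measurable_countLT).inter
    (measurableSet_lt measurable_countLE measurable_const)

theorem measurableSet_between (x : Fin n → ℝ) (j k : ℕ) : MeasurableSet (between x j k) :=
  measurable_prodMk_left (measurableSet_between_prod j k)

theorem measurable_spacing (μ : Measure ℝ) [IsProbabilityMeasure μ] (j k : ℕ) :
    Measurable fun x : Fin n → ℝ => spacing μ x j k :=
  measurable_measure_prodMk_left (measurableSet_between_prod j k)

/-- The old and the new set differ at most in the point `y`, which is null. -/
theorem spacing_insertNth {μ : Measure ℝ} [NullSingletonClass μ] {i : Fin (n + 1)} {x : Fin n → ℝ} {y : ℝ} {j k : ℕ}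
    (hy : y ∈ between x j k) :
    spacing μ (i.insertNth y x : Fin (n + 1) → ℝ) j (k + 1) = spacing μ x j k := by
  refine measure_congr ?_
  have : ∀ᵐ w ∂μ, w ≠ y := by simp [ae_iff]
  filter_upwards [this] with w hw
  exact propext (mem_between_insertNth hy hw)

variable {μ : Measure ℝ} [IsProbabilityMeasure μ]

instance isProbabilityMeasure_sampleLaw : IsProbabilityMeasure (sampleLaw μ n) := by unfold sampleLaw; infer_instance

theorem lintegral_sampleLaw_succ (i : Fin (n + 1)) {φ : (Fin (n + 1) → ℝ) → ℝ≥0∞}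
    (hφ : Measurable φ) :
    ∫⁻ z, φ z ∂sampleLaw μ (n + 1)
      = ∫⁻ x, ∫⁻ y, φ (i.insertNth y x) ∂μ ∂sampleLaw μ n := by
  have h := (measurePreserving_piFinSuccAbove (fun _ : Fin (n + 1) => μ) i).symm
  unfold sampleLaw
  rw [← h.lintegral_comp hφ]
  exact lintegral_prod_symm _ (hφ.comp h.measurable).aemeasurable

theorem measurable_indicator_between {g : ℝ≥0∞ → ℝ≥0∞} (hg : Measurable g) (i : Fin n)
    (j k : ℕ) : Measurable fun z : Fin n → ℝ =>
      (between z j k).indicator (fun _ => g (spacing μ z j k)) (z i) := by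
  have hS : MeasurableSet {z : Fin n → ℝ | z i ∈ between z j k} :=
    (measurableSet_between_prod j k).preimage (measurable_id.prodMk (measurable_pi_apply i))
  exact (hg.comp (measurable_spacing μ j k)).indicator hS

/-- Given the other points, the `i`-th one lies in the enlarged rank window exactly when it falls
into the spacing of the others, which has conditional probability equal to that spacing. -/
theorem lintegral_indicator_spacing [NullSingletonClass μ] {g : ℝ≥0∞ → ℝ≥0∞} (hg : Measurable g)
    (i : Fin (n + 1)) (j k : ℕ) :
    ∫⁻ z, (between z j (k + 1)).indicator (fun _ => g (spacing μ z j (k + 1))) (z i)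
        ∂sampleLaw μ (n + 1)
      = ∫⁻ x, g (spacing μ x j k) * spacing μ x j k ∂sampleLaw μ n := by
  rw [lintegral_sampleLaw_succ i (measurable_indicator_between hg i j (k + 1))]
  refine lintegral_congr fun x => ?_
  simp only [Fin.insertNth_apply_same]
  have : ∀ y, (between (i.insertNth y x : Fin (n + 1) → ℝ) j (k + 1)).indicator
      (fun _ => g (spacing μ (i.insertNth y x : Fin (n + 1) → ℝ) j (k + 1))) y
      = (between x j k).indicator (fun _ => g (spacing μ x j k)) y := by
    intro y
    by_cases hy : y ∈ between x j k
    · rw [Set.indicator_of_mem hy, Set.indicator_of_mem (insertNth_mem_between.2 hy),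
        spacing_insertNth hy]
    · rw [Set.indicator_of_notMem hy, Set.indicator_of_notMem (mt insertNth_mem_between.1 hy)]
  simp only [this]
  rw [lintegral_indicator_const (measurableSet_between x j k)]
  rfl

theorem ae_injective_sample [NullSingletonClass μ] (n : ℕ) :
    ∀ᵐ x ∂sampleLaw μ n, Function.Injective x := by
  have : ∀ i l : Fin n, i ≠ l → ∀ᵐ x ∂sampleLaw μ n, x i ≠ x l := by
    intro i l hil
    cases n with
    | zero => exact i.elim0
    | succ n =>
      have hs : MeasurableSet {z : Fin (n + 1) → ℝ | z i = z l} :=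
        measurableSet_eq_fun (by fun_prop) (by fun_prop)
      rw [ae_iff]
      simp only [ne_eq, not_not]
      rw [← lintegral_indicator_one hs, lintegral_sampleLaw_succ i (measurable_one.indicator hs)]
      obtain ⟨l', rfl⟩ := Fin.exists_succAbove_eq hil.symm
      refine (lintegral_congr fun x => ?_).trans lintegral_zero
      have : (fun y => {z : Fin (n + 1) → ℝ | z i = z (i.succAbove l')}.indicator (1 : (Fin (n + 1) → ℝ) → ℝ≥0∞)
          (i.insertNth y x)) = ({x l'} : Set ℝ).indicator 1 := by
        ext y
        simp [Set.indicator]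
      rw [this, lintegral_indicator_one (measurableSet_singleton _), measure_singleton]
  have h2 : ∀ᵐ x ∂sampleLaw μ n, ∀ i l : Fin n, i ≠ l → x i ≠ x l :=
    ae_all_iff.2 fun i => ae_all_iff.2 fun l => ae_all_iff.2 fun h => this i l h
  filter_upwards [h2] with x hx i l h
  by_contra hil
  exact hx i l hil h

theorem countLE_apply_self {x : Fin n → ℝ} (hx : Function.Injective x) (i : Fin n) :
    countLE x (x i) = countLT x (x i) + 1 := by
  have h : ∀ l, (if x l ≤ x i then 1 else 0) = (if x l < x i then 1 else 0) + if l = i then 1 else 0 := by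
    intro l
    by_cases h : l = i
    · simp [h]
    · have : x l ≠ x i := fun e => h (hx e)
      simp [h, this.le_iff_lt]
  rw [countLE, Finset.sum_congr rfl fun l _ => h l, Finset.sum_add_distrib, countLT]
  simp

/-- Without ties, the number of points to the left of `x i` is its rank counted from `0`, and ranks
are a bijection onto `Fin n`; the window selects the ranks in `[j, k)`. -/
theorem card_mem_between {x : Fin n → ℝ} (hx : Function.Injective x) {j k : ℕ} (hk : k ≤ n) :
    (Finset.univ.filter fun i => j ≤ countLT x (x i) ∧ countLE x (x i) < k + 1).card = k - j := by
  have hlt : ∀ i, countLT x (x i) < n := fun i => by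
    have := countLE_le x (x i)
    rw [countLE_apply_self hx] at this
    omega
  let r : Fin n → Fin n := fun i => ⟨countLT x (x i), hlt i⟩
  have hr : Function.Injective r := by
    intro i l h
    have h' : countLT x (x i) = countLT x (x l) := congrArg Fin.val h
    by_contra hil
    rcases lt_or_gt_of_ne (fun e => hil (hx e)) with h1 | h1
    · have := countLE_le_countLT x h1
      rw [countLE_apply_self hx] at this
      omega
    · have := countLE_le_countLT x h1
      rw [countLE_apply_self hx] at this
      omega
  have hb : Function.Bijective r := Finite.injective_iff_bijective.1 hr
  have h1 : (Finset.univ.filter fun i => j ≤ countLT x (x i) ∧ countLE x (x i) < k + 1)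
      = Finset.univ.filter fun i => j ≤ (r i : ℕ) ∧ (r i : ℕ) < k := by
    refine Finset.filter_congr fun i _ => ?_
    rw [countLE_apply_self hx]
    simp [r]
  have h2 : (Finset.univ.filter fun i => j ≤ (r i : ℕ) ∧ (r i : ℕ) < k).card
      = (Finset.univ.filter fun i : Fin n => j ≤ (i : ℕ) ∧ (i : ℕ) < k).card := by
    rw [Finset.card_filter, Finset.card_filter]
    exact (Equiv.ofBijective r hb).sum_comp fun i : Fin n => if j ≤ (i : ℕ) ∧ (i : ℕ) < k then 1 else 0
  have h3 : (Finset.univ.filter fun i : Fin n => j ≤ (i : ℕ) ∧ (i : ℕ) < k).map Fin.valEmbedding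
      = Finset.Ico j k := by
    ext a
    simp only [Finset.mem_map, Finset.mem_filter, Finset.mem_univ, true_and, Finset.mem_Ico,
      Fin.valEmbedding_apply]
    exact ⟨fun ⟨i, hi, e⟩ => e ▸ hi, fun ha => ⟨⟨a, ha.2.trans_le hk⟩, ha, rfl⟩⟩
  rw [h1, h2, ← Finset.card_map Fin.valEmbedding, h3, Nat.card_Ico]

/-- Size biasing a spacing adds a sample point to it. -/
theorem lintegral_spacing_mul [NullSingletonClass μ] {g : ℝ≥0∞ → ℝ≥0∞} (hg : Measurable g) {j k : ℕ}
    (hk : k ≤ n + 1) :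
    (n + 1 : ℕ) * ∫⁻ x, g (spacing μ x j k) * spacing μ x j k ∂sampleLaw μ n
      = (k - j : ℕ) * ∫⁻ z, g (spacing μ z j (k + 1)) ∂sampleLaw μ (n + 1) := by
  classical
  have h1 : ∑ i : Fin (n + 1), ∫⁻ z, (between z j (k + 1)).indicator
      (fun _ => g (spacing μ z j (k + 1))) (z i) ∂sampleLaw μ (n + 1)
      = (n + 1 : ℕ) * ∫⁻ x, g (spacing μ x j k) * spacing μ x j k ∂sampleLaw μ n := by
    simp [lintegral_indicator_spacing hg]
  rw [← h1, ← lintegral_finsetSum _ fun i _ => measurable_indicator_between hg i j (k + 1), ← lintegral_const_mul]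
  swap
  · exact hg.comp (measurable_spacing μ j (k + 1))
  -- Almost surely exactly `k - j` points lie in the window, so the sum of the indicators is a
  -- constant.
  refine lintegral_congr_ae ?_
  filter_upwards [ae_injective_sample (μ := μ) (n + 1)] with z hz
  rw [← card_mem_between hz hk]
  simp [Set.indicator_apply, ← Finset.sum_filter, between]

/-- Each size-biasing step removes one power and raises `n` and `k` by one. For `j < k ≤ n` these
are the moments of the beta law with parameters `k - j` and `n + 1 - (k - j)`. -/
theorem lintegral_spacing_pow [NullSingletonClass μ] (r : ℕ) {j k : ℕ} (hk : k ≤ n + 1) :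
    ∫⁻ x, spacing μ x j k ^ r ∂sampleLaw μ n
      = ENNReal.ofReal (∏ i ∈ Finset.range r, (((k - j : ℕ) : ℝ) + i) / ((n : ℝ) + 1 + i)) := by
  induction r generalizing n k with
  | zero => simp
  | succ r ih =>
    have h := lintegral_spacing_mul (μ := μ) (n := n) (j := j) (k := k)
      (measurable_id.pow_const r) hk
    simp only [id] at h
    rw [ih (n := n + 1) (k := k + 1) (by omega)] at h
    -- For `k < j` the truncated difference `k + 1 - j` is not `(k - j) + 1`, but then both sides
    -- vanish.
    rcases Nat.lt_or_ge k j with hjk | hjk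
    · rw [Nat.sub_eq_zero_of_le hjk.le] at h ⊢
      simp only [Nat.cast_zero, zero_mul, mul_eq_zero, Nat.cast_eq_zero, Nat.succ_ne_zero,
        false_or] at h
      simp only [pow_succ, h]
      rw [Finset.prod_range_succ']
      simp
    rw [Finset.prod_range_succ']
    have hn : ((n + 1 : ℕ) : ℝ≥0∞) ≠ 0 := by simp
    rw [← ENNReal.mul_right_inj hn (by simp)]
    simp only [pow_succ]
    rw [h, ← ENNReal.ofReal_natCast, ← ENNReal.ofReal_natCast, ← ENNReal.ofReal_mul (by positivity),
      ← ENNReal.ofReal_mul (by positivity), show k + 1 - j = (k - j) + 1 by omega]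
    congr 1
    push_cast
    have : ((n : ℝ) + 1) ≠ 0 := by positivity
    have e : ∏ i ∈ Finset.range r, (((k - j : ℕ) : ℝ) + 1 + i) / ((n : ℝ) + 1 + 1 + i)
      = ∏ i ∈ Finset.range r, (((k - j : ℕ) : ℝ) + (i + 1)) / ((n : ℝ) + 1 + (i + 1)) :=
      Finset.prod_congr rfl fun i _ => by ring
    rw [e]
    field_simp
    simp
    ring

/-- Size biasing read backwards: an inverse power is traded for the loss of one sample point and one
rank. After `q` steps a rank difference `k - j - q` is left, which must be positive. -/
theorem lintegral_inv_spacing_pow_le [NullSingletonClass μ] (q : ℕ) {j k : ℕ} (hk : k ≤ n + 1)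
    (hjk : j + q < k) :
    ∫⁻ x, (spacing μ x j k)⁻¹ ^ q ∂sampleLaw μ n
      ≤ ENNReal.ofReal ((n : ℝ) / ((k - j - q : ℕ) : ℝ)) ^ q := by
  induction q generalizing n k with
  | zero => simp
  | succ q ih =>
    obtain ⟨k, rfl⟩ := Nat.exists_eq_add_of_lt (Nat.zero_lt_of_lt hjk)
    obtain ⟨n, rfl⟩ : ∃ n', n = n' + 1 := ⟨n - 1, by omega⟩
    rw [Nat.zero_add] at *
    have h := lintegral_spacing_mul (μ := μ) (n := n) (j := j) (k := k)
      (measurable_inv.pow_const (q + 1)) (by omega)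
    have h2 : ∫⁻ x, (spacing μ x j k)⁻¹ ^ (q + 1) * spacing μ x j k ∂sampleLaw μ n
        ≤ ENNReal.ofReal ((n : ℝ) / ((k - j - q : ℕ) : ℝ)) ^ q := by
      refine (lintegral_mono fun x => ?_).trans (ih (by omega) (by omega))
      rw [pow_succ, mul_assoc]
      -- Only an inequality, because `s⁻¹ * s` is `0` when `s = 0`.
      exact mul_le_of_le_one_right' (ENNReal.inv_mul_le_one _)
    have hs : 0 < k - j - q := by omega
    have hs' : (0 : ℝ) < ((k - j - q : ℕ) : ℝ) := by exact_mod_cast hs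
    have hkj : ((k - j - q : ℕ) : ℝ≥0∞) ≤ ((k - j : ℕ) : ℝ≥0∞) := by
      exact_mod_cast Nat.sub_le _ _
    have h3 : ((k - j - q : ℕ) : ℝ≥0∞) * ∫⁻ z, (spacing μ z j (k + 1))⁻¹ ^ (q + 1) ∂sampleLaw μ (n + 1)
        ≤ (n + 1 : ℕ) * ENNReal.ofReal ((n : ℝ) / ((k - j - q : ℕ) : ℝ)) ^ q := by
      calc _ ≤ ((k - j : ℕ) : ℝ≥0∞) * ∫⁻ z, (spacing μ z j (k + 1))⁻¹ ^ (q + 1) ∂sampleLaw μ (n + 1) := by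
            gcongr
        _ = _ := h.symm
        _ ≤ _ := by gcongr
    rw [show k + 1 - j - (q + 1) = k - j - q by omega]
    have h4 : ENNReal.ofReal (((n + 1 : ℕ) : ℝ) / ((k - j - q : ℕ) : ℝ))
        = ((k - j - q : ℕ) : ℝ≥0∞)⁻¹ * (n + 1 : ℕ) := by
      rw [ENNReal.ofReal_div_of_pos hs', ENNReal.ofReal_natCast, ENNReal.ofReal_natCast,
        ENNReal.div_eq_inv_mul]
    have hs0 : ((k - j - q : ℕ) : ℝ≥0∞) ≠ 0 := by exact_mod_cast hs.ne'
    rw [← ENNReal.mul_le_mul_iff_right hs0 (by simp)]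
    refine h3.trans ?_
    rw [pow_succ', h4]
    rw [mul_assoc, ← mul_assoc _ (_⁻¹), ENNReal.mul_inv_cancel hs0 (by simp), one_mul, ← h4]
    gcongr
    exact_mod_cast Nat.le_succ n

end Spacing

/-- The expectation of `g` under the binomial law with parameters `n` and `m`. -/
def binE (m : ℝ) : ℕ → (ℕ → ℝ) → ℝ
  | 0, g => g 0
  | n + 1, g => m * binE m n (fun k => g (k + 1)) + (1 - m) * binE m n g

/-! ### Central moments of the binomial law -/

section Binomial

variable {m : ℝ}

theorem binE_add (n : ℕ) (g h : ℕ → ℝ) :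
    binE m n (fun k => g k + h k) = binE m n g + binE m n h := by
  induction n generalizing g h with
  | zero => rfl
  | succ n ih => simp only [binE, ih]; ring

theorem binE_const_mul (n : ℕ) (c : ℝ) (g : ℕ → ℝ) :
    binE m n (fun k => c * g k) = c * binE m n g := by
  induction n generalizing g with
  | zero => rfl
  | succ n ih => simp only [binE, ih]; ring

theorem binE_const (n : ℕ) (c : ℝ) : binE m n (fun _ => c) = c := by
  induction n with
  | zero => rfl
  | succ n ih => simp only [binE, ih]; ring

theorem binE_mono (h0 : 0 ≤ m) (h1 : m ≤ 1) (n : ℕ) {g h : ℕ → ℝ} (hgh : ∀ k, g k ≤ h k) :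
    binE m n g ≤ binE m n h := by
  induction n generalizing g h with
  | zero => exact hgh 0
  | succ n ih =>
    have := ih fun k => hgh (k + 1)
    have := ih hgh
    have := sub_nonneg.2 h1
    simp only [binE]
    gcongr

/-- The central moments of the binomial law. -/
def binMoment (m : ℝ) (n r : ℕ) : ℝ := binE m n fun k => ((k : ℝ) - n * m) ^ r

theorem binE_quartic (n : ℕ) (c₀ c₁ c₂ c₃ c₄ : ℝ) :
    binE m n (fun k => c₀ + c₁ * ((k : ℝ) - n * m) ^ 1 + c₂ * ((k : ℝ) - n * m) ^ 2
      + c₃ * ((k : ℝ) - n * m) ^ 3 + c₄ * ((k : ℝ) - n * m) ^ 4)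
      = c₀ + c₁ * binMoment m n 1 + c₂ * binMoment m n 2 + c₃ * binMoment m n 3
        + c₄ * binMoment m n 4 := by
  rw [binE_add, binE_add, binE_add, binE_add, binE_const, binE_const_mul, binE_const_mul,
    binE_const_mul, binE_const_mul]
  rfl

/-- One more trial shifts the centred count by `1 - m` with probability `m` and by `-m` otherwise.
-/
theorem binMoment_succ (n r : ℕ) : binMoment m (n + 1) r
    = m * binE m n (fun k => (((k : ℝ) - n * m) + (1 - m)) ^ r)
      + (1 - m) * binE m n (fun k => (((k : ℝ) - n * m) - m) ^ r) := by
  unfold binMoment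
  rw [binE]
  congr 3 <;> (funext k; push_cast; ring)

theorem binMoment_one (n : ℕ) : binMoment m n 1 = 0 := by
  induction n with
  | zero => simp [binMoment, binE]
  | succ n ih =>
    rw [binMoment_succ]
    have e1 : (fun k : ℕ => (((k : ℝ) - n * m) + (1 - m)) ^ 1) = fun k : ℕ =>
      (1 - m) + 1 * ((k : ℝ) - n * m) ^ 1 + 0 * ((k : ℝ) - n * m) ^ 2
      + 0 * ((k : ℝ) - n * m) ^ 3 + 0 * ((k : ℝ) - n * m) ^ 4 := by funext k; ring
    have e2 : (fun k : ℕ => (((k : ℝ) - n * m) - m) ^ 1) = fun k : ℕ =>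
      (-m) + 1 * ((k : ℝ) - n * m) ^ 1 + 0 * ((k : ℝ) - n * m) ^ 2
      + 0 * ((k : ℝ) - n * m) ^ 3 + 0 * ((k : ℝ) - n * m) ^ 4 := by funext k; ring
    rw [e1, e2, binE_quartic, binE_quartic, ih]
    ring

theorem binMoment_two (n : ℕ) : binMoment m n 2 = n * (m * (1 - m)) := by
  induction n with
  | zero => simp [binMoment, binE]
  | succ n ih =>
    rw [binMoment_succ]
    have e1 : (fun k : ℕ => (((k : ℝ) - n * m) + (1 - m)) ^ 2) = fun k : ℕ =>
      (1 - m) ^ 2 + (2 * (1 - m)) * ((k : ℝ) - n * m) ^ 1 + 1 * ((k : ℝ) - n * m) ^ 2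
      + 0 * ((k : ℝ) - n * m) ^ 3 + 0 * ((k : ℝ) - n * m) ^ 4 := by funext k; ring
    have e2 : (fun k : ℕ => (((k : ℝ) - n * m) - m) ^ 2) = fun k : ℕ =>
      m ^ 2 + (-2 * m) * ((k : ℝ) - n * m) ^ 1 + 1 * ((k : ℝ) - n * m) ^ 2
      + 0 * ((k : ℝ) - n * m) ^ 3 + 0 * ((k : ℝ) - n * m) ^ 4 := by funext k; ring
    rw [e1, e2, binE_quartic, binE_quartic, ih, binMoment_one]
    push_cast
    ring

theorem binMoment_three (n : ℕ) : binMoment m n 3 = n * (m * (1 - m) * (1 - 2 * m)) := by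
  induction n with
  | zero => simp [binMoment, binE]
  | succ n ih =>
    rw [binMoment_succ]
    have e1 : (fun k : ℕ => (((k : ℝ) - n * m) + (1 - m)) ^ 3) = fun k : ℕ =>
      (1 - m) ^ 3 + (3 * (1 - m) ^ 2) * ((k : ℝ) - n * m) ^ 1
      + (3 * (1 - m)) * ((k : ℝ) - n * m) ^ 2
      + 1 * ((k : ℝ) - n * m) ^ 3 + 0 * ((k : ℝ) - n * m) ^ 4 := by funext k; ring
    have e2 : (fun k : ℕ => (((k : ℝ) - n * m) - m) ^ 3) = fun k : ℕ =>
      (-m ^ 3) + (3 * m ^ 2) * ((k : ℝ) - n * m) ^ 1 + (-3 * m) * ((k : ℝ) - n * m) ^ 2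
      + 1 * ((k : ℝ) - n * m) ^ 3 + 0 * ((k : ℝ) - n * m) ^ 4 := by funext k; ring
    rw [e1, e2, binE_quartic, binE_quartic, ih, binMoment_one, binMoment_two]
    push_cast
    ring

theorem binMoment_four (n : ℕ) : binMoment m n 4
    = n * (m * (1 - m) * (1 - 3 * (m * (1 - m)))) + 3 * n * (n - 1) * (m * (1 - m)) ^ 2 := by
  induction n with
  | zero => simp [binMoment, binE]
  | succ n ih =>
    rw [binMoment_succ]
    have e1 : (fun k : ℕ => (((k : ℝ) - n * m) + (1 - m)) ^ 4) = fun k : ℕ =>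
      (1 - m) ^ 4 + (4 * (1 - m) ^ 3) * ((k : ℝ) - n * m) ^ 1
      + (6 * (1 - m) ^ 2) * ((k : ℝ) - n * m) ^ 2
      + (4 * (1 - m)) * ((k : ℝ) - n * m) ^ 3 + 1 * ((k : ℝ) - n * m) ^ 4 := by funext k; ring
    have e2 : (fun k : ℕ => (((k : ℝ) - n * m) - m) ^ 4) = fun k : ℕ =>
      m ^ 4 + (-4 * m ^ 3) * ((k : ℝ) - n * m) ^ 1 + (6 * m ^ 2) * ((k : ℝ) - n * m) ^ 2
      + (-4 * m) * ((k : ℝ) - n * m) ^ 3 + 1 * ((k : ℝ) - n * m) ^ 4 := by funext k; ring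
    rw [e1, e2, binE_quartic, binE_quartic, ih, binMoment_one, binMoment_two, binMoment_three]
    push_cast
    ring

theorem binE_exp (n : ℕ) (t : ℝ) : binE m n (fun k => Real.exp (t * ((k : ℝ) - n * m)))
    = (m * Real.exp (t * (1 - m)) + (1 - m) * Real.exp (t * -m)) ^ n := by
  induction n with
  | zero => simp [binE]
  | succ n ih =>
    rw [binE]
    have e1 : (fun k : ℕ => Real.exp (t * (((k + 1 : ℕ) : ℝ) - (n + 1 : ℕ) * m))) = fun k : ℕ =>
        Real.exp (t * (1 - m)) * Real.exp (t * ((k : ℝ) - n * m)) := by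
      funext k; rw [← Real.exp_add]; congr 1; push_cast; ring
    have e2 : (fun k : ℕ => Real.exp (t * ((k : ℝ) - (n + 1 : ℕ) * m))) = fun k : ℕ =>
        Real.exp (t * -m) * Real.exp (t * ((k : ℝ) - n * m)) := by
      funext k; rw [← Real.exp_add]; congr 1; push_cast; ring
    rw [e1, e2, binE_const_mul, binE_const_mul, ih]
    ring

/-- In `exp z ≤ 1 + z + z ^ 2`, valid for `|z| ≤ 1`, the linear term has mean zero for a centred
trial, whose variance is at most `1`. -/
theorem binE_exp_le (h0 : 0 ≤ m) (h1 : m ≤ 1) (n : ℕ) {t : ℝ} (ht : |t| ≤ 1) :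
    binE m n (fun k => Real.exp (t * ((k : ℝ) - n * m))) ≤ Real.exp (n * t ^ 2) := by
  have h1' : 0 ≤ 1 - m := by linarith
  have key : ∀ y : ℝ, |y| ≤ 1 → Real.exp (t * y) ≤ 1 + t * y + (t * y) ^ 2 := by
    intro y hy
    have h := Real.abs_exp_sub_one_sub_id_le (x := t * y) (by
      rw [abs_mul]; exact mul_le_one₀ ht (abs_nonneg _) hy)
    have := (abs_le.1 h).2
    linarith
  have k1 := key (1 - m) (by rw [abs_of_nonneg h1']; linarith)
  have k2 := key (-m) (by rw [abs_neg, abs_of_nonneg h0]; exact h1)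
  rw [binE_exp, Real.exp_nat_mul]
  refine pow_le_pow_left₀ (by positivity) ?_ n
  have h2 := Real.add_one_le_exp (t ^ 2)
  have h3 : m * (1 - m) ≤ 1 := mul_le_one₀ h1 h1' (by linarith)
  have h4 : t ^ 2 * (m * (1 - m)) ≤ t ^ 2 * 1 := by gcongr
  calc m * Real.exp (t * (1 - m)) + (1 - m) * Real.exp (t * -m)
      ≤ m * (1 + t * (1 - m) + (t * (1 - m)) ^ 2) + (1 - m) * (1 + t * -m + (t * -m) ^ 2) := by
        gcongr
    _ = 1 + t ^ 2 * (m * (1 - m)) := by ring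
    _ ≤ Real.exp (t ^ 2) := by linarith

/-- With `t = n ^ (-1/2)` the exponential moments at `±t` are at most `e`, and they dominate `(t *
y) ^ (2 * r) / (2 * r)!`. -/
theorem binMoment_even_le (h0 : 0 ≤ m) (h1 : m ≤ 1) (r : ℕ) :
    ∃ C, 0 ≤ C ∧ ∀ n : ℕ, 1 ≤ n → binMoment m n (2 * r) ≤ C * (n : ℝ) ^ r := by
  refine ⟨(2 * r).factorial * (2 * Real.exp 1), by positivity, fun n hn => ?_⟩
  have hn0 : (0 : ℝ) < n := by exact_mod_cast hn
  have hn1 : (1 : ℝ) ≤ n := by exact_mod_cast hn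
  set t : ℝ := (Real.sqrt n)⁻¹ with ht
  have hs : 1 ≤ Real.sqrt n := Real.one_le_sqrt.2 hn1
  have ht0 : 0 < t := by positivity
  have ht1 : |t| ≤ 1 := by rw [abs_of_pos ht0]; exact inv_le_one_of_one_le₀ hs
  have ht2 : (n : ℝ) * t ^ 2 = 1 := by
    rw [ht, inv_pow, Real.sq_sqrt hn0.le, mul_inv_cancel₀ hn0.ne']
  have hpt : ∀ y : ℝ, y ^ (2 * r) ≤ (n : ℝ) ^ r * ((2 * r).factorial *
      (Real.exp (t * y) + Real.exp (-t * y))) := by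
    intro y
    have h2 : |t * y| ^ (2 * r) / (2 * r).factorial ≤ Real.exp |t * y| :=
      Real.pow_div_factorial_le_exp _ (abs_nonneg _) _
    have h3 : Real.exp |t * y| ≤ Real.exp (t * y) + Real.exp (-t * y) := by
      rcases abs_choice (t * y) with h | h <;> rw [h]
      · have := Real.exp_pos (-t * y); linarith
      · have := Real.exp_pos (t * y); rw [← neg_mul]; linarith
    rw [div_le_iff₀ (by positivity), Even.pow_abs ⟨r, by ring⟩, mul_pow] at h2
    have h4 : y ^ (2 * r) = (n : ℝ) ^ r * (t ^ (2 * r) * y ^ (2 * r)) := by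
      rw [← mul_assoc, pow_mul t, ← mul_pow, ht2, one_pow, one_mul]
    rw [h4]
    have h5 : Real.exp |t * y| * ((2 * r).factorial : ℝ)
      ≤ (Real.exp (t * y) + Real.exp (-t * y)) * (2 * r).factorial := by gcongr
    have h6 := h2.trans h5
    rw [mul_comm _ ((2 * r).factorial : ℝ)] at h6
    gcongr
  calc binMoment m n (2 * r) ≤ binE m n (fun k => (n : ℝ) ^ r * ((2 * r).factorial *
      (Real.exp (t * ((k : ℝ) - n * m)) + Real.exp (-t * ((k : ℝ) - n * m))))) :=
        binE_mono h0 h1 n fun k => hpt _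
    _ = (n : ℝ) ^ r * ((2 * r).factorial * (binE m n (fun k => Real.exp (t * ((k : ℝ) - n * m)))
        + binE m n (fun k => Real.exp (-t * ((k : ℝ) - n * m))))) := by
        rw [binE_const_mul, binE_const_mul, binE_add]
    _ ≤ (n : ℝ) ^ r * ((2 * r).factorial * (Real.exp (n * t ^ 2) + Real.exp (n * (-t) ^ 2))) := by
        have := binE_exp_le h0 h1 n ht1
        have := binE_exp_le h0 h1 n (t := -t) (by rwa [abs_neg])
        gcongr
    _ = _ := by rw [neg_sq, ht2]; ring

end Binomial

/-! ### Counts in a set are binomial -/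

section Count

variable {n : ℕ}

/-- The number of sample points in the set `c`. -/
def countIn (c : Set ℝ) (x : Fin n → ℝ) : ℕ := ∑ i, c.indicator 1 (x i)

theorem countIn_le (c : Set ℝ) (x : Fin n → ℝ) : countIn c x ≤ n := by
  calc countIn c x ≤ ∑ _i : Fin n, 1 :=
        Finset.sum_le_sum fun i _ => Set.indicator_le_self' (fun _ _ => zero_le_one) (x i)
    _ = n := by simp

theorem measurable_countIn {c : Set ℝ} (hc : MeasurableSet c) :
    Measurable (countIn c : (Fin n → ℝ) → ℕ) := by
  unfold countIn
  exact Finset.measurable_fun_sum _ fun i _ =>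
    (measurable_one.indicator hc).comp (measurable_pi_apply i)

variable {μ : Measure ℝ} [IsProbabilityMeasure μ]

theorem integrable_comp_countIn {c : Set ℝ} (hc : MeasurableSet c) (g : ℕ → ℝ) :
    Integrable (fun x : Fin n → ℝ => g (countIn c x)) (sampleLaw μ n) := by
  refine Integrable.of_bound (C := ∑ k ∈ Finset.range (n + 1), ‖g k‖)
    ((measurable_from_top.comp (measurable_countIn hc)).aestronglyMeasurable) ?_
  refine Filter.Eventually.of_forall fun x => ?_
  exact Finset.single_le_sum (f := fun k => ‖g k‖) (fun k _ => norm_nonneg _)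
    (Finset.mem_range.2 (Nat.lt_succ_of_le (countIn_le c x)))

/-- Splitting off one coordinate and asking whether it lies in `c` reproduces the recursion that
defines `binE`. -/
theorem integral_comp_countIn {c : Set ℝ} (hc : MeasurableSet c) (g : ℕ → ℝ) :
    ∫ x : Fin n → ℝ, g (countIn c x) ∂sampleLaw μ n = binE (μ.real c) n g := by
  induction n generalizing g with
  | zero => simp [countIn, binE]
  | succ n ih =>
    have h := (measurePreserving_piFinSuccAbove (fun _ : Fin (n + 1) => μ) 0).symm
    have h1 : ∫ x : Fin (n + 1) → ℝ, g (countIn c x) ∂sampleLaw μ (n + 1)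
        = ∫ z : ℝ × (Fin n → ℝ), (c.indicator 1 z.1 * g (countIn c z.2 + 1)
          + cᶜ.indicator 1 z.1 * g (countIn c z.2)) ∂μ.prod (sampleLaw μ n) := by
      unfold sampleLaw
      rw [← h.integral_comp']
      refine integral_congr_ae (Filter.Eventually.of_forall fun z => ?_)
      have : countIn c ((MeasurableEquiv.piFinSuccAbove (fun _ : Fin (n + 1) => ℝ) 0).symm z)
          = c.indicator 1 z.1 + countIn c z.2 := by
        rw [countIn, Fin.sum_univ_succ]
        rfl
      simp only [this]
      by_cases hz : z.1 ∈ c <;> simp [hz, add_comm]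
    have i1 : Integrable (c.indicator (1 : ℝ → ℝ)) μ :=
      (integrable_indicator_iff hc).2 (integrable_const (1 : ℝ)).integrableOn
    have i2 : Integrable (cᶜ.indicator (1 : ℝ → ℝ)) μ :=
      (integrable_indicator_iff hc.compl).2 (integrable_const (1 : ℝ)).integrableOn
    rw [h1, integral_add (i1.mul_prod (integrable_comp_countIn hc fun k => g (k + 1)))
      (i2.mul_prod (integrable_comp_countIn hc g)),
      integral_prod_mul (c.indicator (1 : ℝ → ℝ)) fun x : Fin n → ℝ => g (countIn c x + 1),
      integral_prod_mul (cᶜ.indicator (1 : ℝ → ℝ)) fun x : Fin n → ℝ => g (countIn c x),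
      ih fun k => g (k + 1), ih g, integral_indicator_one hc, integral_indicator_one hc.compl,
      probReal_compl_eq_one_sub hc, binE]

end Count

/-! ### Central moments of a beta law from its raw moments -/

section CentralMoments

/-- The recursion of the central moments of a beta law with parameters `N * u` and `N * (1 - u)`. -/
structure BetaRecursion (N u : ℝ) (c : ℕ → ℝ) : Prop where
  zero : c 0 = 1
  one : c 1 = 0
  succ : ∀ k : ℕ, (N + k + 1) * c (k + 2)
    = (k + 1) * (u * (1 - u) * c k + (1 - 2 * u) * c (k + 1))

theorem BetaRecursion.abs_le {N u : ℝ} {c : ℕ → ℝ} (h : BetaRecursion N u c) (hN : 1 ≤ N)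
    (h0 : 0 ≤ u) (h1 : u ≤ 1) (k : ℕ) : |c (k + 2)| ≤ (k + 1) / N * (|c k| + |c (k + 1)|) := by
  have hN' : 0 < N := by linarith
  have e : N * |c (k + 2)| ≤ (k + 1) * (|c k| + |c (k + 1)|) := by
    calc N * |c (k + 2)| ≤ (N + k + 1) * |c (k + 2)| := by
          gcongr; linarith [(Nat.cast_nonneg k : (0 : ℝ) ≤ k)]
      _ = |(N + k + 1) * c (k + 2)| := by
          rw [abs_mul, abs_of_pos (a := N + k + 1) (by positivity)]
      _ = (k + 1) * |u * (1 - u) * c k + (1 - 2 * u) * c (k + 1)| := by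
          rw [h.succ, abs_mul, abs_of_pos (a := (k : ℝ) + 1) (by positivity)]
      _ ≤ (k + 1) * (1 * |c k| + 1 * |c (k + 1)|) := by
          gcongr
          refine (abs_add_le _ _).trans ?_
          rw [abs_mul, abs_mul (1 - 2 * u)]
          have a1 : |u * (1 - u)| ≤ 1 := by rw [_root_.abs_le]; constructor <;> nlinarith
          have a2 : |1 - 2 * u| ≤ 1 := by rw [_root_.abs_le]; constructor <;> linarith
          gcongr
      _ = _ := by ring
  rw [div_mul_eq_mul_div, le_div_iff₀ hN', mul_comm]
  exact e

/-- Two steps of the recursion gain a factor `1 / N`; since the first moment is zero, odd moments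
are as small as the next even one. The constant is uniform in `N` and `u`. -/
theorem BetaRecursion.bound (r : ℕ) : ∃ C, 0 ≤ C ∧ ∀ (N u : ℝ) (c : ℕ → ℝ), BetaRecursion N u c →
    1 ≤ N → 0 ≤ u → u ≤ 1 → |c (2 * r)| ≤ C / N ^ r ∧ |c (2 * r + 1)| ≤ C / N ^ (r + 1) := by
  induction r with
  | zero =>
    refine ⟨1, zero_le_one, fun N u c h hN h0 h1 => ?_⟩
    simp only [mul_zero, zero_add, h.zero, h.one]
    constructor
    · simp
    · simp only [abs_zero]; positivity
  | succ r ih =>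
    obtain ⟨C, hC, H⟩ := ih
    refine ⟨(2 * r + 2) * ((2 * r + 1) * (C + C) + C), by positivity, fun N u c h hN h0 h1 => ?_⟩
    have hN' : 0 < N := by linarith
    obtain ⟨a1, a2⟩ := H N u c h hN h0 h1
    have b1 := h.abs_le hN h0 h1 (2 * r)
    have b2 := h.abs_le hN h0 h1 (2 * r + 1)
    have a2' : C / N ^ (r + 1) ≤ C / N ^ r := by
      exact div_le_div_of_nonneg_left hC (by positivity) (pow_le_pow_right₀ hN (Nat.le_succ r))
    have e1 : |c (2 * r + 2)| ≤ (2 * r + 1) * (C + C) / N ^ (r + 1) := by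
      calc |c (2 * r + 2)| ≤ ((2 * r : ℕ) + 1) / N * (C / N ^ r + C / N ^ r) := by
            refine b1.trans ?_
            have := a2.trans a2'
            gcongr
        _ = _ := by push_cast; rw [pow_succ]; field_simp
    have e2 : |c (2 * r + 3)| ≤ (2 * r + 2) * ((2 * r + 1) * (C + C) + C) / N ^ (r + 2) := by
      calc |c (2 * r + 3)| ≤ ((2 * r + 1 : ℕ) + 1) / N *
            (C / N ^ (r + 1) + (2 * r + 1) * (C + C) / N ^ (r + 1)) := by
            refine b2.trans ?_
            gcongr
        _ = _ := by push_cast; field_simp; ring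
    refine ⟨?_, e2⟩
    rw [show 2 * (r + 1) = 2 * r + 2 by ring]
    refine e1.trans ?_
    refine div_le_div_of_nonneg_right ?_ (by positivity)
    have : (0 : ℝ) ≤ (2 * r + 1) * (C + C) := by positivity
    nlinarith [(Nat.cast_nonneg r : (0 : ℝ) ≤ r)]

variable {Ω : Type*} [MeasurableSpace Ω] {P : Measure Ω} [IsProbabilityMeasure P] {X : Ω → ℝ}

theorem integrable_comp_of_unit (hX : Measurable X) (h01 : ∀ ω, X ω ∈ Set.Icc (0 : ℝ) 1)
    {g : ℝ → ℝ} (hg : Continuous g) : Integrable (fun ω => g (X ω)) P := by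
  obtain ⟨C, hC⟩ := (isCompact_Icc (a := (0 : ℝ)) (b := 1)).exists_bound_of_continuousOn
    hg.continuousOn
  exact Integrable.of_bound (hg.measurable.comp hX).aestronglyMeasurable C
    (Filter.Eventually.of_forall fun ω => hC _ (h01 ω))

/-- Stein's identity for the beta law. By linearity it suffices to take monomials, where it is the
ratio `(s + r) / (N + r)` of consecutive moments. -/
theorem stein_identity (hX : Measurable X) (h01 : ∀ ω, X ω ∈ Set.Icc (0 : ℝ) 1) {s N : ℝ}
    (hN : 0 < N) (hmom : ∀ r : ℕ, ∫ ω, X ω ^ r ∂P = ∏ i ∈ Finset.range r, (s + i) / (N + i))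
    (g : Polynomial ℝ) :
    ∫ ω, X ω * (1 - X ω) * g.derivative.eval (X ω) ∂P = ∫ ω, (N * X ω - s) * g.eval (X ω) ∂P := by
  have hI : ∀ g : ℝ → ℝ, Continuous g → Integrable (fun ω => g (X ω)) P :=
    fun g hg => integrable_comp_of_unit hX h01 hg
  have hrec : ∀ r : ℕ, (N + r) * ∫ ω, X ω ^ (r + 1) ∂P = (s + r) * ∫ ω, X ω ^ r ∂P := by
    intro r
    rw [hmom, hmom, Finset.prod_range_succ]
    have : N + r ≠ 0 := by positivity
    field_simp
  induction g using Polynomial.induction_on' with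
  | add p q hp hq =>
    simp only [Polynomial.derivative_add, Polynomial.eval_add, mul_add]
    rw [integral_add (hI (fun x => x * (1 - x) * p.derivative.eval x) (by fun_prop))
      (hI (fun x => x * (1 - x) * q.derivative.eval x) (by fun_prop)),
      integral_add (hI (fun x => (N * x - s) * p.eval x) (by fun_prop))
      (hI (fun x => (N * x - s) * q.eval x) (by fun_prop)), hp, hq]
  | monomial n a =>
    have hR : ∫ ω, (N * X ω - s) * (Polynomial.monomial n a).eval (X ω) ∂P
        = a * (N * ∫ ω, X ω ^ (n + 1) ∂P - s * ∫ ω, X ω ^ n ∂P) := by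
      rw [← integral_const_mul, ← integral_const_mul, ← integral_sub
        (hI (fun x => N * x ^ (n + 1)) (by fun_prop)) (hI (fun x => s * x ^ n) (by fun_prop)),
        ← integral_const_mul]
      refine integral_congr_ae (Filter.Eventually.of_forall fun ω => ?_)
      simp only [Polynomial.eval_monomial]
      ring
    rw [hR]
    cases n with
    | zero =>
      have := hrec 0
      simp only [Nat.cast_zero, add_zero] at this
      rw [this]
      simp
    | succ n =>
      have hL : ∫ ω, X ω * (1 - X ω) * (Polynomial.monomial (n + 1) a).derivative.eval (X ω) ∂P
          = a * (n + 1) * (∫ ω, X ω ^ (n + 1) ∂P - ∫ ω, X ω ^ (n + 2) ∂P) := by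
        rw [← integral_sub (hI (fun x => x ^ (n + 1)) (by fun_prop))
          (hI (fun x => x ^ (n + 2)) (by fun_prop)), ← integral_const_mul]
        refine integral_congr_ae (Filter.Eventually.of_forall fun ω => ?_)
        simp only [Polynomial.derivative_monomial, Polynomial.eval_monomial]
        push_cast
        ring
      rw [hL]
      have := hrec (n + 1)
      push_cast at this
      linear_combination (-a) * this

/-- With `u = s / N`, apply Stein's identity to `(x - u) ^ (k + 1)` and write `x(1-x) = u(1-u) +
(1-2u)(x-u) - (x-u)^2`; the last term, moved to the other side, turns `N` into `N + k + 1`. -/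
theorem betaRecursion_of_moments (hX : Measurable X) (h01 : ∀ ω, X ω ∈ Set.Icc (0 : ℝ) 1)
    {s N : ℝ} (hN : 0 < N)
    (hmom : ∀ r : ℕ, ∫ ω, X ω ^ r ∂P = ∏ i ∈ Finset.range r, (s + i) / (N + i)) :
    BetaRecursion N (s / N) fun k => ∫ ω, (X ω - s / N) ^ k ∂P := by
  have hI : ∀ g : ℝ → ℝ, Continuous g → Integrable (fun ω => g (X ω)) P :=
    fun g hg => integrable_comp_of_unit hX h01 hg
  refine ⟨by simp, ?_, fun k => ?_⟩
  · have := hmom 1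
    simp only [pow_one, Finset.prod_range_one, Nat.cast_zero, add_zero] at this ⊢
    rw [integral_sub (hI (fun x => x) continuous_id) (integrable_const _), this]
    simp
  · have h := stein_identity hX h01 hN hmom ((Polynomial.X - Polynomial.C (s / N)) ^ (k + 1))
    simp only [Polynomial.derivative_pow, Polynomial.derivative_sub, Polynomial.derivative_X,
      Polynomial.derivative_C, Polynomial.eval_mul, Polynomial.eval_pow, Polynomial.eval_sub,
      Polynomial.eval_X, Polynomial.eval_C, sub_zero, mul_one,
      Nat.add_sub_cancel] at h
    have hL : ∀ ω, (k + 1) * (s / N * (1 - s / N) * (X ω - s / N) ^ k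
        + (1 - 2 * (s / N)) * (X ω - s / N) ^ (k + 1) - (X ω - s / N) ^ (k + 2))
        = X ω * (1 - X ω) * ((Polynomial.C ((k + 1 : ℕ) : ℝ)).eval (X ω) * (X ω - s / N) ^ k) := by
      intro ω
      rw [Polynomial.eval_C]
      push_cast
      ring
    have hR : ∀ ω, N * (X ω - s / N) ^ (k + 2) = (N * X ω - s) * (X ω - s / N) ^ (k + 1) := by
      intro ω
      have e : N * X ω - s = N * (X ω - s / N) := by field_simp
      rw [e]
      ring
    simp only [Polynomial.eval_C, ← hR] at h hL
    simp only [← hL] at h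
    rw [integral_const_mul, integral_const_mul, integral_sub
      (hI (fun x => s / N * (1 - s / N) * (x - s / N) ^ k
        + (1 - 2 * (s / N)) * (x - s / N) ^ (k + 1)) (by fun_prop))
      (hI (fun x => (x - s / N) ^ (k + 2)) (by fun_prop)),
      integral_add (hI (fun x => s / N * (1 - s / N) * (x - s / N) ^ k) (by fun_prop))
      (hI (fun x => (1 - 2 * (s / N)) * (x - s / N) ^ (k + 1)) (by fun_prop)),
      integral_const_mul, integral_const_mul] at h
    linear_combination (-1) * h

end CentralMoments

/-! ### From the Taylor remainder to expansions of expectations -/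

theorem secondOrderExpansion_of_tendsto {p : ℕ} {R : ℕ → ℝ≥0∞} {W c : ℕ → ℝ}
    (hR : ∀ᶠ n in atTop, R n ≠ ⊤ ∧ (R n).toReal = W n)
    (hW : Tendsto (fun n : ℕ => (n : ℝ) ^ 2 * (W n - p / (2 * n)) - c n) atTop (𝓝 0)) :
    SecondOrderExpansion p R c := by
  refine ⟨hR.mono fun n h => h.1, ?_⟩
  rw [isLittleO_iff_tendsto' (by
    filter_upwards [eventually_gt_atTop 0] with n hn h
    have : (n : ℝ) ≠ 0 := by exact_mod_cast hn.ne'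
    simp [this] at h)]
  refine hW.congr' ?_
  filter_upwards [hR, eventually_gt_atTop 0] with n h hn
  have : (n : ℝ) ≠ 0 := by exact_mod_cast hn.ne'
  rw [h.2]
  field_simp
  ring

/-- `C` may depend on `ε`: for fixed `ε` the second term is `O(n⁻³)`, and the first is an
arbitrarily small multiple of `n⁻²`. -/
theorem tendsto_sq_mul_of_bound {D a b : ℕ → ℝ} {K : ℝ}
    (h : ∀ ε : ℝ, 0 < ε → ∃ C, 0 ≤ C ∧ ∀ᶠ n in atTop, |D n| ≤ ε * a n + C * b n)
    (ha : ∀ᶠ n : ℕ in atTop, a n ≤ K / (n : ℝ) ^ 2)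
    (hb : ∀ᶠ n : ℕ in atTop, b n ≤ K / (n : ℝ) ^ 3) :
    Tendsto (fun n : ℕ => (n : ℝ) ^ 2 * D n) atTop (𝓝 0) := by
  rw [Metric.tendsto_atTop']
  intro ε hε
  obtain ⟨C, hC, hD⟩ := h (ε / (2 * (|K| + 1))) (by positivity)
  have hlim : Tendsto (fun n : ℕ => C * K / (n : ℝ)) atTop (𝓝 0) :=
    tendsto_const_div_atTop_nhds_zero_nat _
  have hev : ∀ᶠ n : ℕ in atTop, C * K / (n : ℝ) < ε / 2 := hlim.eventually_lt_const (by positivity)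
  have : ∀ᶠ n : ℕ in atTop, dist ((n : ℝ) ^ 2 * D n) 0 < ε := by
    filter_upwards [hD, ha, hb, hev, eventually_gt_atTop 0] with n h1 h2 h3 h4 hn
    have hn' : (0 : ℝ) < n := by exact_mod_cast hn
    rw [Real.dist_eq, sub_zero, abs_mul, abs_of_pos (by positivity)]
    calc (n : ℝ) ^ 2 * |D n| ≤ (n : ℝ) ^ 2 *
          (ε / (2 * (|K| + 1)) * (|K| / (n : ℝ) ^ 2) + C * (K / (n : ℝ) ^ 3)) := by
          have : K / (n : ℝ) ^ 2 ≤ |K| / (n : ℝ) ^ 2 := by gcongr; exact le_abs_self K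
          have := h2.trans this
          refine mul_le_mul_of_nonneg_left (h1.trans ?_) (by positivity)
          gcongr
      _ = ε / 2 * (|K| / (|K| + 1)) + C * K / n := by field_simp
      _ < ε / 2 * 1 + ε / 2 := by
          have : |K| / (|K| + 1) ≤ 1 := (div_le_one (by positivity)).2 (by linarith)
          refine add_lt_add_of_le_of_lt ?_ h4
          gcongr
      _ = ε := by ring
  obtain ⟨N, hN⟩ := eventually_atTop.1 this
  exact ⟨N, fun n hn => hN n hn.le⟩

section Remainder

variable {Ω : Type*} [MeasurableSpace Ω] {P : Measure Ω} [IsProbabilityMeasure P] {Y : Ω → ℝ}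

/-- The pointwise remainder bound, averaged over an event. It serves both methods: `A` excludes
empty cells for fixed intervals and is everything for moving ones. -/
theorem integral_symF_sub_symTaylor (hY : Measurable Y) {α M ε C : ℝ} {q : ℕ} {A : Set Ω}
    (hA : MeasurableSet A) (h0 : ∀ ω, 0 ≤ Y ω) (hM : ∀ ω, Y ω ≤ M)
    (hpos : ∀ᵐ ω ∂P, ω ∈ A → 0 < Y ω)
    (hint : IntegrableOn (fun ω => (Y ω - 1) ^ 6 * ((Y ω)⁻¹) ^ q) A P)
    (hrem : ∀ x, 0 < x → x ≤ M →
      |symF α x - symTaylor α x| ≤ ε * (x - 1) ^ 4 + C * ((x - 1) ^ 6 * (x⁻¹) ^ q)) :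
    IntegrableOn (fun ω => symF α (Y ω)) A P ∧
      |∫ ω in A, symF α (Y ω) ∂P - ∫ ω in A, symTaylor α (Y ω) ∂P|
        ≤ ε * ∫ ω in A, (Y ω - 1) ^ 4 ∂P + C * ∫ ω in A, (Y ω - 1) ^ 6 * ((Y ω)⁻¹) ^ q ∂P := by
  have hcont : ∀ g : ℝ → ℝ, Continuous g → Integrable (fun ω => g (Y ω)) P := by
    intro g hg
    obtain ⟨B, hB⟩ := (isCompact_Icc (a := (0 : ℝ)) (b := M)).exists_bound_of_continuousOn
      hg.continuousOn
    exact Integrable.of_bound (hg.measurable.comp hY).aestronglyMeasurable B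
      (Filter.Eventually.of_forall fun ω => hB _ ⟨h0 ω, hM ω⟩)
  have hT : IntegrableOn (fun ω => symTaylor α (Y ω)) A P :=
    (hcont _ (continuous_symTaylor α)).integrableOn
  have h4 : IntegrableOn (fun ω => (Y ω - 1) ^ 4) A P :=
    (hcont (fun x => (x - 1) ^ 4) (by fun_prop)).integrableOn
  have hB : IntegrableOn (fun ω => ε * (Y ω - 1) ^ 4 + C * ((Y ω - 1) ^ 6 * ((Y ω)⁻¹) ^ q)) A P :=
    (h4.const_mul ε).add (hint.const_mul C)
  have hae : ∀ᵐ ω ∂P.restrict A, ‖symF α (Y ω) - symTaylor α (Y ω)‖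
      ≤ ε * (Y ω - 1) ^ 4 + C * ((Y ω - 1) ^ 6 * ((Y ω)⁻¹) ^ q) := by
    rw [ae_restrict_iff' hA]
    filter_upwards [hpos] with ω hω hωA
    exact hrem _ (hω hωA) (hM ω)
  have hD : IntegrableOn (fun ω => symF α (Y ω) - symTaylor α (Y ω)) A P :=
    Integrable.mono' hB (((measurable_symF α).comp hY).sub
      ((continuous_symTaylor α).measurable.comp hY)).aestronglyMeasurable hae
  have hF : IntegrableOn (fun ω => symF α (Y ω)) A P := by
    refine (hD.add hT).congr (Filter.Eventually.of_forall fun ω => ?_)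
    simp
  refine ⟨hF, ?_⟩
  rw [← integral_sub hF hT, ← integral_const_mul, ← integral_const_mul,
    ← integral_add (h4.const_mul ε) (hint.const_mul C)]
  exact norm_integral_le_of_norm_le hB hae

end Remainder

theorem fAlphaExt_eq {α x : ℝ} (h : x ≠ 0 ∨ -1 < α) :
    fAlphaExt α x = ENNReal.ofReal (fAlpha α x) := by
  rw [fAlphaExt, if_neg]
  rintro ⟨h1, h2⟩
  exact h.elim (fun h => h h1) (fun h => h.not_ge h2)

theorem symF_nonneg_of {α x : ℝ} (hx : 0 ≤ x) (h : 0 < x ∨ |α| < 1) : 0 ≤ symF α x := by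
  refine div_nonneg (add_nonneg (fAlpha_nonneg α x hx ?_) (fAlpha_nonneg (-α) x hx ?_)) zero_le_two
  · exact h.imp_right fun h => (abs_lt.1 h).1
  · exact h.imp_right fun h => by linarith [(abs_lt.1 h).2]

theorem symDiv_eq {p : ℕ} {α : ℝ} {m m' : Fin (p + 1) → ℝ} (hm : ∀ i, 0 < m i)
    (hm' : ∀ i, 0 ≤ m' i) (h : (∀ i, 0 < m' i) ∨ |α| < 1) :
    symDiv α m m' = ENNReal.ofReal (∑ i, m i * symF α (m' i / m i)) := by
  have hx : ∀ i, 0 ≤ m' i / m i := fun i => div_nonneg (hm' i) (hm i).le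
  have hx' : ∀ i, 0 < m' i / m i ∨ |α| < 1 := fun i => h.imp_left fun h => div_pos (h i) (hm i)
  have key : ∀ β : ℝ, |β| = |α| → alphaDiv β m m'
      = ENNReal.ofReal (∑ i, m i * fAlpha β (m' i / m i)) ∧
      0 ≤ ∑ i, m i * fAlpha β (m' i / m i) := by
    intro β hβ
    have hb : ∀ i, 0 < m' i / m i ∨ -1 < β := fun i =>
      (hx' i).imp_right fun h => (abs_lt.1 (hβ ▸ h)).1
    have hn : ∀ i, 0 ≤ m i * fAlpha β (m' i / m i) := fun i =>
      mul_nonneg (hm i).le (fAlpha_nonneg β _ (hx i) (hb i))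
    refine ⟨?_, Finset.sum_nonneg fun i _ => hn i⟩
    rw [alphaDiv, ENNReal.ofReal_sum_of_nonneg fun i _ => hn i]
    refine Finset.sum_congr rfl fun i _ => ?_
    rw [fAlphaExt_eq ((hb i).imp_left ne_of_gt), ENNReal.ofReal_mul (hm i).le]
  obtain ⟨e1, n1⟩ := key α rfl
  obtain ⟨e2, n2⟩ := key (-α) (abs_neg α)
  rw [symDiv, e1, e2, ← ENNReal.ofReal_add n1 n2,
    show (2 : ℝ≥0∞) = ENNReal.ofReal 2 by simp, ← ENNReal.ofReal_div_of_pos two_pos]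
  congr 1
  rw [← Finset.sum_add_distrib, Finset.sum_div]
  refine Finset.sum_congr rfl fun i _ => ?_
  rw [symF]
  ring

/-! ### Endpoints, cells and their total probability -/

section WithEnds

variable {p : ℕ} {β : Type*}

theorem withEnds_zero (lo hi : β) (a : Fin p → β) : withEnds lo hi a 0 = lo := rfl

theorem withEnds_last (lo hi : β) (a : Fin p → β) : withEnds lo hi a (Fin.last (p + 1)) = hi := by
  rw [withEnds, ← Fin.succ_last, Fin.cons_succ, Fin.snoc_last]

theorem withEnds_mid (lo hi : β) (a : Fin p → β) (i : Fin p) :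
    withEnds lo hi a i.castSucc.succ = a i := by
  rw [withEnds, Fin.cons_succ, Fin.snoc_castSucc]

theorem comp_withEnds {γ : Type*} (f : β → γ) (lo hi : β) (a : Fin p → β) (i : Fin (p + 2)) :
    withEnds (f lo) (f hi) (fun i => f (a i)) i = f (withEnds lo hi a i) := by
  refine Fin.cases rfl (fun i => ?_) i
  refine Fin.lastCases ?_ (fun i => ?_) i
  · rw [Fin.succ_last, withEnds_last, withEnds_last]
  · rw [withEnds_mid, withEnds_mid]

theorem sum_sub_eq (w : Fin (p + 2) → ℝ) :
    ∑ i : Fin (p + 1), (w i.succ - w i.castSucc) = w (Fin.last (p + 1)) - w 0 := by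
  rw [Finset.sum_sub_distrib]
  have h1 := Fin.sum_univ_succ w
  have h2 := Fin.sum_univ_castSucc w
  linarith

end WithEnds

section CellProb

variable {p : ℕ} {μ : Measure ℝ} [IsProbabilityMeasure μ]

theorem measurableSet_cell (a : Fin p → EReal) (i : Fin (p + 1)) : MeasurableSet (cell a i) :=
  (measurableSet_lt measurable_const measurable_coe_real_ereal).inter
    (measurableSet_lt measurable_coe_real_ereal measurable_const)

theorem measureReal_Ioo_ereal [NullSingletonClass μ] {b b' : EReal} (h : b ≤ b') :
    μ.real {x : ℝ | b < x ∧ (x : EReal) < b'}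
      = μ.real {x : ℝ | (x : EReal) < b'} - μ.real {x : ℝ | (x : EReal) < b} := by
  have hm : ∀ b : EReal, MeasurableSet {x : ℝ | (x : EReal) < b} := fun b =>
    measurableSet_lt measurable_coe_real_ereal measurable_const
  have h1 : {x : ℝ | (x : EReal) < b} ⊆ {x : ℝ | (x : EReal) < b'} :=
    fun x (hx : (x : EReal) < b) => hx.trans_le h
  rw [← measureReal_sdiff h1 (hm b)]
  refine measureReal_congr ?_
  have hne : ∀ᵐ x ∂μ, x ≠ b.toReal := by simp [ae_iff]
  filter_upwards [hne] with x hx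
  refine propext ?_
  change (b < x ∧ (x : EReal) < b') ↔ ((x : EReal) < b' ∧ ¬ ((x : EReal) < b))
  have : (x : EReal) ≠ b := fun e => hx (by rw [← e, EReal.toReal_coe])
  rw [not_lt, this.symm.le_iff_lt, and_comm]

theorem sum_cellProb [NullSingletonClass μ] (a : Fin p → EReal) (h : ∀ i, 0 < cellProb μ a i) :
    ∑ i, cellProb μ a i = 1 := by
  have h1 : ∀ i : Fin (p + 1), cellProb μ a i
      = μ.real {x : ℝ | (x : EReal) < withEnds ⊥ ⊤ a i.succ}
        - μ.real {x : ℝ | (x : EReal) < withEnds ⊥ ⊤ a i.castSucc} := by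
    intro i
    refine measureReal_Ioo_ereal ?_
    -- Endpoints in the wrong order would give an empty cell, against its positive probability.
    by_contra hc
    have : cell a i = ∅ := by
      ext x
      simp only [cell, Set.mem_ofPred_eq, Set.mem_empty_iff_false, iff_false]
      exact fun hx => hc (hx.1.trans hx.2).le
    have h2 := h i
    rw [cellProb, this, measureReal_empty] at h2
    exact lt_irrefl _ h2
  rw [Finset.sum_congr rfl fun i _ => h1 i,
    sum_sub_eq fun i => μ.real {x : ℝ | (x : EReal) < withEnds ⊥ ⊤ a i}, withEnds_last, withEnds_zero]
  simp

end CellProb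

/-! ### One fixed interval -/

section FixedCell

variable {n : ℕ} {μ : Measure ℝ} {c : Set ℝ}

/-- The relative frequency of the set `c` in the sample, divided by the probability of `c`. -/
def freqRatio (μ : Measure ℝ) (c : Set ℝ) (x : Fin n → ℝ) : ℝ := (countIn c x : ℝ) / n / μ.real c

theorem measurable_freqRatio (hc : MeasurableSet c) :
    Measurable (freqRatio μ c : (Fin n → ℝ) → ℝ) :=
  ((measurable_from_top.comp (measurable_countIn hc)).div_const _).div_const _

theorem freqRatio_nonneg (x : Fin n → ℝ) : 0 ≤ freqRatio μ c x := by
  unfold freqRatio; positivity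

theorem freqRatio_le (hm : 0 < μ.real c) (x : Fin n → ℝ) : freqRatio μ c x ≤ 1 / μ.real c := by
  unfold freqRatio
  gcongr
  exact div_le_one_of_le₀ (by exact_mod_cast countIn_le c x) (Nat.cast_nonneg n)

variable [IsProbabilityMeasure μ]

theorem integrable_comp_freqRatio (hc : MeasurableSet c) (g : ℝ → ℝ) :
    Integrable (fun x : Fin n → ℝ => g (freqRatio μ c x)) (sampleLaw μ n) :=
  integrable_comp_countIn hc fun k => g ((k : ℝ) / n / μ.real c)

theorem integral_freqRatio_pow (hc : MeasurableSet c) (hm : 0 < μ.real c) (hn : 0 < n) (r : ℕ) :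
    ∫ x : Fin n → ℝ, (freqRatio μ c x - 1) ^ r ∂sampleLaw μ n
      = binMoment (μ.real c) n r / (n * μ.real c) ^ r := by
  have hn' : (0 : ℝ) < n := by exact_mod_cast hn
  rw [div_eq_inv_mul, binMoment, ← binE_const_mul, ← integral_comp_countIn hc]
  refine integral_congr_ae (Filter.Eventually.of_forall fun x => ?_)
  simp only [freqRatio]
  rw [← inv_pow, ← mul_pow]
  congr 1
  field_simp

theorem exists_integral_freqRatio_le (hc : MeasurableSet c) (hm : 0 < μ.real c) (r : ℕ) :
    ∃ K, 0 ≤ K ∧ ∀ n : ℕ, 0 < n →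
      ∫ x : Fin n → ℝ, (freqRatio μ c x - 1) ^ (2 * r) ∂sampleLaw μ n ≤ K / (n : ℝ) ^ r := by
  obtain ⟨C, hC, h⟩ := binMoment_even_le hm.le measureReal_le_one r
  refine ⟨C / μ.real c ^ (2 * r), by positivity, fun n hn => ?_⟩
  have hn' : (0 : ℝ) < n := by exact_mod_cast hn
  rw [integral_freqRatio_pow hc hm hn]
  calc binMoment (μ.real c) n (2 * r) / (n * μ.real c) ^ (2 * r)
      ≤ C * (n : ℝ) ^ r / (n * μ.real c) ^ (2 * r) := by
        have := h n hn
        gcongr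
    _ = _ := by rw [mul_pow, two_mul, pow_add (n : ℝ)]; field_simp

/-- For `y < 1/2` the factor `4 * (y - 1) ^ 2` is at least `1`, so its `q`-th power may be inserted.
In expectation this gains the `n ^ (-q)` that compensates for `y⁻¹ ^ q ≤ n ^ q`. -/
theorem singular_weight_le {n y : ℝ} (hn : 0 ≤ n) (hy : 0 < y) (hyn : y⁻¹ ≤ n) (q : ℕ) :
    (y - 1) ^ 6 * (y⁻¹) ^ q
      ≤ 2 ^ q * (y - 1) ^ (2 * 3) + n ^ q * 4 ^ q * (y - 1) ^ (2 * (3 + q)) := by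
  have e0 : 0 ≤ (y - 1) ^ 6 := by positivity
  have e1 : (y - 1) ^ (2 * (3 + q)) = (y - 1) ^ 6 * ((y - 1) ^ 2) ^ q := by
    rw [← pow_mul, ← pow_add]; congr 1; ring
  rw [e1, show 2 * 3 = 6 by norm_num]
  rcases le_or_gt (1 / 2) y with h | h
  · have : y⁻¹ ≤ 2 := by rw [inv_le_comm₀ hy two_pos]; linarith
    calc (y - 1) ^ 6 * (y⁻¹) ^ q ≤ (y - 1) ^ 6 * 2 ^ q := by gcongr
      _ = 2 ^ q * (y - 1) ^ 6 := mul_comm _ _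
      _ ≤ _ := le_add_of_nonneg_right (by positivity)
  · have h4 : 1 ≤ 4 * (y - 1) ^ 2 := by nlinarith
    calc (y - 1) ^ 6 * (y⁻¹) ^ q ≤ (y - 1) ^ 6 * n ^ q * 1 := by rw [mul_one]; gcongr
      _ ≤ (y - 1) ^ 6 * n ^ q * (4 * (y - 1) ^ 2) ^ q := by
        gcongr
        exact one_le_pow₀ h4
      _ = n ^ q * 4 ^ q * ((y - 1) ^ 6 * ((y - 1) ^ 2) ^ q) := by rw [mul_pow]; ring
      _ ≤ _ := le_add_of_nonneg_left (by positivity)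

theorem exists_integral_singular_le (hc : MeasurableSet c) (hm : 0 < μ.real c) (q : ℕ) :
    ∃ K, 0 ≤ K ∧ ∀ (n : ℕ) (A : Set (Fin n → ℝ)), 0 < n → MeasurableSet A →
      (∀ x ∈ A, 0 < countIn c x) →
      ∫ x in A, (freqRatio μ c x - 1) ^ 6 * ((freqRatio μ c x)⁻¹) ^ q ∂sampleLaw μ n
        ≤ K / (n : ℝ) ^ 3 := by
  obtain ⟨K1, hK1, h1⟩ := exists_integral_freqRatio_le hc hm 3
  obtain ⟨K2, hK2, h2⟩ := exists_integral_freqRatio_le hc hm (3 + q)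
  refine ⟨2 ^ q * K1 + 4 ^ q * K2, by positivity, fun n A hn hA hpos => ?_⟩
  have hn' : (0 : ℝ) < n := by exact_mod_cast hn
  have i1 := (integrable_comp_freqRatio (n := n) (μ := μ) hc fun y => (y - 1) ^ (2 * 3)).const_mul
    (2 ^ q)
  have i2 := (integrable_comp_freqRatio (n := n) (μ := μ) hc fun y =>
    (y - 1) ^ (2 * (3 + q))).const_mul ((n : ℝ) ^ q * 4 ^ q)
  calc ∫ x in A, (freqRatio μ c x - 1) ^ 6 * ((freqRatio μ c x)⁻¹) ^ q ∂sampleLaw μ n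
      ≤ ∫ x in A, (2 ^ q * (freqRatio μ c x - 1) ^ (2 * 3)
          + (n : ℝ) ^ q * 4 ^ q * (freqRatio μ c x - 1) ^ (2 * (3 + q))) ∂sampleLaw μ n := by
        refine setIntegral_mono_on
          (integrable_comp_freqRatio hc fun y => (y - 1) ^ 6 * (y⁻¹) ^ q).integrableOn
          (i1.add i2).integrableOn hA fun x hx => ?_
        have hk : (1 : ℝ) ≤ countIn c x := by exact_mod_cast hpos x hx
        have hk0 : (0 : ℝ) < countIn c x := one_pos.trans_le hk
        have hm1 : μ.real c ≤ 1 := measureReal_le_one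
        refine singular_weight_le hn'.le (by unfold freqRatio; positivity) ?_ q
        rw [freqRatio, div_div, inv_div, div_le_iff₀ (by positivity)]
        gcongr
        exact hm1.trans hk
    _ ≤ ∫ x, (2 ^ q * (freqRatio μ c x - 1) ^ (2 * 3)
          + (n : ℝ) ^ q * 4 ^ q * (freqRatio μ c x - 1) ^ (2 * (3 + q))) ∂sampleLaw μ n := by
        refine setIntegral_le_integral (i1.add i2) (Filter.Eventually.of_forall fun x => ?_)
        have e1 := (even_two_mul 3).pow_nonneg (freqRatio μ c x - 1)
        have e2 := (even_two_mul (3 + q)).pow_nonneg (freqRatio μ c x - 1)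
        change (0 : ℝ) ≤ _
        positivity
    _ ≤ 2 ^ q * (K1 / (n : ℝ) ^ 3) + (n : ℝ) ^ q * 4 ^ q * (K2 / (n : ℝ) ^ (3 + q)) := by
        rw [integral_add i1 i2, integral_const_mul, integral_const_mul]
        have := h1 n hn
        have := h2 n hn
        gcongr
    _ = _ := by rw [pow_add]; field_simp

/-- An empty cell has ratio `0`, hence `(0 - 1) ^ 6 = 1`; Markov's inequality applies. -/
theorem exists_measureReal_empty_le (hc : MeasurableSet c) (hm : 0 < μ.real c) :
    ∃ K, 0 ≤ K ∧ ∀ n : ℕ, 0 < n →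
      (sampleLaw μ n).real {x | countIn c x = 0} ≤ K / (n : ℝ) ^ 3 := by
  obtain ⟨K, hK, h⟩ := exists_integral_freqRatio_le hc hm 3
  refine ⟨K, hK, fun n hn => le_trans ?_ (h n hn)⟩
  have := mul_meas_ge_le_integral_of_nonneg (μ := sampleLaw μ n)
    (f := fun x : Fin n → ℝ => (freqRatio μ c x - 1) ^ (2 * 3))
    (Filter.Eventually.of_forall fun x => by
      exact (even_two_mul 3).pow_nonneg _)
    (integrable_comp_freqRatio hc fun y => (y - 1) ^ (2 * 3)) 1
  rw [one_mul] at this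
  refine le_trans (measureReal_mono fun x hx => ?_) this
  have hx' : countIn c x = 0 := hx
  norm_num [freqRatio, hx']

/-- The coefficient of `n ^ (-2)` in the expected divergence contributed by an interval of
probability `m`. -/
def fixedCoeff (α m : ℝ) : ℝ :=
  -((1 - m) * (1 - 2 * m) / (4 * m)) + (α ^ 2 + 15) / 32 * ((1 - m) ^ 2 / m)

theorem integral_symTaylor_freqRatio (hc : MeasurableSet c) (hm : 0 < μ.real c) (hn : 0 < n)
    (α : ℝ) :
    ∫ x : Fin n → ℝ, symTaylor α (freqRatio μ c x) ∂sampleLaw μ n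
      = binMoment (μ.real c) n 2 / (n * μ.real c) ^ 2 / 2
        - binMoment (μ.real c) n 3 / (n * μ.real c) ^ 3 / 4
        + (α ^ 2 + 15) / 96 * (binMoment (μ.real c) n 4 / (n * μ.real c) ^ 4) := by
  rw [← integral_freqRatio_pow hc hm hn, ← integral_freqRatio_pow hc hm hn,
    ← integral_freqRatio_pow hc hm hn, ← integral_const_mul, ← integral_div, ← integral_div,
    ← integral_sub, ← integral_add]
  · rfl
  · exact integrable_comp_freqRatio hc fun y => (y - 1) ^ 2 / 2 - (y - 1) ^ 3 / 4
  · exact integrable_comp_freqRatio hc fun y => (α ^ 2 + 15) / 96 * (y - 1) ^ 4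
  · exact integrable_comp_freqRatio hc fun y => (y - 1) ^ 2 / 2
  · exact integrable_comp_freqRatio hc fun y => (y - 1) ^ 3 / 4

theorem tendsto_symTaylor_freqRatio (hc : MeasurableSet c) (hm : 0 < μ.real c) (α : ℝ) :
    Tendsto (fun n : ℕ => (n : ℝ) ^ 2 * (μ.real c *
        ∫ x : Fin n → ℝ, symTaylor α (freqRatio μ c x) ∂sampleLaw μ n
          - (1 - μ.real c) / (2 * n)))
      atTop (𝓝 (fixedCoeff α (μ.real c))) := by
  set m := μ.real c with hmdef
  -- The moments of orders two and three contribute exactly; the error is a constant over `n` coming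
  -- from the fourth.
  have hlim : Tendsto (fun n : ℕ => fixedCoeff α m
      + ((α ^ 2 + 15) / 96 * ((1 - m) * (1 - 3 * (m * (1 - m)))) / m ^ 2
        - (α ^ 2 + 15) / 32 * ((1 - m) ^ 2 / m)) / (n : ℝ)) atTop (𝓝 (fixedCoeff α m + 0)) :=
    tendsto_const_nhds.add (tendsto_const_div_atTop_nhds_zero_nat _)
  rw [add_zero] at hlim
  refine hlim.congr' ?_
  filter_upwards [eventually_gt_atTop 0] with n hn
  have hn' : (n : ℝ) ≠ 0 := by exact_mod_cast hn.ne'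
  rw [integral_symTaylor_freqRatio hc hm hn, ← hmdef, binMoment_two, binMoment_three,
    binMoment_four, fixedCoeff]
  field_simp
  ring

/-- On `A n` the Taylor polynomial replaces `symF α`; being bounded, it can then be integrated over
all samples at a cost of `O(n⁻³)`, where its expectation is explicit. -/
theorem tendsto_symF_freqRatio (hc : MeasurableSet c) (hm : 0 < μ.real c) (α : ℝ)
    {A : ∀ n : ℕ, Set (Fin n → ℝ)} (hA : ∀ n, MeasurableSet (A n))
    (hpos : ∀ n, 0 < n → ∀ x ∈ A n, 0 < countIn c x) {K : ℝ}
    (hK : ∀ n : ℕ, 0 < n → (sampleLaw μ n).real (A n)ᶜ ≤ K / (n : ℝ) ^ 3) :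
    Tendsto (fun n : ℕ => (n : ℝ) ^ 2 * (μ.real c *
        ∫ x in A n, symF α (freqRatio μ c x) ∂sampleLaw μ n - (1 - μ.real c) / (2 * n)))
      atTop (𝓝 (fixedCoeff α (μ.real c))) := by
  obtain ⟨q, hq⟩ := exists_nat_ge (1 + |α|)
  obtain ⟨K1, hK1, h1⟩ := exists_integral_freqRatio_le hc hm 2
  obtain ⟨K2, hK2, h2⟩ := exists_integral_singular_le hc hm q
  obtain ⟨T, hT0, hT⟩ := exists_abs_symTaylor_le α (1 / μ.real c)
  have hD : Tendsto (fun n : ℕ => (n : ℝ) ^ 2 *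
      (∫ x in A n, symF α (freqRatio μ c x) ∂sampleLaw μ n
        - ∫ x in A n, symTaylor α (freqRatio μ c x) ∂sampleLaw μ n)) atTop (𝓝 0) := by
    refine tendsto_sq_mul_of_bound (K := max K1 K2)
      (a := fun n => ∫ x in A n, (freqRatio μ c x - 1) ^ 4 ∂sampleLaw μ n)
      (b := fun n => ∫ x in A n, (freqRatio μ c x - 1) ^ 6 * ((freqRatio μ c x)⁻¹) ^ q
        ∂sampleLaw μ n) ?_ ?_ ?_
    · intro ε hε
      obtain ⟨C, hC, hrem⟩ := symF_remainder α (1 / μ.real c) hq hε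
      refine ⟨C, hC, ?_⟩
      filter_upwards [eventually_gt_atTop 0] with n hn
      refine (integral_symF_sub_symTaylor (measurable_freqRatio hc) (hA n)
        freqRatio_nonneg (freqRatio_le hm) (Filter.Eventually.of_forall fun x hx => ?_)
        (integrable_comp_freqRatio hc fun y => (y - 1) ^ 6 * (y⁻¹) ^ q).integrableOn hrem).2
      have : 0 < countIn c x := hpos n hn x hx
      unfold freqRatio
      positivity
    · filter_upwards [eventually_gt_atTop 0] with n hn
      calc ∫ x in A n, (freqRatio μ c x - 1) ^ 4 ∂sampleLaw μ n
          ≤ ∫ x : Fin n → ℝ, (freqRatio μ c x - 1) ^ 4 ∂sampleLaw μ n :=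
            setIntegral_le_integral (integrable_comp_freqRatio hc fun y => (y - 1) ^ 4)
              (Filter.Eventually.of_forall fun x => by
                change 0 ≤ (freqRatio μ c x - 1) ^ 4
                positivity)
        _ ≤ K1 / (n : ℝ) ^ 2 := h1 n hn
        _ ≤ _ := by gcongr; exact le_max_left _ _
    · filter_upwards [eventually_gt_atTop 0] with n hn
      refine (h2 n (A n) hn (hA n) (hpos n hn)).trans ?_
      gcongr
      exact le_max_right _ _
  have hE : Tendsto (fun n : ℕ => (n : ℝ) ^ 2 *
      (∫ x in A n, symTaylor α (freqRatio μ c x) ∂sampleLaw μ n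
        - ∫ x, symTaylor α (freqRatio μ c x) ∂sampleLaw μ n)) atTop (𝓝 0) := by
    refine tendsto_sq_mul_of_bound (K := K) (a := fun _ => 0)
      (b := fun n => (sampleLaw μ n).real (A n)ᶜ) ?_ ?_ ?_
    · intro ε hε
      refine ⟨T, hT0, Filter.Eventually.of_forall fun n => ?_⟩
      rw [← integral_add_compl (hA n) (integrable_comp_freqRatio hc (symTaylor α)), sub_add_cancel_left,
        abs_neg, mul_zero, zero_add]
      rw [← Real.norm_eq_abs]
      refine norm_setIntegral_le_of_norm_le_const (measure_lt_top _ _) fun x _ => ?_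
      exact hT _ (freqRatio_nonneg x) (freqRatio_le hm x)
    · have : 0 ≤ K := by
        have := (measureReal_nonneg).trans (hK 1 one_pos)
        simpa using this
      filter_upwards with n
      positivity
    · filter_upwards [eventually_gt_atTop 0] with n hn using hK n hn
  have := ((hD.add hE).const_mul (μ.real c)).add (tendsto_symTaylor_freqRatio hc hm α)
  rw [add_zero, mul_zero, zero_add] at this
  refine this.congr fun n => ?_
  ring

end FixedCell

/-! ### Risk of the fixed intervals -/

section Fixed

variable {p : ℕ} {μ : Measure ℝ} [IsProbabilityMeasure μ]
  {a : Fin p → EReal}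

theorem empirical_eq {n : ℕ} (a : Fin p → EReal) (x : Fin n → ℝ) (i : Fin (p + 1)) :
    empirical a x i = (countIn (cell a i) x : ℝ) / n := by
  classical
  rw [empirical, countIn, Finset.card_filter]
  simp only [Set.indicator_apply, Pi.one_apply]

/-- The samples which leave no interval empty. -/
def nonemptySamples (a : Fin p → EReal) (n : ℕ) : Set (Fin n → ℝ) :=
  {x | ∀ i, 0 < empirical a x i}

theorem measurableSet_nonemptySamples (a : Fin p → EReal) (n : ℕ) :
    MeasurableSet (nonemptySamples a n) := by
  have : nonemptySamples a n = ⋂ i, {x | 0 < empirical a x i} := by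
    ext x; simp [nonemptySamples]
  rw [this]
  refine MeasurableSet.iInter fun i => measurableSet_lt measurable_const ?_
  simp only [empirical_eq]
  exact (measurable_from_top.comp (measurable_countIn (measurableSet_cell a i))).div_const _

theorem countIn_pos_of_mem {n : ℕ} {x : Fin n → ℝ} (hx : x ∈ nonemptySamples a n)
    (i : Fin (p + 1)) : 0 < countIn (cell a i) x := by
  have h := hx i
  rw [empirical_eq] at h
  by_contra hc
  rw [Nat.eq_zero_of_not_pos hc] at h
  simp at h

theorem exists_measureReal_compl_nonemptySamples_le (h : ∀ i, 0 < cellProb μ a i) :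
    ∃ K, 0 ≤ K ∧ ∀ n : ℕ, 0 < n →
      (sampleLaw μ n).real (nonemptySamples a n)ᶜ ≤ K / (n : ℝ) ^ 3 := by
  choose K hK hle using fun i => exists_measureReal_empty_le (measurableSet_cell a i) (h i)
  refine ⟨∑ i, K i, Finset.sum_nonneg fun i _ => hK i, fun n hn => ?_⟩
  have hn' : (0 : ℝ) < n := by exact_mod_cast hn
  have hsub : (nonemptySamples a n)ᶜ ⊆ ⋃ i, {x | countIn (cell a i) x = 0} := by
    intro x hx
    by_contra hc
    refine hx fun i => ?_
    have : countIn (cell a i) x ≠ 0 := fun e => hc (Set.mem_iUnion.2 ⟨i, e⟩)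
    rw [empirical_eq]
    positivity
  calc (sampleLaw μ n).real (nonemptySamples a n)ᶜ
      ≤ (sampleLaw μ n).real (⋃ i, {x | countIn (cell a i) x = 0}) := measureReal_mono hsub
    _ ≤ ∑ i, (sampleLaw μ n).real {x | countIn (cell a i) x = 0} := measureReal_iUnion_fintype_le _
    _ ≤ ∑ i, K i / (n : ℝ) ^ 3 := Finset.sum_le_sum fun i _ => hle i n hn
    _ = _ := by rw [Finset.sum_div]

/-- The sum of the coefficients of `n ^ (-2)` over the intervals. -/
def fixedConst (α : ℝ) (m : Fin (p + 1) → ℝ) : ℝ := ∑ i, fixedCoeff α (m i)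

theorem lintegral_symDiv_empirical {n : ℕ} {α : ℝ} (h : ∀ i, 0 < cellProb μ a i)
    {A : Set (Fin n → ℝ)} (hA : MeasurableSet A) (hpos : A ⊆ nonemptySamples a n ∨ |α| < 1) :
    ∫⁻ x in A, symDiv α (cellProb μ a) (empirical a x) ∂sampleLaw μ n ≠ ⊤ ∧
    (∫⁻ x in A, symDiv α (cellProb μ a) (empirical a x) ∂sampleLaw μ n).toReal
      = ∑ i, cellProb μ a i *
        ∫ x in A, symF α (freqRatio μ (cell a i) x) ∂sampleLaw μ n := by
  have hI : ∀ i, Integrable (fun x : Fin n → ℝ => cellProb μ a i *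
      symF α (freqRatio μ (cell a i) x)) (sampleLaw μ n) := fun i =>
    (integrable_comp_freqRatio (measurableSet_cell a i) (symF α)).const_mul _
  have hnn : ∀ x ∈ A, 0 ≤ ∑ i, cellProb μ a i * symF α (freqRatio μ (cell a i) x) := by
    intro x hx
    refine Finset.sum_nonneg fun i _ => mul_nonneg (h i).le
      (symF_nonneg_of (freqRatio_nonneg x) (hpos.imp_left fun hp => ?_))
    have := hp hx i
    rw [empirical_eq] at this
    exact div_pos this (h i)
  have e : ∫⁻ x in A, symDiv α (cellProb μ a) (empirical a x) ∂sampleLaw μ n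
      = ENNReal.ofReal (∫ x in A, ∑ i, cellProb μ a i * symF α (freqRatio μ (cell a i) x)
        ∂sampleLaw μ n) := by
    rw [ofReal_integral_eq_lintegral_ofReal (integrable_finsetSum _ fun i _ => (hI i).integrableOn)
      ((ae_restrict_iff' hA).2 (Filter.Eventually.of_forall hnn))]
    refine setLIntegral_congr_fun hA fun x hx => ?_
    rw [symDiv_eq h (fun i => by rw [empirical_eq]; positivity) (hpos.imp_left fun hp => hp hx)]
    simp only [empirical_eq]
    rfl
  rw [e]
  refine ⟨ENNReal.ofReal_ne_top, ?_⟩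
  rw [ENNReal.toReal_ofReal (setIntegral_nonneg hA hnn),
    integral_finsetSum _ fun i _ => (hI i).integrableOn]
  refine Finset.sum_congr rfl fun i _ => ?_
  rw [integral_const_mul]

theorem tendsto_sum_symF_freqRatio [NullSingletonClass μ] (h : ∀ i, 0 < cellProb μ a i) (α : ℝ) :
    Tendsto (fun n : ℕ => (n : ℝ) ^ 2 * (∑ i, cellProb μ a i *
        ∫ x in nonemptySamples a n, symF α (freqRatio μ (cell a i) x) ∂sampleLaw μ n
          - p / (2 * n))) atTop (𝓝 (fixedConst α (cellProb μ a))) := by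
  obtain ⟨K, hK, hle⟩ := exists_measureReal_compl_nonemptySamples_le h
  have := tendsto_finsetSum Finset.univ fun i _ =>
    tendsto_symF_freqRatio (μ := μ) (measurableSet_cell a i) (h i) α
      (measurableSet_nonemptySamples a) (fun n _ x hx => countIn_pos_of_mem hx i) hle
  refine this.congr fun n => ?_
  rw [← Finset.mul_sum, Finset.sum_sub_distrib, ← Finset.sum_div, Finset.sum_sub_distrib]
  have e : ∑ i, μ.real (cell a i) = 1 := sum_cellProb a h
  rw [e]
  simp [cellProb]

theorem secondOrderExpansion_fixedNonempty [NullSingletonClass μ] (a : Fin p → ℝ)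
    (h : ∀ i, 0 < cellProb μ (fun j => (a j : EReal)) i) (α : ℝ) :
    SecondOrderExpansion p (riskFixedNonempty μ a α)
      fun _ => fixedConst α (cellProb μ fun j => (a j : EReal)) := by
  refine secondOrderExpansion_of_tendsto (Filter.Eventually.of_forall fun n =>
    lintegral_symDiv_empirical h (measurableSet_nonemptySamples _ n) (Or.inl subset_rfl)) ?_
  have := (tendsto_sum_symF_freqRatio h α).sub_const
    (fixedConst α (cellProb μ fun j => (a j : EReal)))
  rw [sub_self] at this
  exact this

/-- For `|α| < 1` the divergence stays bounded at empty cells, and those samples have probability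
`O(n⁻³)`. -/
theorem secondOrderExpansion_fixed [NullSingletonClass μ] (a : Fin p → ℝ)
    (h : ∀ i, 0 < cellProb μ (fun j => (a j : EReal)) i) {α : ℝ} (hα : |α| < 1) :
    SecondOrderExpansion p (riskFixed μ a α)
      fun _ => fixedConst α (cellProb μ fun j => (a j : EReal)) := by
  set b : Fin p → EReal := fun j => (a j : EReal)
  refine secondOrderExpansion_of_tendsto (W := fun n => ∑ i, cellProb μ b i *
    ∫ x : Fin n → ℝ, symF α (freqRatio μ (cell b i) x) ∂sampleLaw μ n)
    (Filter.Eventually.of_forall fun n => ?_) ?_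
  · have := lintegral_symDiv_empirical (n := n) h MeasurableSet.univ (Or.inr hα)
    simp only [setLIntegral_univ, setIntegral_univ] at this
    exact this
  obtain ⟨K, hK, hle⟩ := exists_measureReal_compl_nonemptySamples_le h
  have hE : ∀ i, Tendsto (fun n : ℕ => (n : ℝ) ^ 2 *
      (∫ x, symF α (freqRatio μ (cell b i) x) ∂sampleLaw μ n
        - ∫ x in nonemptySamples b n, symF α (freqRatio μ (cell b i) x) ∂sampleLaw μ n))
      atTop (𝓝 0) := by
    intro i
    obtain ⟨T, hT0, hT⟩ := exists_symF_le hα (1 / cellProb μ b i)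
    refine tendsto_sq_mul_of_bound (K := K) (a := fun _ => 0)
      (b := fun n => (sampleLaw μ n).real (nonemptySamples b n)ᶜ) ?_ ?_ ?_
    · intro ε hε
      refine ⟨T, hT0, Filter.Eventually.of_forall fun n => ?_⟩
      rw [← integral_add_compl (measurableSet_nonemptySamples b n)
        (integrable_comp_freqRatio (measurableSet_cell b i) (symF α)), add_sub_cancel_left,
        mul_zero, zero_add]
      rw [← Real.norm_eq_abs]
      refine norm_setIntegral_le_of_norm_le_const (measure_lt_top _ _) fun x _ => ?_
      exact hT _ (freqRatio_nonneg x) (freqRatio_le (h i) x)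
    · filter_upwards with n
      positivity
    · filter_upwards [eventually_gt_atTop 0] with n hn using hle n hn
  have h2 := (tendsto_finsetSum Finset.univ fun i _ => (hE i).const_mul (cellProb μ b i)).add
    (tendsto_sum_symF_freqRatio h α)
  simp only [mul_zero, Finset.sum_const_zero, zero_add] at h2
  have h3 := h2.sub_const (fixedConst α (cellProb μ b))
  rw [sub_self] at h3
  refine h3.congr fun n => congrArg (· - _) ?_
  rw [mul_sub, mul_sub, ← add_sub_assoc, Finset.mul_sum, Finset.mul_sum, ← Finset.sum_add_distrib]
  congr 1
  refine Finset.sum_congr rfl fun i _ => ?_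
  ring

/-- Among the fixed intervals, those of equal probabilities have the smallest coefficient. -/
theorem fixedConst_ge (α : ℝ) {m : Fin (p + 1) → ℝ} (hm : ∀ i, 0 < m i) (hs : ∑ i, m i = 1) :
    p * ((α ^ 2 + 7) * p + 8) / 32 ≤ fixedConst α m := by
  -- The convex part `1 / m` is replaced by its tangent at `1 / (p + 1)`; the sum then depends only
  -- on `∑ m i = 1`.
  have h1 : ∀ i, (α ^ 2 + 7) / 32 * (2 * (p + 1) - (p + 1) ^ 2 * m i) + (3 / 4 - (α ^ 2 + 15) / 16)
      + ((α ^ 2 + 15) / 32 - 1 / 2) * m i ≤ fixedCoeff α (m i) := by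
    intro i
    have hi := hm i
    have e : fixedCoeff α (m i) = (α ^ 2 + 7) / 32 * (1 / m i) + (3 / 4 - (α ^ 2 + 15) / 16)
      + ((α ^ 2 + 15) / 32 - 1 / 2) * m i := by
      rw [fixedCoeff]; field_simp; ring
    rw [e]
    gcongr
    rw [le_div_iff₀ hi]
    nlinarith [sq_nonneg ((p + 1 : ℝ) * m i - 1)]
  refine le_trans (le_of_eq ?_) (Finset.sum_le_sum fun i _ => h1 i)
  rw [Finset.sum_add_distrib, Finset.sum_add_distrib, ← Finset.mul_sum, Finset.sum_sub_distrib]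
  simp only [Finset.sum_const, Finset.card_univ, Fintype.card_fin, nsmul_eq_mul]
  rw [← Finset.mul_sum, ← Finset.mul_sum, hs]
  push_cast
  ring

end Fixed

/-- The coefficient of `n ^ (-2)` in the expected divergence contributed by a spacing of nominal
probability `m` and rank difference `n * m + d`. -/
def movingCoeff (α m d : ℝ) : ℝ :=
  (-2 * (m * (1 - m)) + (d - m) * (1 - 2 * m) + (d - m) ^ 2) / (2 * m)
    - (2 * (m * (1 - m)) * (1 - 2 * m) + 3 * (m * (1 - m)) * (d - m)) / (4 * m ^ 2)
    + (α ^ 2 + 15) / 32 * ((1 - m) ^ 2 / m)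

theorem continuous_movingCoeff (α m : ℝ) : Continuous (movingCoeff α m) := by
  unfold movingCoeff; fun_prop

/-- For a limit that depends on a bounded parameter it is enough to treat convergent parameters. -/
theorem tendsto_of_bounded_parameter {δ : ℕ → ℝ} {B : ℝ} (hδ : ∀ n, |δ n| ≤ B) {G : ℕ → ℝ}
    {D : ℝ → ℝ} (hD : Continuous D)
    (h : ∀ (l : Filter ℕ) (d : ℝ), l ≤ atTop → Tendsto δ l (𝓝 d) → Tendsto G l (𝓝 (D d))) :
    Tendsto (fun n => G n - D (δ n)) atTop (𝓝 0) := by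
  rw [tendsto_iff_ultrafilter]
  intro g hg
  have hK : (g.map δ : Filter ℝ) ≤ 𝓟 (Set.Icc (-B) B) := by
    rw [le_principal_iff]
    exact Filter.mem_map.2 (Filter.univ_mem' fun n => abs_le.1 (hδ n))
  -- Along an ultrafilter the bounded parameter converges, so oscillation is no obstacle.
  obtain ⟨d, _, hd⟩ := isCompact_Icc.ultrafilter_le_nhds (g.map δ) hK
  have hd' : Tendsto δ g (𝓝 d) := hd
  have := (h g d hg hd').sub ((hD.tendsto d).comp hd')
  rw [sub_self] at this
  exact this

/-! ### Limits of the beta moments -/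

section Limits

variable {l : Filter ℕ} {m d : ℝ} {δ : ℕ → ℝ} {c : ℕ → ℕ → ℝ}

theorem tendsto_nat_div_add (hl : l ≤ atTop) (a : ℝ) :
    Tendsto (fun n : ℕ => (n : ℝ) / (n + a)) l (𝓝 1) :=
  (tendsto_natCast_div_add_atTop a).mono_left hl

/-- The bracket is the expected Taylor polynomial re-centred from the mean to `m`, with bias `η`.
Three steps of the recursion make the moments explicit, and `n * η n` tends to `d - m`. A general
filter is needed because the rounding errors `δ` need not converge along `atTop`. -/
theorem tendsto_betaMoments (hm : 0 < m) (α : ℝ) (hl : l ≤ atTop) (hδ : Tendsto δ l (𝓝 d))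
    (hc : ∀ᶠ n : ℕ in l, BetaRecursion ((n : ℝ) + 1) ((n * m + δ n) / (n + 1)) (c n)) {η : ℕ → ℝ}
    (hη : ∀ n : ℕ, η n = (n * m + δ n) / (n + 1) - m) :
    Tendsto (fun n : ℕ => (n : ℝ) ^ 2 * (m * (
        (c n 2 + η n ^ 2) / m ^ 2 / 2 - (c n 3 + 3 * η n * c n 2 + η n ^ 3) / m ^ 3 / 4
        + (α ^ 2 + 15) / 96 * ((c n 4 + 4 * η n * c n 3 + 6 * η n ^ 2 * c n 2 + η n ^ 4) / m ^ 4))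
        - (1 - m) / (2 * n))) l (𝓝 (movingCoeff α m d)) := by
  have hinv : Tendsto (fun n : ℕ => (n : ℝ)⁻¹) l (𝓝 0) :=
    (tendsto_inv_atTop_nhds_zero_nat (𝕜 := ℝ)).mono_left hl
  have h1 := tendsto_nat_div_add hl 1
  have h2 := tendsto_nat_div_add hl 2
  have h3 := tendsto_nat_div_add hl 3
  have h4 := tendsto_nat_div_add hl 4
  have hη1 : ∀ n : ℕ, η n = (δ n - m) / (n + 1) := fun n => by
    have : (n : ℝ) + 1 ≠ 0 := by positivity
    rw [hη]; field_simp; ring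
  have hnη : Tendsto (fun n : ℕ => (n : ℝ) * η n) l (𝓝 (d - m)) := by
    have := h1.mul (hδ.sub_const m)
    rw [one_mul] at this
    refine this.congr fun n => ?_
    rw [hη1]; ring
  have hpos : ∀ᶠ n : ℕ in l, (n : ℝ) ≠ 0 :=
    hl ((eventually_gt_atTop 0).mono fun n hn => by exact_mod_cast (ne_of_gt hn))
  have hη0 : Tendsto η l (𝓝 0) := by
    have := hinv.mul hnη
    rw [zero_mul] at this
    refine this.congr' (hpos.mono fun n hn => ?_)
    field_simp
  have c2 : ∀ᶠ n in l, c n 2 = (m + η n) * (1 - (m + η n)) / (n + 2) := by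
    filter_upwards [hc] with n hc
    have e := hc.succ 0
    rw [hc.zero, hc.one] at e
    have hu : ((n : ℝ) * m + δ n) / (n + 1) = m + η n := by rw [hη]; ring
    rw [hu] at e
    have : (n : ℝ) + 2 ≠ 0 := by positivity
    rw [eq_div_iff this]
    push_cast at e
    linear_combination e
  have c3 : ∀ᶠ n in l, c n 3 = 2 * (1 - 2 * (m + η n)) * c n 2 / (n + 3) := by
    filter_upwards [hc] with n hc
    have e := hc.succ 1
    rw [hc.one] at e
    have hu : ((n : ℝ) * m + δ n) / (n + 1) = m + η n := by rw [hη]; ring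
    rw [hu] at e
    have : (n : ℝ) + 3 ≠ 0 := by positivity
    rw [eq_div_iff this]
    push_cast at e
    linear_combination e
  have c4 : ∀ᶠ n in l, c n 4 = 3 * ((m + η n) * (1 - (m + η n)) * c n 2
      + (1 - 2 * (m + η n)) * c n 3) / (n + 4) := by
    filter_upwards [hc] with n hc
    have e := hc.succ 2
    have hu : ((n : ℝ) * m + δ n) / (n + 1) = m + η n := by rw [hη]; ring
    rw [hu] at e
    have : (n : ℝ) + 4 ≠ 0 := by positivity
    rw [eq_div_iff this]
    push_cast at e
    linear_combination e
  have hu : Tendsto (fun n => m + η n) l (𝓝 m) := by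
    simpa using hη0.const_add m
  have hv : Tendsto (fun n => (m + η n) * (1 - (m + η n))) l (𝓝 (m * (1 - m))) :=
    hu.mul (hu.const_sub 1)
  have hw : Tendsto (fun n => 1 - 2 * (m + η n)) l (𝓝 (1 - 2 * m)) :=
    (hu.const_mul 2).const_sub 1
  have l2 : Tendsto (fun n : ℕ => (n : ℝ) * c n 2) l (𝓝 (m * (1 - m))) := by
    have := h2.mul hv
    rw [one_mul] at this
    refine this.congr' (c2.mono fun n c2 => ?_)
    beta_reduce
    rw [c2]; ring
  -- The leading term of the variance cancels against `(1 - m) / (2 * n)`, so here the next order is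
  -- required.
  have l2' : Tendsto (fun n : ℕ => (n : ℝ) ^ 2 * c n 2 - n * (m * (1 - m))) l
      (𝓝 (-2 * (m * (1 - m)) + (d - m) * (1 - 2 * m))) := by
    have := (((h2.const_mul (-2)).mul_const (m * (1 - m))).add
      (h2.mul (hnη.mul_const (1 - 2 * m)))).sub (h2.mul (hnη.mul hη0))
    simp only [mul_one, one_mul, mul_zero, sub_zero] at this
    refine this.congr' (c2.mono fun n c2 => ?_)
    have : (n : ℝ) + 2 ≠ 0 := by positivity
    beta_reduce
    rw [c2]
    field_simp
    ring
  have l3 : Tendsto (fun n : ℕ => (n : ℝ) ^ 2 * c n 3) l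
      (𝓝 (2 * (1 - 2 * m) * (m * (1 - m)))) := by
    have := h3.mul ((hw.const_mul 2).mul l2)
    rw [one_mul] at this
    refine this.congr' (c3.mono fun n c3 => ?_)
    beta_reduce
    rw [c3]; ring
  have l3' : Tendsto (fun n : ℕ => (n : ℝ) * c n 3) l (𝓝 0) := by
    have := hinv.mul l3
    rw [zero_mul] at this
    refine this.congr' (hpos.mono fun n hn => ?_)
    field_simp
  have l4 : Tendsto (fun n : ℕ => (n : ℝ) ^ 2 * c n 4) l (𝓝 (3 * (m * (1 - m) * (m * (1 - m))))) := by
    have := h4.mul (((hv.mul l2).add (hw.mul l3')).const_mul 3)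
    rw [one_mul, mul_zero, add_zero] at this
    refine this.congr' (c4.mono fun n c4 => ?_)
    beta_reduce
    rw [c4]; ring
  have lη2 := hnη.mul hnη
  have M2 := (l2'.add lη2).div_const (2 * m)
  have M3 := ((l3.add ((hnη.mul l2).const_mul 3)).add (lη2.mul hη0)).div_const (4 * m ^ 2)
  have M4 := ((((l4.add ((hη0.mul l3).const_mul 4)).add
    (((hη0.mul hnη).mul l2).const_mul 6)).add ((lη2.mul hη0).mul hη0)).const_mul
      ((α ^ 2 + 15) / 96)).div_const (m ^ 3)
  have := (M2.sub M3).add M4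
  refine (this.congr' (hpos.mono fun n hn => ?_)).trans (le_of_eq ?_)
  · field_simp
    ring
  · congr 1
    rw [movingCoeff]
    field_simp
    ring

end Limits

/-! ### Moment bounds for spacings of rank difference near `n * m` -/

section SpacingSequence

variable {n : ℕ} {μ : Measure ℝ} [IsProbabilityMeasure μ]

theorem spacing_le_one (x : Fin n → ℝ) (j k : ℕ) : spacing μ x j k ≤ 1 := prob_le_one

theorem toReal_spacing_mem (x : Fin n → ℝ) (j k : ℕ) :
    (spacing μ x j k).toReal ∈ Set.Icc (0 : ℝ) 1 :=
  ⟨ENNReal.toReal_nonneg, ENNReal.toReal_le_of_le_ofReal zero_le_one (by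
    simpa using spacing_le_one x j k)⟩

theorem measurable_toReal_spacing (j k : ℕ) :
    Measurable fun x : Fin n → ℝ => (spacing μ x j k).toReal :=
  (measurable_spacing μ j k).ennreal_toReal

variable [NullSingletonClass μ]

theorem integral_spacing_pow {j k : ℕ} (hk : k ≤ n + 1) (r : ℕ) :
    ∫ x : Fin n → ℝ, (spacing μ x j k).toReal ^ r ∂sampleLaw μ n
      = ∏ i ∈ Finset.range r, (((k - j : ℕ) : ℝ) + i) / ((n : ℝ) + 1 + i) := by
  rw [integral_eq_lintegral_of_nonneg_ae
    (Filter.Eventually.of_forall fun x => pow_nonneg ENNReal.toReal_nonneg r)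
    ((measurable_toReal_spacing j k).pow_const r).aestronglyMeasurable]
  have e : ∀ x : Fin n → ℝ, ENNReal.ofReal ((spacing μ x j k).toReal ^ r) = spacing μ x j k ^ r := by
    intro x
    rw [← ENNReal.toReal_pow, ENNReal.ofReal_toReal]
    exact ENNReal.pow_ne_top ((spacing_le_one x j k).trans_lt ENNReal.one_lt_top).ne
  simp only [e]
  rw [lintegral_spacing_pow r hk, ENNReal.toReal_ofReal]
  exact Finset.prod_nonneg fun i _ => by positivity

theorem ofReal_inv_toReal_pow_le (s : ℝ≥0∞) (q : ℕ) :
    ENNReal.ofReal ((s.toReal)⁻¹ ^ q) ≤ s⁻¹ ^ q := by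
  rw [ENNReal.ofReal_pow (by positivity)]
  gcongr
  rcases eq_or_ne s 0 with rfl | h0
  · simp
  rcases eq_or_ne s ⊤ with rfl | h1
  · simp
  rw [ENNReal.ofReal_inv_of_pos (ENNReal.toReal_pos h0 h1), ENNReal.ofReal_toReal h1]

theorem integral_inv_spacing_pow_le {j k q : ℕ} (hk : k ≤ n + 1) (hjk : j + q < k) :
    Integrable (fun x : Fin n → ℝ => ((spacing μ x j k).toReal)⁻¹ ^ q) (sampleLaw μ n) ∧
    ∫ x : Fin n → ℝ, ((spacing μ x j k).toReal)⁻¹ ^ q ∂sampleLaw μ n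
      ≤ ((n : ℝ) / ((k - j - q : ℕ) : ℝ)) ^ q := by
  have hmeas : AEStronglyMeasurable (fun x : Fin n → ℝ => ((spacing μ x j k).toReal)⁻¹ ^ q)
      (sampleLaw μ n) :=
    ((measurable_toReal_spacing j k).inv.pow_const q).aestronglyMeasurable
  have hle : ∫⁻ x : Fin n → ℝ, ENNReal.ofReal (((spacing μ x j k).toReal)⁻¹ ^ q) ∂sampleLaw μ n
      ≤ ENNReal.ofReal (((n : ℝ) / ((k - j - q : ℕ) : ℝ)) ^ q) := by
    rw [ENNReal.ofReal_pow (by positivity)]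
    exact (lintegral_mono fun x => ofReal_inv_toReal_pow_le _ q).trans
      (lintegral_inv_spacing_pow_le q hk hjk)
  have hnn : ∀ x : Fin n → ℝ, 0 ≤ ((spacing μ x j k).toReal)⁻¹ ^ q := fun x => by positivity
  constructor
  · refine ⟨hmeas, ?_⟩
    rw [hasFiniteIntegral_iff_ofReal (Filter.Eventually.of_forall hnn)]
    exact hle.trans_lt ENNReal.ofReal_lt_top
  · rw [integral_eq_lintegral_of_nonneg_ae (Filter.Eventually.of_forall hnn) hmeas]
    exact ENNReal.toReal_le_of_le_ofReal (by positivity) hle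

/-- The first inverse moment is finite. -/
theorem ae_spacing_pos {j k : ℕ} (hk : k ≤ n + 1) (hjk : j + 1 < k) :
    ∀ᵐ x ∂sampleLaw μ n, 0 < (spacing μ x j k).toReal := by
  have h := lintegral_inv_spacing_pow_le (μ := μ) 1 hk hjk
  have h2 : ∀ᵐ x ∂sampleLaw μ n, (spacing μ x j k)⁻¹ ^ 1 < ⊤ := by
    refine ae_lt_top ((measurable_spacing μ j k).inv.pow_const 1) (ne_of_lt (h.trans_lt ?_))
    exact ENNReal.pow_lt_top ENNReal.ofReal_lt_top
  filter_upwards [h2] with x hx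
  rw [pow_one, ENNReal.inv_lt_top] at hx
  exact ENNReal.toReal_pos hx.ne' ((spacing_le_one x j k).trans_lt ENNReal.one_lt_top).ne

theorem betaRecursion_spacing {j k : ℕ} (hk : k ≤ n + 1) :
    BetaRecursion ((n : ℝ) + 1) (((k - j : ℕ) : ℝ) / (n + 1)) fun r =>
      ∫ x : Fin n → ℝ, ((spacing μ x j k).toReal - ((k - j : ℕ) : ℝ) / (n + 1)) ^ r ∂sampleLaw μ n :=
  betaRecursion_of_moments (measurable_toReal_spacing j k) (fun x => toReal_spacing_mem x j k)
    (by positivity) (integral_spacing_pow hk)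

/-- Moments of the normalized spacing about `1`. -/
theorem exists_integral_spacing_le {m : ℝ} (hm : 0 < m) (hm1 : m ≤ 1) (r : ℕ) :
    ∃ K, 0 ≤ K ∧ ∀ (n j k : ℕ), 0 < n → k ≤ n + 1 → |((k - j : ℕ) : ℝ) - n * m| ≤ 2 →
      ∫ x : Fin n → ℝ, ((spacing μ x j k).toReal / m - 1) ^ (2 * r) ∂sampleLaw μ n
        ≤ K / (n : ℝ) ^ r := by
  obtain ⟨C, hC, hb⟩ := BetaRecursion.bound r
  refine ⟨2 ^ (2 * r - 1) * (C + 3 ^ (2 * r)) / m ^ (2 * r), by positivity,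
    fun n j k hn hk hd => ?_⟩
  have hn' : (0 : ℝ) < n := by exact_mod_cast hn
  have hn1 : (1 : ℝ) ≤ n := by exact_mod_cast hn
  set u : ℝ := ((k - j : ℕ) : ℝ) / (n + 1) with hu
  have hs : ((k - j : ℕ) : ℝ) ≤ n + 1 := by exact_mod_cast (Nat.sub_le k j).trans hk
  have hu0 : 0 ≤ u := by positivity
  have hu1 : u ≤ 1 := (div_le_one (by positivity)).2 hs
  have hcb := (hb _ _ _ (betaRecursion_spacing (μ := μ) (j := j) hk) (by linarith) hu0 hu1).1
  -- Rounding contributes at most `2` and the denominator `n + 1` at most `m ≤ 1`.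
  have hη : |u - m| ≤ 3 / n := by
    have e : u - m = (((k - j : ℕ) : ℝ) - n * m - m) / (n + 1) := by rw [hu]; field_simp; ring
    rw [e, abs_div, abs_of_pos (by positivity : (0 : ℝ) < n + 1)]
    have : |((k - j : ℕ) : ℝ) - n * m - m| ≤ 3 := by
      refine (abs_sub _ _).trans ?_
      rw [abs_of_pos hm]
      linarith
    gcongr
    linarith
  have hη2 : (u - m) ^ (2 * r) ≤ 3 ^ (2 * r) / (n : ℝ) ^ r := by
    calc (u - m) ^ (2 * r) = |u - m| ^ (2 * r) := ((even_two_mul r).pow_abs _).symm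
      _ ≤ (3 / n) ^ (2 * r) := by gcongr
      _ = 3 ^ (2 * r) / (n : ℝ) ^ (2 * r) := div_pow _ _ _
      _ ≤ 3 ^ (2 * r) / (n : ℝ) ^ r := by
        refine div_le_div_of_nonneg_left (by positivity) (by positivity)
          (pow_le_pow_right₀ hn1 (by omega))
  have hI : ∀ g : ℝ → ℝ, Continuous g →
      Integrable (fun x : Fin n → ℝ => g (spacing μ x j k).toReal) (sampleLaw μ n) :=
    fun g hg => integrable_comp_of_unit (measurable_toReal_spacing j k)
      (fun x => toReal_spacing_mem x j k) hg
  have i1 := hI (fun y => (y - u) ^ (2 * r)) (by fun_prop)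
  calc ∫ x : Fin n → ℝ, ((spacing μ x j k).toReal / m - 1) ^ (2 * r) ∂sampleLaw μ n
      ≤ ∫ x : Fin n → ℝ, 2 ^ (2 * r - 1) / m ^ (2 * r) *
          (((spacing μ x j k).toReal - u) ^ (2 * r) + (u - m) ^ (2 * r)) ∂sampleLaw μ n := by
        refine integral_mono (hI (fun y => (y / m - 1) ^ (2 * r)) (by fun_prop))
          ((i1.add (integrable_const _)).const_mul _) fun x => ?_
        have e : (spacing μ x j k).toReal / m - 1
            = (((spacing μ x j k).toReal - u) + (u - m)) / m := by field_simp; ring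
        change ((spacing μ x j k).toReal / m - 1) ^ (2 * r) ≤ _
        rw [e, div_pow, div_mul_eq_mul_div]
        gcongr
        exact (even_two_mul r).add_pow_le
    _ = 2 ^ (2 * r - 1) / m ^ (2 * r) *
        (∫ x : Fin n → ℝ, ((spacing μ x j k).toReal - u) ^ (2 * r) ∂sampleLaw μ n
          + (u - m) ^ (2 * r)) := by
        rw [integral_const_mul, integral_add i1 (integrable_const _)]
        simp
    _ ≤ 2 ^ (2 * r - 1) / m ^ (2 * r) * (C / (n : ℝ) ^ r + 3 ^ (2 * r) / (n : ℝ) ^ r) := by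
        have h1 : C / ((n : ℝ) + 1) ^ r ≤ C / (n : ℝ) ^ r := by gcongr; linarith
        have := (le_abs_self _).trans (hcb.trans h1)
        gcongr
    _ = _ := by field_simp

theorem rank_diff_large {m : ℝ} (hm : 0 < m) (q : ℕ) :
    ∀ᶠ n : ℕ in atTop, ∀ s : ℕ, |(s : ℝ) - n * m| ≤ 2 →
      q < s ∧ (n : ℝ) * m / 2 ≤ ((s - q : ℕ) : ℝ) := by
  have h : Tendsto (fun n : ℕ => (n : ℝ) * m / 2) atTop atTop :=
    (tendsto_natCast_atTop_atTop.atTop_mul_const hm).atTop_div_const two_pos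
  filter_upwards [h.eventually_gt_atTop ((q : ℝ) + 2)] with n hn s hs
  have h1 := (abs_le.1 hs).1
  have h2 : (q : ℝ) < s := by linarith
  have h3 : q < s := by exact_mod_cast h2
  refine ⟨h3, ?_⟩
  rw [Nat.cast_sub h3.le]
  linarith

/-- With `a` the sixth power and `b` the inverse weight, `a * b ≤ n^3 * a^2 / 2 + b^2 / (2 * n^3)`:
the twelfth moment is `O(n⁻⁶)`, while inverse moments of order `2 * q` stay bounded. -/
theorem exists_integral_singular_spacing_le {m : ℝ} (hm : 0 < m) (hm1 : m ≤ 1) (q : ℕ) :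
    ∃ K, 0 ≤ K ∧ ∀ᶠ n : ℕ in atTop, ∀ j k : ℕ, k ≤ n + 1 → |((k - j : ℕ) : ℝ) - n * m| ≤ 2 →
      Integrable (fun x : Fin n → ℝ => ((spacing μ x j k).toReal / m - 1) ^ 6
        * (((spacing μ x j k).toReal / m)⁻¹) ^ q) (sampleLaw μ n) ∧
      ∫ x : Fin n → ℝ, ((spacing μ x j k).toReal / m - 1) ^ 6
        * (((spacing μ x j k).toReal / m)⁻¹) ^ q ∂sampleLaw μ n ≤ K / (n : ℝ) ^ 3 := by
  obtain ⟨K, hK, h⟩ := exists_integral_spacing_le (μ := μ) hm hm1 6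
  refine ⟨(2 ^ (2 * q) + K) / 2, by positivity, ?_⟩
  filter_upwards [rank_diff_large hm (2 * q), eventually_gt_atTop 0] with n hlarge hn j k hk hd
  have hn' : (0 : ℝ) < n := by exact_mod_cast hn
  obtain ⟨hq, hq2⟩ := hlarge _ hd
  obtain ⟨i1, b1⟩ := integral_inv_spacing_pow_le (μ := μ) (n := n) (j := j) (k := k) (q := 2 * q) hk
    (by omega)
  have i2 : Integrable (fun x : Fin n → ℝ => ((spacing μ x j k).toReal / m - 1) ^ (2 * 6))
      (sampleLaw μ n) := integrable_comp_of_unit (measurable_toReal_spacing j k)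
      (fun x => toReal_spacing_mem x j k) (g := fun y => (y / m - 1) ^ (2 * 6)) (by fun_prop)
  have b2 := h n j k hn hk hd
  have hB : Integrable (fun x : Fin n → ℝ => (m ^ (2 * q) / (n : ℝ) ^ 3 / 2) *
      ((spacing μ x j k).toReal)⁻¹ ^ (2 * q) + (n : ℝ) ^ 3 / 2 *
        ((spacing μ x j k).toReal / m - 1) ^ (2 * 6)) (sampleLaw μ n) :=
    (i1.const_mul _).add (i2.const_mul _)
  have hpt : ∀ x : Fin n → ℝ, ((spacing μ x j k).toReal / m - 1) ^ 6
        * (((spacing μ x j k).toReal / m)⁻¹) ^ q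
      ≤ (m ^ (2 * q) / (n : ℝ) ^ 3 / 2) * ((spacing μ x j k).toReal)⁻¹ ^ (2 * q)
        + (n : ℝ) ^ 3 / 2 * ((spacing μ x j k).toReal / m - 1) ^ (2 * 6) := by
    intro x
    have e : m ^ (2 * q) * ((spacing μ x j k).toReal)⁻¹ ^ (2 * q)
        = ((((spacing μ x j k).toReal / m)⁻¹) ^ q) ^ 2 := by
      rw [inv_div, div_eq_mul_inv, mul_pow, mul_pow, ← pow_mul, ← pow_mul, mul_comm q 2]
    set a := ((spacing μ x j k).toReal / m - 1) ^ 6 with ha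
    set b := (((spacing μ x j k).toReal / m)⁻¹) ^ q with hb
    have e2 : ((spacing μ x j k).toReal / m - 1) ^ (2 * 6) = a ^ 2 := by rw [ha]; ring
    rw [e2, div_div, div_mul_eq_mul_div, e]
    have := two_mul_le_add_sq ((n : ℝ) ^ 3 * a) b
    rw [← sub_nonneg]
    have e3 : b ^ 2 / ((n : ℝ) ^ 3 * 2) + (n : ℝ) ^ 3 / 2 * a ^ 2 - a * b
        = (((n : ℝ) ^ 3 * a) ^ 2 + b ^ 2 - 2 * ((n : ℝ) ^ 3 * a) * b) / ((n : ℝ) ^ 3 * 2) := by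
      field_simp
      ring
    rw [e3]
    refine div_nonneg ?_ (by positivity)
    linarith
  have hnn : ∀ x : Fin n → ℝ, 0 ≤ ((spacing μ x j k).toReal / m - 1) ^ 6
        * (((spacing μ x j k).toReal / m)⁻¹) ^ q := fun x => by
    have : 0 ≤ (spacing μ x j k).toReal := ENNReal.toReal_nonneg
    positivity
  have hmeas : AEStronglyMeasurable (fun x : Fin n → ℝ => ((spacing μ x j k).toReal / m - 1) ^ 6
        * (((spacing μ x j k).toReal / m)⁻¹) ^ q) (sampleLaw μ n) := by
    have := measurable_toReal_spacing (n := n) (μ := μ) j k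
    exact ((((this.div_const m).sub_const 1).pow_const 6).mul
      ((this.div_const m).inv.pow_const q)).aestronglyMeasurable
  have hint := hB.mono' hmeas (Filter.Eventually.of_forall fun x => by
    rw [Real.norm_of_nonneg (hnn x)]; exact hpt x)
  refine ⟨hint, (integral_mono hint hB hpt).trans ?_⟩
  rw [integral_add (i1.const_mul _) (i2.const_mul _), integral_const_mul, integral_const_mul]
  have b3 : ∫ x : Fin n → ℝ, ((spacing μ x j k).toReal)⁻¹ ^ (2 * q) ∂sampleLaw μ n
      ≤ (2 / m) ^ (2 * q) := by
    refine b1.trans ?_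
    have h0 : 0 < (n : ℝ) * m / 2 := by positivity
    have : (n : ℝ) / ((k - j - 2 * q : ℕ) : ℝ) ≤ 2 / m := by
      rw [div_le_div_iff₀ (h0.trans_le hq2) hm]
      linarith
    gcongr
  calc _ ≤ m ^ (2 * q) / (n : ℝ) ^ 3 / 2 * (2 / m) ^ (2 * q) + (n : ℝ) ^ 3 / 2 * (K / (n : ℝ) ^ 6) := by
        gcongr
    _ = _ := by rw [div_pow]; field_simp

end SpacingSequence

/-! ### Expansion for one spacing -/

section SpacingExpansion

theorem integral_quartic {Ω : Type*} [MeasurableSpace Ω] {P : Measure Ω} [IsProbabilityMeasure P]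
    {X : Ω → ℝ} (hX : Measurable X) (h01 : ∀ ω, X ω ∈ Set.Icc (0 : ℝ) 1) (u a₀ a₁ a₂ a₃ a₄ : ℝ) :
    ∫ ω, (a₀ + (a₁ * (X ω - u) ^ 1 + (a₂ * (X ω - u) ^ 2
        + (a₃ * (X ω - u) ^ 3 + a₄ * (X ω - u) ^ 4)))) ∂P
      = a₀ + (a₁ * ∫ ω, (X ω - u) ^ 1 ∂P + (a₂ * ∫ ω, (X ω - u) ^ 2 ∂P
        + (a₃ * ∫ ω, (X ω - u) ^ 3 ∂P + a₄ * ∫ ω, (X ω - u) ^ 4 ∂P))) := by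
  have hI : ∀ g : ℝ → ℝ, Continuous g → Integrable (fun ω => g (X ω)) P :=
    fun g hg => integrable_comp_of_unit hX h01 hg
  have i : ∀ (a : ℝ) (r : ℕ), Integrable (fun ω => a * (X ω - u) ^ r) P := fun a r =>
    hI (fun y => a * (y - u) ^ r) (by fun_prop)
  rw [integral_add (integrable_const _) (hI (fun y => a₁ * (y - u) ^ 1 + (a₂ * (y - u) ^ 2
      + (a₃ * (y - u) ^ 3 + a₄ * (y - u) ^ 4))) (by fun_prop)),
    integral_add (i a₁ 1) (hI (fun y => a₂ * (y - u) ^ 2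
      + (a₃ * (y - u) ^ 3 + a₄ * (y - u) ^ 4)) (by fun_prop)),
    integral_add (i a₂ 2) (hI (fun y => a₃ * (y - u) ^ 3 + a₄ * (y - u) ^ 4) (by fun_prop)),
    integral_add (i a₃ 3) (i a₄ 4),
    integral_const_mul, integral_const_mul, integral_const_mul, integral_const_mul,
    integral_const, probReal_univ, one_smul]

variable {μ : Measure ℝ} [IsProbabilityMeasure μ] [NullSingletonClass μ]

theorem integral_symTaylor_spacing {n j k : ℕ} {m : ℝ} (hm : 0 < m) (hk : k ≤ n + 1) (α : ℝ)
    {η u : ℝ} (hu : u = ((k - j : ℕ) : ℝ) / (n + 1)) (hη : η = u - m) {c : ℕ → ℝ}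
    (hc : c = fun r => ∫ x : Fin n → ℝ, ((spacing μ x j k).toReal - u) ^ r ∂sampleLaw μ n) :
    ∫ x : Fin n → ℝ, symTaylor α ((spacing μ x j k).toReal / m) ∂sampleLaw μ n
      = (c 2 + η ^ 2) / m ^ 2 / 2 - (c 3 + 3 * η * c 2 + η ^ 3) / m ^ 3 / 4
        + (α ^ 2 + 15) / 96 * ((c 4 + 4 * η * c 3 + 6 * η ^ 2 * c 2 + η ^ 4) / m ^ 4) := by
  have h1 : c 1 = 0 := by
    have := (betaRecursion_spacing (μ := μ) (j := j) hk).one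
    rw [hc, hu]
    exact this
  set κ := (α ^ 2 + 15) / 96 with hκ
  have e : ∀ x : Fin n → ℝ, symTaylor α ((spacing μ x j k).toReal / m)
      = (η ^ 2 / m ^ 2 / 2 - η ^ 3 / m ^ 3 / 4 + κ * η ^ 4 / m ^ 4)
        + ((2 * η / m ^ 2 / 2 - 3 * η ^ 2 / m ^ 3 / 4 + κ * 4 * η ^ 3 / m ^ 4)
            * ((spacing μ x j k).toReal - u) ^ 1
        + ((1 / m ^ 2 / 2 - 3 * η / m ^ 3 / 4 + κ * 6 * η ^ 2 / m ^ 4)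
            * ((spacing μ x j k).toReal - u) ^ 2
        + ((-(1 / m ^ 3 / 4) + κ * 4 * η / m ^ 4) * ((spacing μ x j k).toReal - u) ^ 3
        + κ / m ^ 4 * ((spacing μ x j k).toReal - u) ^ 4))) := by
    intro x
    rw [symTaylor, ← hκ, hη]
    field_simp
    ring
  have hcr : ∀ r, ∫ x : Fin n → ℝ, ((spacing μ x j k).toReal - u) ^ r ∂sampleLaw μ n = c r :=
    fun r => by rw [hc]
  simp only [e]
  rw [integral_quartic (measurable_toReal_spacing j k) (fun x => toReal_spacing_mem x j k),
    hcr, hcr, hcr, hcr, h1]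
  ring

/-- No samples need excluding here: for large `n` the spacing is almost surely positive and has the
inverse moments required, for every `α`. -/
theorem tendsto_symF_spacing {m : ℝ} (hm : 0 < m) (hm1 : m ≤ 1) (α : ℝ) {j k : ℕ → ℕ} {δ : ℕ → ℝ}
    (hδ : ∀ n, |δ n| ≤ 2)
    (hjk : ∀ᶠ n : ℕ in atTop, k n ≤ n + 1 ∧ ((k n - j n : ℕ) : ℝ) = n * m + δ n) :
    (∀ᶠ n in atTop, Integrable (fun x : Fin n → ℝ =>
      symF α ((spacing μ x (j n) (k n)).toReal / m)) (sampleLaw μ n)) ∧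
    Tendsto (fun n : ℕ => (n : ℝ) ^ 2 * (m *
        ∫ x : Fin n → ℝ, symF α ((spacing μ x (j n) (k n)).toReal / m) ∂sampleLaw μ n
          - (1 - m) / (2 * n)) - movingCoeff α m (δ n)) atTop (𝓝 0) := by
  obtain ⟨q, hq⟩ := exists_nat_ge (1 + |α|)
  obtain ⟨K1, hK1, h1⟩ := exists_integral_spacing_le (μ := μ) hm hm1 2
  obtain ⟨K2, hK2, h2⟩ := exists_integral_singular_spacing_le (μ := μ) hm hm1 q
  have hjk' : ∀ᶠ n : ℕ in atTop, k n ≤ n + 1 ∧ |((k n - j n : ℕ) : ℝ) - n * m| ≤ 2 :=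
    hjk.mono fun n h => ⟨h.1, by rw [h.2, add_sub_cancel_left]; exact hδ n⟩
  have key : ∀ ε : ℝ, 0 < ε → ∃ C, 0 ≤ C ∧ ∀ᶠ n in atTop,
      Integrable (fun x : Fin n → ℝ => symF α ((spacing μ x (j n) (k n)).toReal / m))
        (sampleLaw μ n) ∧
      |∫ x : Fin n → ℝ, symF α ((spacing μ x (j n) (k n)).toReal / m) ∂sampleLaw μ n
        - ∫ x : Fin n → ℝ, symTaylor α ((spacing μ x (j n) (k n)).toReal / m) ∂sampleLaw μ n|
      ≤ ε * ∫ x : Fin n → ℝ, ((spacing μ x (j n) (k n)).toReal / m - 1) ^ 4 ∂sampleLaw μ n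
        + C * ∫ x : Fin n → ℝ, ((spacing μ x (j n) (k n)).toReal / m - 1) ^ 6
          * (((spacing μ x (j n) (k n)).toReal / m)⁻¹) ^ q ∂sampleLaw μ n := by
    intro ε hε
    obtain ⟨C, hC, hrem⟩ := symF_remainder α (1 / m) hq hε
    refine ⟨C, hC, ?_⟩
    filter_upwards [hjk', h2, rank_diff_large hm 1] with n hn h2 h3
    have hint := (h2 (j n) (k n) hn.1 hn.2).1
    have hlt := (h3 _ hn.2).1
    have := integral_symF_sub_symTaylor (P := sampleLaw μ n) (A := Set.univ)
      ((measurable_toReal_spacing (μ := μ) (j n) (k n)).div_const m) MeasurableSet.univ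
      (fun x => div_nonneg ENNReal.toReal_nonneg hm.le)
      (fun x => div_le_div_of_nonneg_right (toReal_spacing_mem x (j n) (k n)).2 hm.le)
      ((ae_spacing_pos hn.1 (by omega)).mono fun x hx _ => div_pos hx hm)
      hint.integrableOn hrem
    simpa only [setIntegral_univ, integrableOn_univ] using this
  refine ⟨(key 1 one_pos).choose_spec.2.mono fun n h => h.1, ?_⟩
  have hD : Tendsto (fun n : ℕ => (n : ℝ) ^ 2 *
      (∫ x : Fin n → ℝ, symF α ((spacing μ x (j n) (k n)).toReal / m) ∂sampleLaw μ n
        - ∫ x : Fin n → ℝ, symTaylor α ((spacing μ x (j n) (k n)).toReal / m) ∂sampleLaw μ n))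
      atTop (𝓝 0) := by
    refine tendsto_sq_mul_of_bound (K := max K1 K2)
      (fun ε hε => (key ε hε).imp fun C h => ⟨h.1, h.2.mono fun n h => h.2⟩) ?_ ?_
    · filter_upwards [hjk', eventually_gt_atTop 0] with n hn hn0
      refine (h1 n (j n) (k n) hn0 hn.1 hn.2).trans ?_
      gcongr
      exact le_max_left _ _
    · filter_upwards [hjk', h2] with n hn h2
      refine (h2 (j n) (k n) hn.1 hn.2).2.trans ?_
      gcongr
      exact le_max_right _ _
  have hT : Tendsto (fun n : ℕ => (n : ℝ) ^ 2 * (m *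
        ∫ x : Fin n → ℝ, symTaylor α ((spacing μ x (j n) (k n)).toReal / m) ∂sampleLaw μ n
          - (1 - m) / (2 * n)) - movingCoeff α m (δ n)) atTop (𝓝 0) := by
    refine tendsto_of_bounded_parameter hδ (continuous_movingCoeff α m) fun l d hl hd => ?_
    have hev := hl hjk
    have := tendsto_betaMoments (c := fun n r => ∫ x : Fin n → ℝ,
      ((spacing μ x (j n) (k n)).toReal - ((n : ℝ) * m + δ n) / (n + 1)) ^ r ∂sampleLaw μ n)
      hm α hl hd (by
        filter_upwards [hev] with n hn
        have := betaRecursion_spacing (μ := μ) (j := j n) hn.1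
        rw [hn.2] at this
        exact this) (η := fun n => ((n : ℝ) * m + δ n) / (n + 1) - m) fun n => rfl
    refine this.congr' ?_
    filter_upwards [hev] with n hn
    rw [integral_symTaylor_spacing (c := fun r => ∫ x : Fin n → ℝ,
      ((spacing μ x (j n) (k n)).toReal - ((n : ℝ) * m + δ n) / (n + 1)) ^ r ∂sampleLaw μ n)
      hm hn.1 α (by rw [hn.2]) rfl rfl]
  have := (hD.const_mul m).add hT
  rw [mul_zero, zero_add] at this
  refine this.congr fun n => ?_
  ring

end SpacingExpansion

/-! ### Random ranks and their shifts -/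

section Ranks

variable {p : ℕ}

theorem rBar_nonpos (n : ℕ) {t : ℝ} (ht : 0 ≤ t) : rBar n t ≤ 0 :=
  sub_nonpos.2 (Nat.floor_le (by positivity))

theorem neg_one_lt_rBar (n : ℕ) (t : ℝ) : -1 < rBar n t := by
  have := Nat.lt_floor_add_one ((n : ℝ) * t)
  rw [rBar]
  linarith

/-- The amount by which the rank exceeds `n * t`. -/
def rankShift (n : ℕ) (t : ℝ) (b : Bool) : ℝ := rBar n t + if b then 1 else 0

theorem cast_rank (n : ℕ) (t : ℝ) (b : Bool) : (rank n t b : ℝ) = n * t + rankShift n t b := by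
  cases b
  · simp [rank, rankShift, rBar]
  · simp [rank, rankShift, rBar]
    ring

theorem abs_rankShift_le (n : ℕ) {t : ℝ} (ht : 0 ≤ t) (b : Bool) : |rankShift n t b| ≤ 1 := by
  have h1 := rBar_nonpos n ht
  have h2 := neg_one_lt_rBar n t
  rw [abs_le]
  cases b <;> simp only [rankShift, Bool.false_eq_true, if_true, if_false] <;>
    constructor <;> linarith

theorem rankProb_nonneg (n : ℕ) {t : ℝ} (ht : 0 ≤ t) (b : Bool) : 0 ≤ rankProb n t b := by
  have h1 := rBar_nonpos n ht
  have h2 := neg_one_lt_rBar n t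
  cases b <;> simp only [rankProb, Bool.false_eq_true, if_true, if_false] <;> linarith

theorem withEnds_uniform {lam : Fin p → ℝ} (hlam : ∀ i, gaps lam i = 1 / ((p : ℝ) + 1))
    (i : Fin (p + 2)) : withEnds 0 1 lam i = (i : ℝ) / (p + 1) := by
  induction i using Fin.induction with
  | zero => simp [withEnds_zero]
  | succ i ih =>
    have := hlam i
    rw [gaps, ih] at this
    rw [sub_eq_iff_eq_add] at this
    rw [this]
    simp
    ring

theorem lam_eq {lam : Fin p → ℝ} (hlam : ∀ i, gaps lam i = 1 / ((p : ℝ) + 1)) (i : Fin p) :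
    lam i = ((i : ℝ) + 1) / (p + 1) := by
  have := withEnds_uniform hlam i.castSucc.succ
  rw [withEnds_mid] at this
  simpa using this

/-- The ranks of the endpoints, including the fictitious ranks `0` and `n + 1`. -/
def endRanks (n : ℕ) (lam : Fin p → ℝ) (b : Fin p → Bool) : Fin (p + 2) → ℕ :=
  withEnds 0 (n + 1) fun i => rank n (lam i) (b i)

/-- The amounts by which the ranks of the endpoints exceed `n` times the nominal values. -/
def endShifts (n : ℕ) (lam : Fin p → ℝ) (b : Fin p → Bool) : Fin (p + 2) → ℝ :=
  withEnds 0 1 fun i => rankShift n (lam i) (b i)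

theorem forall_fin_ends {Q : Fin (p + 2) → Prop} (h0 : Q 0) (h1 : Q (Fin.last (p + 1)))
    (hm : ∀ i : Fin p, Q i.castSucc.succ) (i : Fin (p + 2)) : Q i := by
  refine Fin.cases h0 (fun i => ?_) i
  exact Fin.lastCases (motive := fun i => Q i.succ) h1 hm i

theorem cast_endRanks (n : ℕ) (lam : Fin p → ℝ) (b : Fin p → Bool) (i : Fin (p + 2)) :
    (endRanks n lam b i : ℝ) = n * withEnds 0 1 lam i + endShifts n lam b i := by
  refine forall_fin_ends (Q := fun i =>
    (endRanks n lam b i : ℝ) = n * withEnds 0 1 lam i + endShifts n lam b i) ?_ ?_ (fun i => ?_) i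
  · simp [endRanks, endShifts, withEnds_zero]
  · simp [endRanks, endShifts, withEnds_last]
  · rw [endRanks, endShifts, withEnds_mid, withEnds_mid, withEnds_mid, cast_rank]

theorem abs_endShifts_le (n : ℕ) {lam : Fin p → ℝ} (h : ∀ i, 0 ≤ lam i) (b : Fin p → Bool)
    (i : Fin (p + 2)) : |endShifts n lam b i| ≤ 1 := by
  refine forall_fin_ends (Q := fun i => |endShifts n lam b i| ≤ 1) ?_ ?_ (fun i => ?_) i
  · simp [endShifts, withEnds_zero]
  · simp [endShifts, withEnds_last]
  · rw [endShifts, withEnds_mid]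
    exact abs_rankShift_le n (h i) _

/-- The amount by which the rank difference of a cell exceeds `n` times its nominal probability. -/
def cellShift (n : ℕ) (lam : Fin p → ℝ) (b : Fin p → Bool) (i : Fin (p + 1)) : ℝ :=
  endShifts n lam b i.succ - endShifts n lam b i.castSucc

theorem abs_cellShift_le (n : ℕ) {lam : Fin p → ℝ} (h : ∀ i, 0 ≤ lam i) (b : Fin p → Bool)
    (i : Fin (p + 1)) : |cellShift n lam b i| ≤ 2 := by
  refine (abs_sub _ _).trans ?_
  have := abs_endShifts_le n h b i.succ
  have := abs_endShifts_le n h b i.castSucc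
  linarith

/-- Telescoping: the fictitious top rank `n + 1` exceeds `n * 1` by one. -/
theorem sum_cellShift (n : ℕ) (lam : Fin p → ℝ) (b : Fin p → Bool) :
    ∑ i, cellShift n lam b i = 1 := by
  have := sum_sub_eq (endShifts n lam b)
  rw [endShifts, withEnds_last, withEnds_zero, sub_zero] at this
  exact this

theorem eventually_endRanks {lam : Fin p → ℝ} (hlam : ∀ i, gaps lam i = 1 / ((p : ℝ) + 1))
    (b : Fin p → Bool) (i : Fin (p + 1)) :
    ∀ᶠ n : ℕ in atTop, endRanks n lam b i.succ ≤ n + 1 ∧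
      ((endRanks n lam b i.succ - endRanks n lam b i.castSucc : ℕ) : ℝ)
        = n * (1 / ((p : ℝ) + 1)) + cellShift n lam b i := by
  have hl0 : ∀ i, 0 ≤ lam i := fun i => by rw [lam_eq hlam]; positivity
  have h : Tendsto (fun n : ℕ => (n : ℝ) * (1 / ((p : ℝ) + 1))) atTop atTop :=
    tendsto_natCast_atTop_atTop.atTop_mul_const (by positivity)
  -- Once `n / (p + 1) ≥ 2`, the shift cannot reverse the order of the ranks, so the truncated
  -- subtraction is a true one.
  filter_upwards [h.eventually_ge_atTop 2] with n hn
  have e : (endRanks n lam b i.succ : ℝ) - endRanks n lam b i.castSucc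
      = n * (1 / ((p : ℝ) + 1)) + cellShift n lam b i := by
    rw [cast_endRanks, cast_endRanks, cellShift, ← hlam i, gaps]
    ring
  have hle : endRanks n lam b i.castSucc ≤ endRanks n lam b i.succ := by
    have := (abs_le.1 (abs_cellShift_le n hl0 b i)).1
    have h2 : (endRanks n lam b i.castSucc : ℝ) ≤ endRanks n lam b i.succ := by linarith
    exact_mod_cast h2
  refine ⟨?_, by rw [Nat.cast_sub hle, e]⟩
  have h1 := (abs_le.1 (abs_endShifts_le n hl0 b i.succ)).2
  have h2 : withEnds 0 1 lam i.succ ≤ 1 := by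
    rw [withEnds_uniform hlam]
    refine (div_le_one (by positivity)).2 ?_
    exact_mod_cast Nat.lt_succ_iff.1 i.succ.2
  have h3 : (endRanks n lam b i.succ : ℝ) ≤ n + 1 := by
    rw [cast_endRanks]
    have : (n : ℝ) * withEnds 0 1 lam i.succ ≤ n * 1 := by gcongr
    linarith
  exact_mod_cast h3

end Ranks

/-! ### Averaging over the choice of ranks -/

section Weights

variable {p : ℕ}

/-- The probability of the choice `b` of the ranks. -/
def choiceProb (n : ℕ) (lam : Fin p → ℝ) (b : Fin p → Bool) : ℝ := ∏ i, rankProb n (lam i) (b i)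

/-- Independence of the choices; taking factors `1` off chosen indices gives every mixed moment
below. -/
theorem sum_choiceProb_mul_prod (n : ℕ) (lam : Fin p → ℝ) (g : Fin p → Bool → ℝ) :
    ∑ b, choiceProb n lam b * ∏ i, g i (b i)
      = ∏ i, (rankProb n (lam i) false * g i false + rankProb n (lam i) true * g i true) := by
  have h := Fintype.prod_sum (fun (i : Fin p) (t : Bool) => rankProb n (lam i) t * g i t)
  simp only [Fintype.sum_bool] at h
  rw [Finset.prod_congr rfl fun i _ => add_comm _ _, h]
  refine Finset.sum_congr rfl fun b _ => ?_
  rw [choiceProb, ← Finset.prod_mul_distrib]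

theorem rankProb_false_add_true (n : ℕ) (t : ℝ) : rankProb n t false + rankProb n t true = 1 := by
  simp [rankProb]

theorem sum_choiceProb (n : ℕ) (lam : Fin p → ℝ) : ∑ b, choiceProb n lam b = 1 := by
  have := sum_choiceProb_mul_prod n lam fun _ _ => 1
  simpa [rankProb_false_add_true] using this

theorem choiceProb_nonneg (n : ℕ) {lam : Fin p → ℝ} (h : ∀ i, 0 ≤ lam i) (b : Fin p → Bool) :
    0 ≤ choiceProb n lam b := Finset.prod_nonneg fun i _ => rankProb_nonneg n (h i) _

theorem choiceProb_le_one (n : ℕ) {lam : Fin p → ℝ} (h : ∀ i, 0 ≤ lam i) (b : Fin p → Bool) :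
    choiceProb n lam b ≤ 1 := by
  rw [← sum_choiceProb n lam]
  exact Finset.single_le_sum (fun b _ => choiceProb_nonneg n h b) (Finset.mem_univ b)

theorem mean_rankShift (n : ℕ) (t : ℝ) :
    rankProb n t false * rankShift n t false + rankProb n t true * rankShift n t true = 0 := by
  simp [rankProb, rankShift]
  ring

theorem sum_choiceProb_rankShift (n : ℕ) (lam : Fin p → ℝ) (i : Fin p) :
    ∑ b, choiceProb n lam b * rankShift n (lam i) (b i) = 0 := by
  have h := sum_choiceProb_mul_prod n lam fun l t => if l = i then rankShift n (lam l) t else 1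
  simp only [Finset.prod_ite_eq', Finset.mem_univ, if_true] at h
  rw [h]
  refine Finset.prod_eq_zero (Finset.mem_univ i) ?_
  simp only [if_true]
  exact mean_rankShift n (lam i)

theorem sum_choiceProb_rankShift_mul (n : ℕ) (lam : Fin p → ℝ) {i j : Fin p} (hij : i ≠ j) :
    ∑ b, choiceProb n lam b * (rankShift n (lam i) (b i) * rankShift n (lam j) (b j)) = 0 := by
  have h := sum_choiceProb_mul_prod n lam fun l t =>
    (if l = i then rankShift n (lam l) t else 1) * (if l = j then rankShift n (lam l) t else 1)
  simp only [Finset.prod_mul_distrib, Finset.prod_ite_eq', Finset.mem_univ, if_true] at h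
  rw [h]
  refine Finset.prod_eq_zero (Finset.mem_univ i) ?_
  simp only [if_true, if_neg hij, mul_one]
  exact mean_rankShift n (lam i)

/-- With `r = rBar n (lam i)`, the shift has the Bernoulli variance `-r * (1 + r)`. -/
theorem sum_choiceProb_rankShift_sq_le (n : ℕ) (lam : Fin p → ℝ) (i : Fin p) :
    ∑ b, choiceProb n lam b * rankShift n (lam i) (b i) ^ 2 ≤ 1 / 4 := by
  have h := sum_choiceProb_mul_prod n lam fun l t => if l = i then rankShift n (lam l) t ^ 2 else 1
  simp only [Finset.prod_ite_eq', Finset.mem_univ, if_true] at h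
  rw [h, Finset.prod_eq_single i]
  · simp only [if_true, rankProb, rankShift, Bool.false_eq_true, if_false]
    nlinarith [sq_nonneg (rBar n (lam i) + 1 / 2)]
  · intro l _ hl
    simp [hl, rankProb_false_add_true]
  · simp

/-- Inner neighbours are independent and centred; at the left end a factor is `0`, at the right end
it is the constant `1` times a centred shift. -/
theorem sum_choiceProb_endShifts_mul (n : ℕ) (lam : Fin p → ℝ) (i : Fin (p + 1)) :
    ∑ b, choiceProb n lam b * (endShifts n lam b i.castSucc * endShifts n lam b i.succ) = 0 := by
  cases p with
  | zero =>
    obtain rfl : i = 0 := Fin.ext (by omega)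
    refine Finset.sum_eq_zero fun b _ => ?_
    rw [show (0 : Fin 1).castSucc = 0 from rfl, endShifts, withEnds_zero, zero_mul, mul_zero]
  | succ p =>
    refine Fin.cases ?_ (fun i => ?_) i
    · refine Finset.sum_eq_zero fun b _ => ?_
      rw [Fin.castSucc_zero, endShifts, withEnds_zero, zero_mul, mul_zero]
    · have e1 : ∀ b, endShifts n lam b i.succ.castSucc = rankShift n (lam i) (b i) := fun b => by
        rw [← Fin.succ_castSucc, endShifts, withEnds_mid]
      simp only [e1]
      refine Fin.lastCases ?_ (fun i' => ?_) i
      · simp only [Fin.succ_last, endShifts, withEnds_last, mul_one]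
        exact sum_choiceProb_rankShift n lam _
      · have e2 : ∀ b, endShifts n lam b i'.castSucc.succ.succ
            = rankShift n (lam i'.succ) (b i'.succ) := fun b => by
          rw [Fin.succ_castSucc, endShifts, withEnds_mid]
        simp only [e2]
        refine sum_choiceProb_rankShift_mul n lam ?_
        exact (Fin.castSucc_lt_succ).ne

/-- In the expanded squares each inner shift occurs twice, the top end contributes `1`, and the
cross terms average to zero: `2 * p * (1 / 4) + 1`. -/
theorem sum_choiceProb_cellShift_sq_le (n : ℕ) (lam : Fin p → ℝ) :
    ∑ b, choiceProb n lam b * ∑ i, cellShift n lam b i ^ 2 ≤ p / 2 + 1 := by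
  have e : ∀ b, choiceProb n lam b * ∑ i, cellShift n lam b i ^ 2
      = 2 * ∑ i, choiceProb n lam b * rankShift n (lam i) (b i) ^ 2 + choiceProb n lam b
        - 2 * ∑ i : Fin (p + 1), choiceProb n lam b *
          (endShifts n lam b i.castSucc * endShifts n lam b i.succ) := by
    intro b
    have h1 : ∑ i : Fin (p + 1), endShifts n lam b i.succ ^ 2
        = ∑ i, rankShift n (lam i) (b i) ^ 2 + 1 := by
      rw [Fin.sum_univ_castSucc]
      simp [endShifts, withEnds_mid, withEnds_last]
    have h2 : ∑ i : Fin (p + 1), endShifts n lam b i.castSucc ^ 2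
        = ∑ i, rankShift n (lam i) (b i) ^ 2 := by
      rw [Fin.sum_univ_succ]
      simp [endShifts, withEnds_mid, withEnds_zero]
    have h3 : ∀ i, cellShift n lam b i ^ 2 = endShifts n lam b i.succ ^ 2
        + endShifts n lam b i.castSucc ^ 2
        - 2 * (endShifts n lam b i.castSucc * endShifts n lam b i.succ) := fun i => by
      rw [cellShift]; ring
    rw [Finset.sum_congr rfl fun i _ => h3 i, Finset.sum_sub_distrib, Finset.sum_add_distrib, h1, h2,
      ← Finset.mul_sum, ← Finset.mul_sum, ← Finset.mul_sum]
    ring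
  have c1 : ∑ b, ∑ i, choiceProb n lam b * rankShift n (lam i) (b i) ^ 2
      = ∑ i, ∑ b, choiceProb n lam b * rankShift n (lam i) (b i) ^ 2 := Finset.sum_comm
  have c2 : ∑ b, ∑ i : Fin (p + 1), choiceProb n lam b *
        (endShifts n lam b i.castSucc * endShifts n lam b i.succ)
      = ∑ i : Fin (p + 1), ∑ b, choiceProb n lam b *
        (endShifts n lam b i.castSucc * endShifts n lam b i.succ) := Finset.sum_comm
  rw [Finset.sum_congr rfl fun b _ => e b, Finset.sum_sub_distrib, Finset.sum_add_distrib,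
    ← Finset.mul_sum, ← Finset.mul_sum, c1, sum_choiceProb, c2,
    Finset.sum_congr rfl fun i _ => sum_choiceProb_endShifts_mul n lam i]
  have : ∑ i : Fin p, ∑ b, choiceProb n lam b * rankShift n (lam i) (b i) ^ 2
      ≤ ∑ _i : Fin p, (1 / 4 : ℝ) :=
    Finset.sum_le_sum fun i _ => sum_choiceProb_rankShift_sq_le n lam i
  rw [Finset.sum_const, Finset.card_univ, Fintype.card_fin, nsmul_eq_mul] at this
  rw [Finset.sum_const_zero, mul_zero, sub_zero]
  linarith

end Weights

/-! ### Risk of the moving intervals and the comparison -/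

section Moving

variable {p : ℕ}

theorem withEnds_orderStat {n : ℕ} (x : Fin n → ℝ) (k : Fin p → ℕ) (i : Fin (p + 2)) :
    withEnds ⊥ ⊤ (fun i => orderStat x (k i)) i = orderStat x (withEnds 0 (n + 1) k i) := by
  have h0 : orderStat x 0 = ⊥ := by simp [orderStat]
  have h1 : orderStat x (n + 1) = ⊤ := by simp [orderStat]
  rw [← comp_withEnds (orderStat x), h0, h1]

theorem cellProb_orderStat {n : ℕ} (μ : Measure ℝ) (x : Fin n → ℝ) (k : Fin p → ℕ)
    (i : Fin (p + 1)) :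
    cellProb μ (fun i => orderStat x (k i)) i
      = (spacing μ x (withEnds 0 (n + 1) k i.castSucc) (withEnds 0 (n + 1) k i.succ)).toReal := by
  rw [cellProb, cell, withEnds_orderStat, withEnds_orderStat, spacing, between_eq]
  rfl

/-- The probability of the `i`-th cell of the moving intervals with the ranks chosen by `b`. -/
def movingCell (μ : Measure ℝ) {n : ℕ} (lam : Fin p → ℝ) (b : Fin p → Bool) (i : Fin (p + 1))
    (x : Fin n → ℝ) : ℝ :=
  (spacing μ x (endRanks n lam b i.castSucc) (endRanks n lam b i.succ)).toReal

variable {μ : Measure ℝ} [IsProbabilityMeasure μ] [NullSingletonClass μ] {lam : Fin p → ℝ}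

theorem eventually_riskMovingAt (hlam : ∀ i, gaps lam i = 1 / ((p : ℝ) + 1)) (α : ℝ)
    (b : Fin p → Bool) :
    ∀ᶠ n in atTop, riskMovingAt μ lam α n (fun i => rank n (lam i) (b i)) ≠ ⊤ ∧
      (riskMovingAt μ lam α n fun i => rank n (lam i) (b i)).toReal
        = ∑ i, (1 / ((p : ℝ) + 1)) *
          ∫ x : Fin n → ℝ, symF α (movingCell μ lam b i x / (1 / ((p : ℝ) + 1))) ∂sampleLaw μ n := by
  set m : ℝ := 1 / ((p : ℝ) + 1) with hm
  have hm0 : 0 < m := by positivity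
  have hm1 : m ≤ 1 := by
    rw [hm]
    exact (div_le_one (by positivity)).2 (by linarith [(Nat.cast_nonneg p : (0 : ℝ) ≤ p)])
  have hl0 : ∀ i, 0 ≤ lam i := fun i => by rw [lam_eq hlam]; positivity
  have hint := eventually_all.2 fun i => (tendsto_symF_spacing (μ := μ) hm0 hm1 α
    (fun n => abs_cellShift_le n hl0 b i) (eventually_endRanks hlam b i)).1
  filter_upwards [hint, eventually_all.2 fun i => eventually_endRanks hlam b i,
    rank_diff_large hm0 1] with n hint hr hlarge
  have hpos : ∀ᵐ x ∂sampleLaw μ n, ∀ i, 0 < movingCell μ lam b i x := by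
    refine ae_all_iff.2 fun i => ae_spacing_pos (hr i).1 ?_
    have := (hlarge _ (by
      rw [(hr i).2, add_sub_cancel_left]; exact abs_cellShift_le n hl0 b i)).1
    omega
  have hI : ∀ i ∈ Finset.univ, Integrable (fun x : Fin n → ℝ =>
      m * symF α (movingCell μ lam b i x / m)) (sampleLaw μ n) := fun i _ =>
    (hint i).const_mul m
  have hnn : ∀ᵐ x ∂sampleLaw μ n, 0 ≤ ∑ i, m * symF α (movingCell μ lam b i x / m) := by
    filter_upwards [hpos] with x hx
    exact Finset.sum_nonneg fun i _ => mul_nonneg hm0.le (symF_nonneg α (div_pos (hx i) hm0))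
  have e : riskMovingAt μ lam α n (fun i => rank n (lam i) (b i))
      = ENNReal.ofReal (∫ x, ∑ i, m * symF α (movingCell μ lam b i x / m) ∂sampleLaw μ n) := by
    rw [ofReal_integral_eq_lintegral_ofReal (integrable_finsetSum _ hI) hnn, riskMovingAt]
    refine lintegral_congr_ae ?_
    filter_upwards [hpos] with x hx
    have hc : (cellProb μ fun i => orderStat x (rank n (lam i) (b i)))
        = fun i => movingCell μ lam b i x := funext fun i => cellProb_orderStat μ x _ i
    rw [hc, symDiv_eq (fun i => by rw [hlam]; exact hm0) (fun i => (hx i).le) (Or.inl hx)]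
    simp only [hlam]
  rw [e]
  refine ⟨ENNReal.ofReal_ne_top, ?_⟩
  rw [ENNReal.toReal_ofReal (integral_nonneg_of_ae hnn), integral_finsetSum _ hI]
  exact Finset.sum_congr rfl fun i _ => integral_const_mul _ _

/-- The coefficient of `n ^ (-2)` in the risk of the moving intervals. -/
def movingConst (α : ℝ) (lam : Fin p → ℝ) (n : ℕ) : ℝ :=
  ∑ b, choiceProb n lam b * ∑ i, movingCoeff α (1 / ((p : ℝ) + 1)) (cellShift n lam b i)

theorem secondOrderExpansion_moving (hlam : ∀ i, gaps lam i = 1 / ((p : ℝ) + 1)) (α : ℝ) :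
    SecondOrderExpansion p (riskMoving μ lam α) (movingConst α lam) := by
  set m : ℝ := 1 / ((p : ℝ) + 1) with hm
  have hm0 : 0 < m := by positivity
  have hm1 : m ≤ 1 := by
    rw [hm]
    exact (div_le_one (by positivity)).2 (by linarith [(Nat.cast_nonneg p : (0 : ℝ) ≤ p)])
  have hl0 : ∀ i, 0 ≤ lam i := fun i => by rw [lam_eq hlam]; positivity
  refine secondOrderExpansion_of_tendsto (W := fun n => ∑ b, choiceProb n lam b *
    ∑ i, m * ∫ x : Fin n → ℝ, symF α (movingCell μ lam b i x / m) ∂sampleLaw μ n) ?_ ?_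
  · filter_upwards [eventually_all.2 fun b => eventually_riskMovingAt (μ := μ) hlam α b] with n hn
    have hfin : ∀ b : Fin p → Bool, ENNReal.ofReal (∏ i, rankProb n (lam i) (b i)) *
        riskMovingAt μ lam α n (fun i => rank n (lam i) (b i)) ≠ ⊤ := fun b =>
      ENNReal.mul_ne_top ENNReal.ofReal_ne_top (hn b).1
    refine ⟨ENNReal.sum_ne_top.2 fun b _ => hfin b, ?_⟩
    rw [riskMoving, ENNReal.toReal_sum fun b _ => hfin b]
    refine Finset.sum_congr rfl fun b _ => ?_
    rw [ENNReal.toReal_mul, (hn b).2, ← choiceProb, ENNReal.toReal_ofReal (choiceProb_nonneg n hl0 b)]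
  · have hb : ∀ b : Fin p → Bool, Tendsto (fun n : ℕ => choiceProb n lam b * ∑ i, ((n : ℝ) ^ 2 * (m *
        ∫ x : Fin n → ℝ, symF α (movingCell μ lam b i x / m) ∂sampleLaw μ n
          - (1 - m) / (2 * n)) - movingCoeff α m (cellShift n lam b i))) atTop (𝓝 0) := by
      intro b
      have h1 := tendsto_finsetSum Finset.univ fun i _ => (tendsto_symF_spacing (μ := μ) hm0 hm1 α
        (fun n => abs_cellShift_le n hl0 b i) (eventually_endRanks hlam b i)).2
      rw [Finset.sum_const_zero] at h1
      -- The weights vary with `n` but stay in `[0, 1]`, so each choice of ranks can be treated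
      -- separately.
      refine bdd_le_mul_tendsto_zero' 1 (Filter.Eventually.of_forall fun n => ?_) h1
      rw [abs_of_nonneg (choiceProb_nonneg n hl0 b)]
      exact choiceProb_le_one n hl0 b
    have h2 := tendsto_finsetSum Finset.univ fun b _ => hb b
    rw [Finset.sum_const_zero] at h2
    refine h2.congr fun n => ?_
    have hp : ∑ _i : Fin (p + 1), (1 - m) / (2 * (n : ℝ)) = p / (2 * n) := by
      rw [Finset.sum_const, Finset.card_univ, Fintype.card_fin, nsmul_eq_mul, ← mul_div_assoc]
      congr 1
      rw [hm]
      push_cast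
      field_simp
      ring
    have h3 : ∀ b : Fin p → Bool, choiceProb n lam b * ∑ i, ((n : ℝ) ^ 2 * (m *
        ∫ x : Fin n → ℝ, symF α (movingCell μ lam b i x / m) ∂sampleLaw μ n
          - (1 - m) / (2 * n)) - movingCoeff α m (cellShift n lam b i))
        = (n : ℝ) ^ 2 * (choiceProb n lam b * ∑ i, m *
          ∫ x : Fin n → ℝ, symF α (movingCell μ lam b i x / m) ∂sampleLaw μ n)
          - choiceProb n lam b * ((n : ℝ) ^ 2 * (p / (2 * n)))
          - choiceProb n lam b * ∑ i, movingCoeff α m (cellShift n lam b i) := by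
      intro b
      rw [Finset.sum_sub_distrib, ← Finset.mul_sum, Finset.sum_sub_distrib, hp]
      ring
    rw [Finset.sum_congr rfl fun b _ => h3 b, Finset.sum_sub_distrib, Finset.sum_sub_distrib,
      ← Finset.mul_sum, ← Finset.sum_mul, sum_choiceProb, one_mul, mul_sub, movingConst]

/-- The coefficient is quadratic in the cell shift, and the shifts have a fixed sum, so the random
choice enters only through the mean sum of squares. -/
theorem movingConst_le (lam : Fin p → ℝ) (α : ℝ) (n : ℕ) :
    movingConst α lam n ≤ p * ((α ^ 2 + 7) * p + 8) / 32 := by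
  have hp : (p : ℝ) + 1 ≠ 0 := by positivity
  set m : ℝ := 1 / ((p : ℝ) + 1) with hm
  set a₁ : ℝ := (1 - 4 * m) / (2 * m) - 3 * (1 - m) / (4 * m)
  have hd : ∀ d, movingCoeff α m d = movingCoeff α m 0 + a₁ * d + ((p : ℝ) + 1) / 2 * d ^ 2 := by
    intro d
    simp only [movingCoeff, a₁, hm]
    field_simp
    ring
  have hsum : ∀ b, ∑ i, movingCoeff α m (cellShift n lam b i)
      = ((p + 1) * movingCoeff α m 0 + a₁)
        + ((p : ℝ) + 1) / 2 * ∑ i, cellShift n lam b i ^ 2 := by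
    intro b
    rw [Finset.sum_congr rfl fun i _ => hd (cellShift n lam b i), Finset.sum_add_distrib,
      Finset.sum_add_distrib, ← Finset.mul_sum, sum_cellShift, ← Finset.mul_sum]
    simp
  have e : movingConst α lam n = ((p + 1) * movingCoeff α m 0 + a₁)
      + ((p : ℝ) + 1) / 2 * ∑ b, choiceProb n lam b * ∑ i, cellShift n lam b i ^ 2 := by
    rw [movingConst, Finset.mul_sum]
    have : ∀ b, choiceProb n lam b * ∑ i, movingCoeff α m (cellShift n lam b i)
        = choiceProb n lam b * ((p + 1) * movingCoeff α m 0 + a₁)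
          + ((p : ℝ) + 1) / 2 * (choiceProb n lam b * ∑ i, cellShift n lam b i ^ 2) := by
      intro b
      rw [hsum]
      ring
    rw [Finset.sum_congr rfl fun b _ => this b, Finset.sum_add_distrib, ← Finset.sum_mul,
      sum_choiceProb, one_mul]
  calc movingConst α lam n ≤ ((p + 1) * movingCoeff α m 0 + a₁)
      + ((p : ℝ) + 1) / 2 * (p / 2 + 1) := by
        rw [e]
        have := sum_choiceProb_cellShift_sq_le n lam
        gcongr
    -- Under the worst-case variance `1/4` the value is precisely the minimum in `fixedConst_ge`.
    _ = _ := by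
        simp only [movingCoeff, a₁, hm]
        field_simp
        ring

end Moving

theorem le_add_of_expansions {p : ℕ} {R R' : ℕ → ℝ≥0∞} {d c : ℕ → ℝ}
    (hR : SecondOrderExpansion p R d) (hR' : SecondOrderExpansion p R' c) (hdc : ∀ n, d n ≤ c n)
    {ε : ℝ} (hε : 0 < ε) : ∀ᶠ n : ℕ in atTop, R n ≤ R' n + ENNReal.ofReal (ε / (n : ℝ) ^ 2) := by
  filter_upwards [hR.1, hR'.1, isLittleO_iff.1 hR.2 (half_pos hε), isLittleO_iff.1 hR'.2 (half_pos hε)]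
    with n h1 h2 h3 h4
  rw [← ENNReal.ofReal_toReal h1, ← ENNReal.ofReal_toReal h2,
    ← ENNReal.ofReal_add ENNReal.toReal_nonneg (by positivity)]
  refine ENNReal.ofReal_le_ofReal ?_
  rw [Real.norm_eq_abs, Real.norm_of_nonneg (by positivity)] at h3 h4
  have h5 := (abs_le.1 h3).2
  have h6 := (abs_le.1 h4).1
  have h7 : d n / (n : ℝ) ^ 2 ≤ c n / (n : ℝ) ^ 2 := by
    have := hdc n
    gcongr
  rw [div_eq_mul_inv ε]
  linarith

end Discretization

end

theorem theorem3 (p : ℕ) (α : ℝ) (lam : Fin p → ℝ)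
    (hlam : ∀ i, Discretization.gaps lam i = 1 / ((p : ℝ) + 1)) :
    ∃ d : ℕ → ℝ, ∀ (μ : Measure ℝ) [IsProbabilityMeasure μ], μ ≪ volume →
      Discretization.SecondOrderExpansion p (Discretization.riskMoving μ lam α) d ∧
      ∀ a : Fin p → ℝ, StrictMono a →
        (∀ i, 0 < Discretization.cellProb μ (fun j => (a j : EReal)) i) →
        (∀ ε : ℝ, 0 < ε → ∀ᶠ n : ℕ in atTop,
          Discretization.riskMoving μ lam α n ≤
            Discretization.riskFixed μ a α n + ENNReal.ofReal (ε / (n : ℝ) ^ 2)) ∧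
        ∃ c : ℝ, (∀ n, d n ≤ c) ∧
          Discretization.SecondOrderExpansion p
            (Discretization.riskFixedNonempty μ a α) (fun _ => c) ∧
          (|α| < 1 → Discretization.SecondOrderExpansion p
            (Discretization.riskFixed μ a α) (fun _ => c)) := by
  refine ⟨Discretization.movingConst α lam, fun μ _ hμ => ?_⟩
  -- Absolute continuity enters only through the absence of atoms.
  have : NullSingletonClass μ := ⟨fun x => hμ (measure_singleton x)⟩
  have hmov := Discretization.secondOrderExpansion_moving (μ := μ) hlam α
  refine ⟨hmov, fun a _ ha => ?_⟩
  have hfix := Discretization.secondOrderExpansion_fixedNonempty a ha α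
  have hle : ∀ n, Discretization.movingConst α lam n
      ≤ Discretization.fixedConst α (Discretization.cellProb μ fun j => (a j : EReal)) := fun n =>
    (Discretization.movingConst_le lam α n).trans
      (Discretization.fixedConst_ge α ha (Discretization.sum_cellProb _ ha))
  refine ⟨fun ε hε => ?_, _, hle, hfix, fun hα => Discretization.secondOrderExpansion_fixed a ha hα⟩
  -- The comparison is made with the part of the risk from nonempty cells, which has an expansion
  -- for every `α`; the full risk, possibly infinite, is at least as large.
  filter_upwards [Discretization.le_add_of_expansions hmov hfix hle hε] with n hn
  exact hn.trans (add_le_add_left (setLIntegral_le_lintegral _ _) _)
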